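/- **Setting.** Let $U$ (users, $|U|=n\ge 1$) and $R$ (resources, $|R|=k$) be finite sets. For $A\subseteq U\times R$ write $A(r)=\{u:(u,r)\in A\}$ and $A(u)=\{r:(u,r)\in A\}$; $A$ is *complete* if $A(r)\neq\emptyset$ for all $r\in R$. A *weighted user authorization function* is a map $\omega:U\times 2^R\to\mathbb N$ with $\omega(u,T')\le\omega(u,T)$ whenever $T'\subseteq T$, and with $\omega(u,T)=0$ whenever $\omega(u,\{r\})=0$ for all $r\in T$. An instance $\mathcal I=(R,U,C,\omega)$ of Valued APEP$\langle\mathsf{BoD_E},\mathsf{SoD_U}\rangle$ consists of such an $\omega$ and a finite list $C$ of weighted constraints, each of one of two kinds: - existential binding of duty $c=(r,r',\leftrightarrow,\exists)$: $w_c(A)=0$ if $A(r)\cap A(r')\ne\emptyset$, and $w_c(A)=\ell_c$ otherwise, where $\ell_c\ge 1$ is a constant; - universal separation of duty $c=(r,r',\updownarrow,\forall)$: $w_c(A)=f_c(|A(r)\cap A(r')|)$, where $f_c:\mathbb Z\to\mathbb N$ is non-decreasing and $f_c(z)=0$ iff $z\le 0$. The weight of $A$ is $w(A)=\sum_{u\in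 U}\omega(u,A(u))+\sum_{c\in C}w_c(A)$. The task is to find a complete $A\subseteq U\times R$ of minimum weight among all complete relations (an *optimal solution*); the parameter is $k$. An instance of *Valued WSP* consists of a finite set $S'$ of steps, the user set $U$, a list of weighted constraints $w'_{c'}:U^{S'}\to\mathbb N$, and a weighted user authorization function $\omega':U\times 2^{S'}\to\mathbb N$. The weight of a plan $\pi:S'\to U$ is $\sum_{u}\omega'(u,\pi^{-1}(u))+\sum_{c'}w'_{c'}(\pi)$, and an optimal plan is one of minimum weight. A weighted constraint $w'$ is *user-independent* if $w'(\sigma\circ\pi)=w'(\pi)$ for every permutation $\sigma$ of $U$ and every plan $\pi$. **Construction.** Given $\mathcal I$, let $\Gamma(r)$ be the set of all $r'$ such that $C$ contains an existential binding-of-duty constraint on $r,r'$ (in either order). Let $S^r=\{s^r\}$ if $\Gamma(r)=\emptyset$, and $S^r=\{s^r_{r'}:r'\in\Gamma(r)\}$ otherwise; let $S'=\bigsqcup_{r\in R}S^r$. Each $(r,r',\leftrightarrow,\exists)\in C$ is replaced by the constraint of weight $0$ if $\pi(s^r_{r'})=\pi(s^{r'}_r)$ and $\ell_c$ otherwise;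 each $(r,r',\updownarrow,\forall)\in C$ is replaced by the constraint of weight $f_c(|\pi(S^r)\cap\pi(S^{r'})|)$; and $\omega'(u,T)=\omega(u,\{r:T\cap S^r\ne\emptyset\})$. Call the resulting Valued WSP instance $\mathcal I'$. **Model.** Algorithms are programs of a random access machine with unit-cost addition, truncated subtraction, zero test and indirect addressing. The numbers $\omega(u,T)$, $\ell_c$ and $f_c(0),\dots,f_c(n)$ are stored one per memory cell; set $|\mathcal I|=k+n+|C|$. Time $\mathcal O^*(f(k))$ means that a single program and an absolute constant $c$ exist such that the program solves every instance within $c\,f(k)\,|\mathcal I|^{c}$ time units; polynomial time means $\mathcal O^*(1)$. A problem is fixed-parameter tractable if it is solvable in time $\mathcal O^*(f(k))$ for some computable $f$. **Theorem.** 1. Valued APEP$\langle\mathsf{BoD_E},\mathsf{SoD_U}\rangle$ is fixed-parameter tractable and can be solved in time $\mathcal O^*(4^{k^2\log_2 k})$ (where $k^2\log_2 k$ is read as $0$ for $k=0$). 2. All weighted constraints of $\mathcal I'$ are user-independent. If no existential binding-of-duty constraint of $\mathcal I$ has $r=r'$, then $|S'|\le\max\{k,k(k-1)\}$; in particular $|S'|\le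 k(k-1)$ when $k\ge 2$. 3. The weight of an optimal solution of $\mathcal I$ equals the weight of an optimal plan of $\mathcal I'$. If $\pi$ is an optimal plan of $\mathcal I'$, then the relation $A$ with $A(r)=\pi(S^r)$ for all $r\in R$ is an optimal solution of $\mathcal I$. 4. The instance $\mathcal I'$ is computable from $\mathcal I$ in time polynomial in $|\mathcal I|$, in the sense that its step set, the weight $\omega'(u,T)$ for given $u\in U$ and $T\subseteq S'$, and the weight $w'_{c'}(\pi)$ for a given constraint $c'$ and a given plan $\pi$ are computable in polynomial time. Given an optimal plan of $\mathcal I'$, an optimal solution of $\mathcal I$ can be computed in polynomial time. -/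

import Mathlib

/-! ## Machine model: a random access machine with unit-cost addition and subtraction

A state has number registers and numbered memory banks (arrays) whose cells hold natural numbers.
A program is a finite text, so it only names finitely many registers and banks. There is no
multiplication or shift: a step can at most double the largest number present. -/

structure RAMState where
  reg : ℕ → ℕ
  mem : ℕ → ℕ → ℕ

inductive RAMExpr where
  | const (v : ℕ)
  | reg (i : ℕ)
  | add (a b : RAMExpr)
  /-- Truncated subtraction. -/
  | sub (a b : RAMExpr)
  /-- The content of the cell of bank `bank` whose address is the value of `a`. -/
  | load (bank : ℕ) (a : RAMExpr)

namespace RAMExpr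

def eval (s : RAMState) : RAMExpr → ℕ
  | const v => v
  | reg i => s.reg i
  | add a b => a.eval s + b.eval s
  | sub a b => a.eval s - b.eval s
  | load bank a => s.mem bank (a.eval s)

/-- One time unit for each operation, constant and register access. -/
def cost : RAMExpr → ℕ
  | const _ => 1
  | reg _ => 1
  | add a b => a.cost + b.cost + 1
  | sub a b => a.cost + b.cost + 1
  | load _ a => a.cost + 1

end RAMExpr

inductive RAMProg where
  | skip
  /-- Register `i` := value of `e`. -/
  | assign (i : ℕ) (e : RAMExpr)
  /-- Cell `a` of bank `bank` := value of `e`. -/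
  | store (bank : ℕ) (a e : RAMExpr)
  | seq (p q : RAMProg)
  /-- If `e ≠ 0` then `p` else `q`. -/
  | ite (e : RAMExpr) (p q : RAMProg)
  /-- While `e ≠ 0` do `p`. -/
  | loop (e : RAMExpr) (p : RAMProg)

/-- `RAMProg.Runs p s s' t`: started in `s`, the program `p` halts in `s'` after exactly `t` time
units. -/
inductive RAMProg.Runs : RAMProg → RAMState → RAMState → ℕ → Prop
  | skip (s : RAMState) : Runs .skip s s 1
  | assign (i : ℕ) (e : RAMExpr) (s : RAMState) :
      Runs (.assign i e) s ⟨Function.update s.reg i (e.eval s), s.mem⟩ (e.cost + 1)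
  | store (bank : ℕ) (a e : RAMExpr) (s : RAMState) :
      Runs (.store bank a e) s
        ⟨s.reg, Function.update s.mem bank
          (Function.update (s.mem bank) (a.eval s) (e.eval s))⟩
        (a.cost + e.cost + 1)
  | seq {p q : RAMProg} {s s₁ s₂ : RAMState} {t₁ t₂ : ℕ} :
      Runs p s s₁ t₁ → Runs q s₁ s₂ t₂ → Runs (.seq p q) s s₂ (t₁ + t₂)
  | iteTrue {e : RAMExpr} {p q : RAMProg} {s s' : RAMState} {t : ℕ} :
      e.eval s ≠ 0 → Runs p s s' t → Runs (.ite e p q) s s' (e.cost + t + 1)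
  | iteFalse {e : RAMExpr} {p q : RAMProg} {s s' : RAMState} {t : ℕ} :
      e.eval s = 0 → Runs q s s' t → Runs (.ite e p q) s s' (e.cost + t + 1)
  | loopTrue {e : RAMExpr} {p : RAMProg} {s s₁ s₂ : RAMState} {t₁ t₂ : ℕ} :
      e.eval s ≠ 0 → Runs p s s₁ t₁ → Runs (.loop e p) s₁ s₂ t₂ →
      Runs (.loop e p) s s₂ (e.cost + t₁ + t₂ + 1)
  | loopFalse {e : RAMExpr} {p : RAMProg} {s : RAMState} :
      e.eval s = 0 → Runs (.loop e p) s s (e.cost + 1)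

/-- A parameterized (search) problem: the instance `x` is presented to the machine in the state
`input x`, and `Correct x s` says that the final state `s` holds a correct answer for `x`. -/
structure ParamProblem where
  Inst : Type
  input : Inst → RAMState
  size : Inst → ℕ
  param : Inst → ℕ
  Correct : Inst → RAMState → Prop

/-- Solvable in time `O(f(κ) * |x| ^ c)` for an absolute constant `c`, by one program for all
instances; that is, in time `O*(f(κ))`. -/
def ParamProblem.SolvableInOStar (Q : ParamProblem) (f : ℕ → ℝ) : Prop :=
  ∃ (p : RAMProg) (c : ℕ), ∀ x : Q.Inst, ∃ (s : RAMState) (t : ℕ),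
    p.Runs (Q.input x) s t ∧ Q.Correct x s ∧
    (t : ℝ) ≤ c * (f (Q.param x) * (Q.size x : ℝ) ^ c)

/-- Fixed-parameter tractable: solvable in time `O*(f(κ))` for some computable `f`. -/
def ParamProblem.IsFPT (Q : ParamProblem) : Prop :=
  ∃ f : ℕ → ℕ, Computable f ∧ Q.SolvableInOStar (fun k => (f k : ℝ))

/-- Solvable in time `O(|x| ^ c)`. -/
def ParamProblem.IsPolyTime (Q : ParamProblem) : Prop :=
  Q.SolvableInOStar (fun _ => 1)

/-! ## Valued APEP and Valued WSP -/

/-- A weighted user authorization function on users `U` and resources (or steps) `X`. User `u` is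
authorized for `x` iff `u` has weight zero on `{x}`. -/
structure WeightedAuth (U X : Type) where
  toFun : U → Finset X → ℕ
  zero_of_authorized : ∀ u T, (∀ x ∈ T, toFun u {x} = 0) → toFun u T = 0
  mono : ∀ u T' T, T' ⊆ T → toFun u T' ≤ toFun u T

section Rel

variable {U R : Type} [Fintype U] [DecidableEq U] [Fintype R] [DecidableEq R]

/-- `A(r)`. -/
def usersOf (A : Finset (U × R)) (r : R) : Finset U :=
  Finset.univ.filter fun u => (u, r) ∈ A

/-- `A(u)`. -/
def resourcesOf (A : Finset (U × R)) (u : U) : Finset R :=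
  Finset.univ.filter fun r => (u, r) ∈ A

end Rel

/-- An instance of Valued APEP: weighted constraints, and a weighted user authorization
function. -/
structure ValuedAPEP (U R : Type) where
  constraints : List (Finset (U × R) → ℕ)
  auth : WeightedAuth U R

namespace ValuedAPEP

variable {U R : Type} [Fintype U] [DecidableEq U] [Fintype R] [DecidableEq R]

/-- `w(A) = Ω(A) + w_C(A)`. -/
def weight (I : ValuedAPEP U R) (A : Finset (U × R)) : ℕ :=
  ∑ u, I.auth.toFun u (resourcesOf A u) + (I.constraints.map fun w => w A).sum

def Complete (A : Finset (U × R)) : Prop :=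
  ∀ r : R, (usersOf A r).Nonempty

/-- A complete authorization relation of minimum weight among the complete ones. -/
def IsSolution (I : ValuedAPEP U R) (A : Finset (U × R)) : Prop :=
  Complete A ∧ ∀ A' : Finset (U × R), Complete A' → I.weight A ≤ I.weight A'

/-- `m` is the weight of an optimal solution. -/
def IsOPT (I : ValuedAPEP U R) (m : ℕ) : Prop :=
  IsLeast {x | ∃ A : Finset (U × R), Complete A ∧ I.weight A = x} m

end ValuedAPEP

/-- An instance of Valued WSP on steps `S`: weighted constraints on plans `S → U`, and a weighted
authorization policy. -/
structure ValuedWSP (U S : Type) where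
  constraints : List ((S → U) → ℕ)
  auth : WeightedAuth U S

namespace ValuedWSP

variable {U S : Type} [Fintype U] [DecidableEq U] [Fintype S] [DecidableEq S]

def weight (J : ValuedWSP U S) (π : S → U) : ℕ :=
  ∑ u, J.auth.toFun u (Finset.univ.filter fun s => π s = u) +
    (J.constraints.map fun w => w π).sum

def IsOptimalPlan (J : ValuedWSP U S) (π : S → U) : Prop :=
  ∀ π' : S → U, J.weight π ≤ J.weight π'

/-- `m` is the weight of an optimal plan. -/
def IsOPT (J : ValuedWSP U S) (m : ℕ) : Prop :=
  IsLeast (Set.range J.weight) m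

/-- A weighted constraint on plans is user-independent if permuting the users never changes its
weight. -/
def UserIndependent (w : (S → U) → ℕ) : Prop :=
  ∀ (σ : Equiv.Perm U) (π : S → U), w (σ ∘ π) = w π

end ValuedWSP

/-! ## Existential binding of duty and universal separation of duty -/

structure PenaltyFun where
  toFun : ℤ → ℕ
  mono : ∀ z, toFun z ≤ toFun (z + 1)
  zero_iff : ∀ z, toFun z = 0 ↔ z ≤ 0

inductive BSConstraint (R : Type) where
  /-- `(r, r', ↔, ∃)` with violation weight `l`. -/
  | bodE (r r' : R) (l : ℕ) (hl : 0 < l)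
  /-- `(r, r', ↕, ∀)` with penalty function `f`. -/
  | sodU (r r' : R) (f : PenaltyFun)

def BSConstraint.weight {U R : Type} [Fintype U] [DecidableEq U] [DecidableEq R] :
    BSConstraint R → Finset (U × R) → ℕ
  | bodE r r' l _, A => if (usersOf A r ∩ usersOf A r').Nonempty then 0 else l
  | sodU r r' f, A => f.toFun ((usersOf A r ∩ usersOf A r').card : ℤ)

/-- An instance of Valued APEP all of whose constraints are existential BoD or universal SoD. -/
structure BSInstance (U R : Type) where
  C : List (BSConstraint R)
  auth : WeightedAuth U R

namespace BSInstance

variable {U R : Type} [Fintype U] [DecidableEq U] [Fintype R] [DecidableEq R]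

def toAPEP (I : BSInstance U R) : ValuedAPEP U R where
  constraints := I.C.map BSConstraint.weight
  auth := I.auth

/-- `r' ∈ Γ(r)`: some existential BoD constraint links `r` and `r'`. -/
def Linked (I : BSInstance U R) (r r' : R) : Prop :=
  ∃ (l : ℕ) (hl : 0 < l),
    BSConstraint.bodE r r' l hl ∈ I.C ∨ BSConstraint.bodE r' r l hl ∈ I.C

/-- The pair `(r, none)` is the step `s^r`, present if `Γ(r) = ∅`; the pair `(r, some r')` is the
step `s^r_{r'}`, present if `r' ∈ Γ(r)`. -/
def IsStep (I : BSInstance U R) : R × Option R → Prop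
  | (r, none) => ∀ r', ¬ I.Linked r r'
  | (r, some r') => I.Linked r r'

/-- The step set `S'`. -/
abbrev Step (I : BSInstance U R) : Type :=
  {p : R × Option R // I.IsStep p}

noncomputable instance (I : BSInstance U R) : DecidablePred I.IsStep :=
  Classical.decPred _

/-- `π(S^r)`. -/
noncomputable def stepUsers (I : BSInstance U R) (π : I.Step → U) (r : R) : Finset U :=
  (Finset.univ.filter fun s : I.Step => s.1.1 = r).image π

/-- The weighted constraint on plans that replaces the constraint `c`: for existential BoD between
`r` and `r'`, the steps `s^r_{r'}` and `s^{r'}_r` must have the same user; for universal SoD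
between `r` and `r'`, the users in `π(S^r) ∩ π(S^{r'})` are penalized. -/
noncomputable def planConstraint (I : BSInstance U R) :
    (c : BSConstraint R) → c ∈ I.C → (I.Step → U) → ℕ
  | .bodE r r' l hl, hc, π =>
      if π ⟨(r, some r'), ⟨l, hl, Or.inl hc⟩⟩ = π ⟨(r', some r), ⟨l, hl, Or.inr hc⟩⟩
      then 0 else l
  | .sodU r r' f, _, π => f.toFun ((I.stepUsers π r ∩ I.stepUsers π r').card : ℤ)

/-- `R_T`: the resources to which the steps in `T` belong. -/
def resourcesOfSteps (I : BSInstance U R) (T : Finset I.Step) : Finset R :=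
  T.image fun s => s.1.1

/-- `ω'(u, T) = ω(u, R_T)`. -/
def wspAuth (I : BSInstance U R) : WeightedAuth U I.Step where
  toFun u T := I.auth.toFun u (I.resourcesOfSteps T)
  zero_of_authorized u T h := by
    refine I.auth.zero_of_authorized u _ fun r hr => ?_
    obtain ⟨s, hs, rfl⟩ := Finset.mem_image.mp hr
    simpa [resourcesOfSteps] using h s hs
  mono u T' T h := I.auth.mono u _ _ (Finset.image_subset_image h)

/-- The Valued WSP instance built from `I`. -/
noncomputable def toWSP (I : BSInstance U R) : ValuedWSP U I.Step where
  constraints := I.C.attach.map fun c => I.planConstraint c.1 c.2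
  auth := I.wspAuth

/-- The authorization relation read off a plan: `A(r) = π(S^r)`. -/
noncomputable def relOfPlan (I : BSInstance U R) (π : I.Step → U) : Finset (U × R) :=
  Finset.univ.filter fun p => p.1 ∈ I.stepUsers π p.2

end BSInstance

/-! ## Presentation of instances to the machine

Users are `0, ..., n - 1` and resources are `0, ..., k - 1`. Weights are stored one per memory
cell, so that every single weight can be looked up. -/

namespace BSConstraint

variable {k : ℕ}

def kind : BSConstraint (Fin k) → ℕ
  | bodE _ _ _ _ => 0
  | sodU _ _ _ => 1

def fst : BSConstraint (Fin k) → ℕ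
  | bodE r _ _ _ => r
  | sodU r _ _ => r

def snd : BSConstraint (Fin k) → ℕ
  | bodE _ r' _ _ => r'
  | sodU _ r' _ => r'

/-- The violation weight, respectively the value of the penalty function at `x`. -/
def table : BSConstraint (Fin k) → ℕ → ℕ
  | bodE _ _ l _, _ => l
  | sodU _ _ f, x => f.toFun (x : ℤ)

end BSConstraint

/-- The set of resources whose bits are set in `a`. -/
def maskSet (k a : ℕ) : Finset (Fin k) :=
  Finset.univ.filter fun r => Nat.testBit a r = true

/-- Number of the pair `(r, none)` or `(r, some r')`. -/
def stepCode {k : ℕ} : Fin k × Option (Fin k) → ℕ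
  | (r, none) => r * (k + 1)
  | (r, some r') => r * (k + 1) + (r' + 1)

namespace BSInstance

variable {n k : ℕ}

/-- Bank 0: `k`, `n`, `|C|`. Bank 1: `ω(u, T)` at `u * 2 ^ k + ∑ r ∈ T, 2 ^ r`. Banks 2, 3, 4:
kind, first and second resource of the constraints. Bank 5: the weights of constraint number `i`
for `x = 0, ..., n` violating users, at `i * (n + 1) + x`. All other cells are zero. -/
def memory (I : BSInstance (Fin n) (Fin k)) : ℕ → ℕ → ℕ
  | 0, 0 => k
  | 0, 1 => n
  | 0, 2 => I.C.length
  | 1, a => if h : a < n * 2 ^ k then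
      I.auth.toFun ⟨a / 2 ^ k, Nat.div_lt_of_lt_mul (by rwa [mul_comm])⟩ (maskSet k (a % 2 ^ k))
      else 0
  | 2, i => (I.C[i]?).elim 0 BSConstraint.kind
  | 3, i => (I.C[i]?).elim 0 BSConstraint.fst
  | 4, i => (I.C[i]?).elim 0 BSConstraint.snd
  | 5, a => (I.C[a / (n + 1)]?).elim 0 fun c => c.table (a % (n + 1))
  | _, _ => 0

/-- The input state: all registers zero, except that register 0 may hold an additional number; bank
7 may hold an additional array. -/
def inputState (I : BSInstance (Fin n) (Fin k)) (r0 : ℕ) (aux : ℕ → ℕ) : RAMState where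
  reg := Function.update (fun _ => 0) 0 r0
  mem := Function.update I.memory 7 aux

/-- A plan as an array indexed by the numbers of the steps. -/
noncomputable def planArray (I : BSInstance (Fin n) (Fin k)) (π : I.Step → Fin n) : ℕ → ℕ :=
  fun a => ∑ s : I.Step, if stepCode s.1 = a then (π s : ℕ) else 0

/-- A set of steps as an array of zeros and ones. -/
def stepSetArray (I : BSInstance (Fin n) (Fin k)) (T : Finset I.Step) : ℕ → ℕ :=
  fun a => ∑ s ∈ T, if stepCode s.1 = a then 1 else 0

end BSInstance

/-- The authorization relation in the output bank (bank 6). -/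
def outputRel (n k : ℕ) (s : RAMState) : Finset (Fin n × Fin k) :=
  Finset.univ.filter fun p => s.mem 6 (p.1 * k + p.2) ≠ 0

/-- An instance with numbered users and resources and at least one user. -/
structure NumberedInstance where
  n : ℕ
  k : ℕ
  n_pos : 0 < n
  I : BSInstance (Fin n) (Fin k)

/-- `k + n + |C|`: it counts neither the table of authorization weights nor the lengths of the
weights, so a bound in terms of it is also one in terms of the length of the whole input. -/
def NumberedInstance.size (x : NumberedInstance) : ℕ :=
  x.k + x.n + x.I.C.length

/-- Valued APEP with existential BoD and universal SoD constraints, parameterized by the number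
of resources: output a complete authorization relation of minimum weight. -/
def valuedAPEPBoDESoDU : ParamProblem where
  Inst := NumberedInstance
  input x := x.I.inputState 0 fun _ => 0
  size x := x.size
  param x := x.k
  Correct x s := x.I.toAPEP.IsSolution (outputRel x.n x.k s)

/-- Compute the step set of the Valued WSP instance, as an array of zeros and ones. -/
def computeSteps : ParamProblem where
  Inst := NumberedInstance
  input x := x.I.inputState 0 fun _ => 0
  size x := x.size
  param x := x.k
  Correct x s := ∀ p : Fin x.k × Option (Fin x.k),
    (x.I.IsStep p → s.mem 6 (stepCode p) = 1) ∧ (¬ x.I.IsStep p → s.mem 6 (stepCode p) = 0)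

/-- Compute the authorization weight of a given user and set of steps in the Valued WSP
instance. -/
def computeWSPAuth : ParamProblem where
  Inst := Σ x : NumberedInstance, Fin x.n × Finset x.I.Step
  input y := y.1.I.inputState y.2.1 (y.1.I.stepSetArray y.2.2)
  size y := y.1.size
  param y := y.1.k
  Correct y s := s.reg 0 = y.1.I.toWSP.auth.toFun y.2.1 y.2.2

/-- Compute the weight of a given constraint of the Valued WSP instance on a given plan. -/
noncomputable def computeWSPConstraint : ParamProblem where
  Inst := Σ x : NumberedInstance, Fin x.I.C.length × (x.I.Step → Fin x.n)
  input y := y.1.I.inputState y.2.1 (y.1.I.planArray y.2.2)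
  size y := y.1.size
  param y := y.1.k
  Correct y s := s.reg 0 = y.1.I.planConstraint y.1.I.C[y.2.1] (List.getElem_mem _) y.2.2

/-- Given an optimal plan of the Valued WSP instance, output a complete authorization relation of
minimum weight for the Valued APEP instance. -/
noncomputable def solutionFromPlan : ParamProblem where
  Inst := Σ x : NumberedInstance, {π : x.I.Step → Fin x.n // x.I.toWSP.IsOptimalPlan π}
  input y := y.1.I.inputState 0 (y.1.I.planArray y.2.1)
  size y := y.1.size
  param y := y.1.k
  Correct y s := y.1.I.toAPEP.IsSolution (outputRel y.1.n y.1.k s)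

/-! Reduction. A plan π gives the relation A(r) = π(S^r), which is complete because every S^r is
nonempty. Its authorization and separation weights are those of π, and its binding penalties can
only be smaller (`weight_relOfPlan_le`). Conversely, let a complete A assign to s^r_{r'} and
s^{r'}_r one common member of A(r) ∩ A(r') if there is one, and to all other steps of r any member
of A(r). Then π(S^r) ⊆ A(r), so monotonicity of ω and of the penalty functions shows that the plan
weighs no more than A (`weight_planOfRel_le`). Hence the optima agree and optimal plans yield
optimal solutions.

Algorithm. As |S'| ≤ k², some optimal solution gives resources to at most k² users
(`exists_isSolution_card_le`). Completeness and all constraint weights depend only on the k(k+1)/2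
numbers |A(r) ∩ A(r')|, r ≤ r'. With B = k² + 1, these numbers are the digits of a single number in
base B, with the number of active users (those with a resource) on top. This code is a sum of
contributions of the single users, and no carries occur as long as fewer than B users are active
(`PairCode.common_eq_of_sum_code_eq`). Minimizing the authorization weight for a prescribed code is
therefore a knapsack problem in which each user picks a set T ⊆ R, with the code of T as size and
ω(u,T) as cost. One dynamic program solves it for all M = B^(k(k+1)/2 + 1) codes. For each code one
optimal choice is read off, tested for completeness and charged with the constraint weights; the
best code gives an optimal solution (`isSolution_of_minUpTo`). The time is M · 2^k up to a
polynomial, and M · 2^k is at most k^(2k²) = 4^(k² log₂ k) up to a polynomial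
(`codeBound_mul_two_pow_le`).

Machine. Programs are written with counting loops only. Their effect is then a total function
`exec`, their running time has a bound computed from the text (`runs`), loops are verified by
invariants (`exec_loop_induct`), and `time_le_largeTime` separates the few loops of superpolynomial
length from the rest. -/

namespace RAMState

/-! ### Writing to registers and memory cells -/

@[ext]
theorem ext {s s' : RAMState} (hr : ∀ i, s.reg i = s'.reg i) (hm : ∀ b a, s.mem b a = s'.mem b a) :
    s = s' := by
  cases s; cases s'
  simp only [RAMState.mk.injEq]
  exact ⟨funext hr, funext fun b => funext (hm b)⟩

/-- Write a register. -/
def setReg (s : RAMState) (i v : ℕ) : RAMState :=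
  ⟨Function.update s.reg i v, s.mem⟩

/-- Write a memory cell. -/
def setMem (s : RAMState) (b a v : ℕ) : RAMState :=
  ⟨s.reg, Function.update s.mem b (Function.update (s.mem b) a v)⟩

@[simp] theorem setReg_reg (s : RAMState) (i v j : ℕ) :
    (s.setReg i v).reg j = if j = i then v else s.reg j := by
  simp [setReg, Function.update_apply]

@[simp] theorem setReg_mem (s : RAMState) (i v : ℕ) : (s.setReg i v).mem = s.mem := rfl

@[simp] theorem setMem_reg (s : RAMState) (b a v : ℕ) : (s.setMem b a v).reg = s.reg := rfl

theorem setMem_mem_apply (s : RAMState) (b a v b' a' : ℕ) :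
    (s.setMem b a v).mem b' a' = if b' = b ∧ a' = a then v else s.mem b' a' := by
  by_cases hb : b' = b
  · subst hb
    simp [setMem, Function.update_apply]
  · simp [setMem, hb]

@[simp] theorem setMem_mem_same (s : RAMState) (b a v a' : ℕ) :
    (s.setMem b a v).mem b a' = if a' = a then v else s.mem b a' := by
  simp [setMem_mem_apply]

theorem setMem_mem_of_ne (s : RAMState) {b b' : ℕ} (a v : ℕ) (h : b' ≠ b) :
    (s.setMem b a v).mem b' = s.mem b' := by
  funext a'
  simp [setMem_mem_apply, h]

end RAMState

/-! ## A language of counting loops -/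

/-- Programs whose only loops run a register through the values below another register. -/
inductive LProg where
  | skip
  | assign (i : ℕ) (e : RAMExpr)
  | store (bank : ℕ) (a e : RAMExpr)
  | seq (p q : LProg)
  | ite (e : RAMExpr) (p q : LProg)
  /-- For register `i` from `0` to the value of register `b`, exclusive, do `p`. -/
  | loop (i b : ℕ) (p : LProg)

namespace LProg

def compile : LProg → RAMProg
  | skip => .skip
  | assign i e => .assign i e
  | store b a e => .store b a e
  | seq p q => .seq p.compile q.compile
  | ite e p q => .ite e p.compile q.compile
  | loop i b p => .seq (.assign i (.const 0))
      (.loop (.sub (.reg b) (.reg i)) (.seq p.compile (.assign i (.add (.reg i) (.const 1)))))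

/-- The final state. -/
def exec : LProg → RAMState → RAMState
  | skip, s => s
  | assign i e, s => s.setReg i (e.eval s)
  | store b a e, s => s.setMem b (a.eval s) (e.eval s)
  | seq p q, s => q.exec (p.exec s)
  | ite e p q, s => if e.eval s = 0 then q.exec s else p.exec s
  -- The bound is read once here, while the compiled loop reads register `b` again at every turn;
  -- `wf` makes the two agree.
  | loop i b p, s =>
      (fun s' => (p.exec s').setReg i ((p.exec s').reg i + 1))^[s.reg b] (s.setReg i 0)

/-- The program contains an assignment to register `x`. -/
def writesReg : LProg → ℕ → Bool
  | skip, _ => false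
  | assign i _, x => x == i
  | store _ _ _, _ => false
  | seq p q, x => p.writesReg x || q.writesReg x
  | ite _ p q, x => p.writesReg x || q.writesReg x
  | loop i _ p, x => x == i || p.writesReg x

/-- The program contains an assignment to a cell of bank `x`. -/
def writesMem : LProg → ℕ → Bool
  | skip, _ => false
  | assign _ _, _ => false
  | store b _ _, x => x == b
  | seq p q, x => p.writesMem x || q.writesMem x
  | ite _ p q, x => p.writesMem x || q.writesMem x
  | loop _ _ p, x => p.writesMem x

/-- The registers that bound the loops. -/
def bounds : LProg → List ℕ
  | skip => []
  | assign _ _ => []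
  | store _ _ _ => []
  | seq p q => p.bounds ++ q.bounds
  | ite _ p q => p.bounds ++ q.bounds
  | loop _ b p => b :: p.bounds

/-- No loop body assigns to the counter of the loop. -/
def countersOk : LProg → Bool
  | skip => true
  | assign _ _ => true
  | store _ _ _ => true
  | seq p q => p.countersOk && q.countersOk
  | ite _ p q => p.countersOk && q.countersOk
  | loop i _ p => !p.writesReg i && p.countersOk

/-- No loop body assigns to the counter of the loop, and the program does not assign to the
bounds of its loops. -/
def wf (p : LProg) : Bool :=
  p.countersOk && p.bounds.all fun b => !p.writesReg b

/-- A bound on the running time in terms of the registers that bound the loops. -/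
def time : LProg → (ℕ → ℕ) → ℕ
  | skip, _ => 1
  | assign _ e, _ => e.cost + 1
  | store _ a e, _ => a.cost + e.cost + 1
  | seq p q, v => p.time v + q.time v
  | ite e p q, v => e.cost + p.time v + q.time v + 1
  -- A turn costs 4 for the test and 4 for the increment besides the body; 6 is 2 for resetting the
  -- counter and 4 for the failing test.
  | loop _ b p, v => v b * (p.time v + 8) + 6

/-- Both premises are Boolean computations on the program text, so for a concrete program they hold
by `rfl`. This carries unchanged registers and banks past whole subprograms. -/
theorem exec_frame (p : LProg) (s : RAMState) :
    (∀ x, p.writesReg x = false → (p.exec s).reg x = s.reg x) ∧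
      ∀ x, p.writesMem x = false → (p.exec s).mem x = s.mem x := by
  induction p generalizing s with
  | skip => simp [exec]
  | assign i e => simp +contextual [exec, writesReg]
  | store b a e =>
    refine ⟨fun x _ => rfl, fun x hx => ?_⟩
    exact RAMState.setMem_mem_of_ne _ _ _ (by simpa [writesMem] using hx)
  | seq p q hp hq =>
    simp +contextual [exec, writesReg, writesMem, hp, hq]
  | ite e p q hp hq =>
    by_cases h : e.eval s = 0 <;> simp +contextual [exec, writesReg, writesMem, hp, hq, h]
  | loop i b p hp =>
    simp only [exec, writesReg, writesMem]
    generalize s.reg b = N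
    induction N with
    | zero => simp +contextual
    | succ N ih =>
      rw [Function.iterate_succ_apply']
      refine ⟨fun x hx => ?_, fun x hx => ?_⟩
      · have h1 := ih.1 x hx
        simp only [Bool.or_eq_false_iff, beq_eq_false_iff_ne] at hx
        simp only [RAMState.setReg_reg, hx.1, if_false]
        rw [(hp _).1 x hx.2, h1]
      · rw [RAMState.setReg_mem, (hp _).2 x hx, ih.2 x hx]

theorem exec_reg {p : LProg} {s : RAMState} (x : ℕ) (h : p.writesReg x = false) :
    (p.exec s).reg x = s.reg x :=
  (p.exec_frame s).1 x h

theorem exec_mem {p : LProg} {s : RAMState} (x : ℕ) (h : p.writesMem x = false) :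
    (p.exec s).mem x = s.mem x :=
  (p.exec_frame s).2 x h

theorem time_congr (p : LProg) {v v' : ℕ → ℕ} (h : ∀ b ∈ p.bounds, v b = v' b) :
    p.time v = p.time v' := by
  induction p with
  | skip => rfl
  | assign i e => rfl
  | store b a e => rfl
  | seq p q hp hq =>
    simp only [bounds, List.mem_append] at h
    simp [time, hp fun b hb => h b (Or.inl hb), hq fun b hb => h b (Or.inr hb)]
  | ite e p q hp hq =>
    simp only [bounds, List.mem_append] at h
    simp [time, hp fun b hb => h b (Or.inl hb), hq fun b hb => h b (Or.inr hb)]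
  | loop i b p hp =>
    simp only [bounds, List.mem_cons] at h
    simp [time, hp fun b hb => h b (Or.inr hb), h b (Or.inl rfl)]

/-- The states at the head of a loop: counter `j`, and nothing else changed than what the loop body
may change. -/
structure AtHead (i b : ℕ) (p : LProg) (s : RAMState) (j : ℕ) (s' : RAMState) : Prop where
  counter : s'.reg i = j
  reg : ∀ x, (loop i b p).writesReg x = false → s'.reg x = s.reg x
  mem : ∀ x, p.writesMem x = false → s'.mem x = s.mem x

/-- The loop rule. Since the step also receives `AtHead`, an invariant has to speak only about what
the body changes. -/
theorem exec_loop_induct {i b : ℕ} {p : LProg} (hi : p.writesReg i = false) (s : RAMState)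
    (Inv : ℕ → RAMState → Prop) (h0 : Inv 0 (s.setReg i 0))
    (hstep : ∀ j < s.reg b, ∀ s', AtHead i b p s j s' → Inv j s' →
      Inv (j + 1) ((p.exec s').setReg i (j + 1))) :
    Inv (s.reg b) ((loop i b p).exec s) := by
  suffices h : ∀ N ≤ s.reg b, AtHead i b p s N
      ((fun s' => (p.exec s').setReg i ((p.exec s').reg i + 1))^[N] (s.setReg i 0)) ∧
      Inv N ((fun s' => (p.exec s').setReg i ((p.exec s').reg i + 1))^[N] (s.setReg i 0)) from
    (h _ le_rfl).2
  intro N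
  induction N with
  | zero =>
    refine fun _ => ⟨⟨by simp, fun x hx => ?_, fun x hx => rfl⟩, h0⟩
    simp only [writesReg, Bool.or_eq_false_iff, beq_eq_false_iff_ne] at hx
    simp [hx.1]
  | succ N ih =>
    intro hN
    obtain ⟨h1, h2⟩ := ih (Nat.le_of_succ_le hN)
    rw [Function.iterate_succ_apply']
    generalize (fun s' => (p.exec s').setReg i ((p.exec s').reg i + 1))^[N] (s.setReg i 0) = s₁
      at h1 h2
    simp only [exec_reg i hi, h1.counter]
    refine ⟨⟨by simp, fun x hx => ?_, fun x hx => ?_⟩, hstep N hN _ h1 h2⟩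
    · have h3 := h1.reg x hx
      simp only [writesReg, Bool.or_eq_false_iff, beq_eq_false_iff_ne] at hx
      simp only [RAMState.setReg_reg, hx.1, if_false]
      rw [exec_reg x hx.2, h3]
    · rw [RAMState.setReg_mem, exec_mem x hx, h1.mem x hx]

/-- Induction on the number `N` of remaining turns. The state `s₀` fixes the registers that the body
leaves alone, so that one bound `T` is valid for all turns. -/
theorem runs_loop_aux {i b : ℕ} {p : LProg} (hi : p.writesReg i = false)
    (hb : p.writesReg b = false) (hib : b ≠ i) {T : ℕ} {s₀ : RAMState}
    (hp : ∀ s, s.reg b = s₀.reg b → (∀ x, p.writesReg x = false → x ≠ i → s.reg x = s₀.reg x) →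
      ∃ t ≤ T, p.compile.Runs s (p.exec s) t) (N : ℕ) :
    ∀ s, s.reg b = s.reg i + N → s.reg b = s₀.reg b →
      (∀ x, p.writesReg x = false → x ≠ i → s.reg x = s₀.reg x) →
      ∃ t ≤ N * (T + 8) + 4, RAMProg.Runs
        (.loop (.sub (.reg b) (.reg i)) (.seq p.compile (.assign i (.add (.reg i) (.const 1))))) s
        ((fun s' => (p.exec s').setReg i ((p.exec s').reg i + 1))^[N] s) t := by
  induction N with
  | zero =>
    intro s hs _ _
    exact ⟨4, by omega, .loopFalse (by simp [RAMExpr.eval]; omega)⟩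
  | succ N ih =>
    intro s hs hs0 hf
    obtain ⟨t, ht, hrun⟩ := hp s hs0 hf
    rw [Function.iterate_succ_apply]
    obtain ⟨t', ht', hrun'⟩ := ih ((p.exec s).setReg i ((p.exec s).reg i + 1))
      (by simp [hib, exec_reg i hi, exec_reg b hb]; omega)
      (by simp [hib, exec_reg b hb, hs0])
      (by intro x hx hxi; simp [hxi, exec_reg x hx, hf x hx hxi])
    have h := RAMProg.Runs.loopTrue (e := .sub (.reg b) (.reg i))
      (by simp [RAMExpr.eval]; omega)
      (hrun.seq (.assign i (.add (.reg i) (.const 1)) _)) hrun'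
    exact ⟨_, by simp [RAMExpr.cost]; nlinarith, h⟩

/-- The bound may be evaluated at the initial registers because no loop bound is written anywhere in
the program; `time_congr` carries it across sequencing and turns. -/
theorem runs_of_bounds (p : LProg) (hc : p.countersOk = true) (s : RAMState)
    (hb : ∀ b ∈ p.bounds, p.writesReg b = false) :
    ∃ t ≤ p.time s.reg, p.compile.Runs s (p.exec s) t := by
  induction p generalizing s with
  | skip => exact ⟨1, le_rfl, .skip s⟩
  | assign i e => exact ⟨_, le_rfl, .assign i e s⟩
  | store b a e => exact ⟨_, le_rfl, .store b a e s⟩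
  | seq p q hp hq =>
    simp only [countersOk, Bool.and_eq_true, bounds, List.mem_append, writesReg,
      Bool.or_eq_false_iff] at hc hb
    obtain ⟨t, ht, h⟩ := hp hc.1 s fun b h => (hb b (Or.inl h)).1
    obtain ⟨t', ht', h'⟩ := hq hc.2 (p.exec s) fun b h => (hb b (Or.inr h)).2
    refine ⟨_, ?_, h.seq h'⟩
    rw [q.time_congr (v' := s.reg) fun b hb' => exec_reg b (hb b (Or.inr hb')).1] at ht'
    simp only [time]
    omega
  | ite e p q hp hq =>
    simp only [countersOk, Bool.and_eq_true, bounds, List.mem_append, writesReg,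
      Bool.or_eq_false_iff] at hc hb
    obtain ⟨t, ht, h⟩ := hp hc.1 s fun b h => (hb b (Or.inl h)).1
    obtain ⟨t', ht', h'⟩ := hq hc.2 s fun b h => (hb b (Or.inr h)).2
    by_cases he : e.eval s = 0
    · refine ⟨e.cost + t' + 1, by simp only [time]; omega, ?_⟩
      simpa [exec, compile, he] using RAMProg.Runs.iteFalse he h'
    · refine ⟨e.cost + t + 1, by simp only [time]; omega, ?_⟩
      simpa [exec, compile, he] using RAMProg.Runs.iteTrue he h
  | loop i b p hp =>
    simp only [countersOk, Bool.and_eq_true, bounds, List.mem_cons, writesReg,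
      Bool.or_eq_false_iff, Bool.not_eq_true', beq_eq_false_iff_ne, forall_eq_or_imp] at hc hb
    obtain ⟨⟨hbi, hbw⟩, hb⟩ := hb
    obtain ⟨t, ht, h⟩ := runs_loop_aux hc.1 hbw hbi (T := p.time s.reg) (s₀ := s)
      (fun s' hs' hs => by
        have := hp hc.2 s' fun x hx => (hb x hx).2
        rwa [p.time_congr (v' := s.reg) fun x hx => hs x (hb x hx).2 (hb x hx).1] at this)
      (s.reg b) (s.setReg i 0) (by simp [hbi]) (by simp [hbi])
      (by intro x _ hx; simp [hx])
    exact ⟨_, by simp only [time, RAMExpr.cost]; omega,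
      RAMProg.Runs.seq (.assign i (.const 0) s) h⟩

theorem runs (p : LProg) (hp : p.wf = true) (s : RAMState) :
    ∃ t ≤ p.time s.reg, p.compile.Runs s (p.exec s) t := by
  simp only [wf, Bool.and_eq_true, List.all_eq_true, Bool.not_eq_true'] at hp
  exact p.runs_of_bounds hp.1 s hp.2

/-- The nesting depth of loops. -/
def depth : LProg → ℕ
  | skip => 0
  | assign _ _ => 0
  | store _ _ _ => 0
  -- A sum, not a maximum: only an upper bound on the nesting is needed, as an exponent.
  | seq p q => p.depth + q.depth
  | ite _ p q => p.depth + q.depth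
  | loop _ _ p => p.depth + 1

/-- The part of the running time that comes from the loops bounded by the registers in `S`. -/
def largeTime (S : List ℕ) : LProg → (ℕ → ℕ) → ℕ
  | skip, _ => 1
  | assign _ _, _ => 1
  | store _ _ _, _ => 1
  | seq p q, v => max (p.largeTime S v) (q.largeTime S v)
  | ite _ p q, v => max (p.largeTime S v) (q.largeTime S v)
  | loop _ b p, v => if b ∈ S then v b * p.largeTime S v else p.largeTime S v

theorem largeTime_pos (S : List ℕ) (p : LProg) (v : ℕ → ℕ) (hv : ∀ b ∈ S, 0 < v b) :
    0 < p.largeTime S v := by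
  induction p with
  | skip => exact one_pos
  | assign i e => exact one_pos
  | store b a e => exact one_pos
  | seq p q hp hq => exact lt_max_of_lt_left hp
  | ite e p q hp hq => exact lt_max_of_lt_left hp
  | loop i b p hp =>
    rw [largeTime]
    split_ifs with h
    · exact Nat.mul_pos (hv b h) hp
    · exact hp

theorem largeTime_nil (p : LProg) (v : ℕ → ℕ) : p.largeTime [] v = 1 := by
  induction p <;> simp_all [largeTime]

/-- Each loop outside `S` costs a factor `X`; a loop in `S` multiplies its own bound into
`largeTime`. Sequenced parts enter by their maximum, their number being absorbed in `c`. Positivity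
makes the right-hand monomial at least one, so that it absorbs additive constants. -/
theorem time_le_largeTime (S : List ℕ) (p : LProg) : ∃ c : ℕ, ∀ (v : ℕ → ℕ) (X : ℕ), 0 < X →
    (∀ b ∈ S, 0 < v b) → (∀ b ∈ p.bounds, b ∉ S → v b ≤ X) →
    p.time v ≤ c * X ^ p.depth * p.largeTime S v := by
  have mono : ∀ {X c d e W W' : ℕ}, 0 < X → d ≤ e → W ≤ W' → c * X ^ d * W ≤ c * X ^ e * W' :=
    fun hX hd hW => Nat.mul_le_mul (Nat.mul_le_mul_left _ (Nat.pow_le_pow_right hX hd)) hW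
  induction p with
  | skip => exact ⟨1, fun v X _ _ _ => by simp [time, depth, largeTime]⟩
  | assign i e => exact ⟨e.cost + 1, fun v X _ _ _ => by simp [time, depth, largeTime]⟩
  | store b a e => exact ⟨a.cost + e.cost + 1, fun v X _ _ _ => by simp [time, depth, largeTime]⟩
  | seq p q hp hq =>
    obtain ⟨c, hc⟩ := hp
    obtain ⟨c', hc'⟩ := hq
    refine ⟨c + c', fun v X hX hS hb => ?_⟩
    simp only [bounds, List.mem_append] at hb
    simp only [time, depth, largeTime, add_mul]
    exact add_le_add
      ((hc v X hX hS fun b h => hb b (Or.inl h)).trans (mono hX (by omega) (le_max_left _ _)))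
      ((hc' v X hX hS fun b h => hb b (Or.inr h)).trans (mono hX (by omega) (le_max_right _ _)))
  | ite e p q hp hq =>
    obtain ⟨c, hc⟩ := hp
    obtain ⟨c', hc'⟩ := hq
    refine ⟨e.cost + c + c' + 1, fun v X hX hS hb => ?_⟩
    simp only [bounds, List.mem_append] at hb
    have h1 : 0 < X ^ (p.depth + q.depth) * max (p.largeTime S v) (q.largeTime S v) :=
      Nat.mul_pos (Nat.pow_pos hX) (lt_max_of_lt_left (p.largeTime_pos S v hS))
    simp only [time, depth, largeTime, add_mul]
    refine add_le_add (add_le_add (add_le_add ?_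
      ((hc v X hX hS fun b h => hb b (Or.inl h)).trans (mono hX (by omega) (le_max_left _ _))))
      ((hc' v X hX hS fun b h => hb b (Or.inr h)).trans (mono hX (by omega) (le_max_right _ _))))
      (by rwa [one_mul])
    rw [mul_assoc]
    exact Nat.le_mul_of_pos_right _ h1
  | loop i b p hp =>
    obtain ⟨c, hc⟩ := hp
    -- The summand 14 is 8 + 6, the two constants in the time of a loop.
    refine ⟨c + 14, fun v X hX hS hb => ?_⟩
    simp only [bounds, List.mem_cons, forall_eq_or_imp] at hb
    have h1 := hc v X hX hS hb.2
    have hW := p.largeTime_pos S v hS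
    have h2 : 0 < X ^ p.depth * p.largeTime S v := Nat.mul_pos (Nat.pow_pos hX) hW
    have h3 : p.time v + 8 ≤ (c + 8) * X ^ p.depth * p.largeTime S v := by
      rw [mul_assoc] at h1 ⊢
      rw [add_mul]
      omega
    have h4 : 0 < X ^ (p.depth + 1) * (loop i b p).largeTime S v :=
      Nat.mul_pos (Nat.pow_pos hX) ((loop i b p).largeTime_pos S v hS)
    have h5 : v b * p.largeTime S v ≤ X * (loop i b p).largeTime S v := by
      rw [largeTime]
      split_ifs with h
      · exact Nat.le_mul_of_pos_left _ hX
      · exact Nat.mul_le_mul_right _ (hb.1 h)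
    simp only [time, depth]
    calc v b * (p.time v + 8) + 6
        ≤ v b * ((c + 8) * X ^ p.depth * p.largeTime S v) +
          6 * (X ^ (p.depth + 1) * (loop i b p).largeTime S v) :=
          add_le_add (Nat.mul_le_mul_left _ h3) (by omega)
      _ = (c + 8) * X ^ p.depth * (v b * p.largeTime S v) +
          6 * (X ^ (p.depth + 1) * (loop i b p).largeTime S v) := by ring
      _ ≤ (c + 8) * X ^ p.depth * (X * (loop i b p).largeTime S v) +
          6 * (X ^ (p.depth + 1) * (loop i b p).largeTime S v) :=
          Nat.add_le_add_right (Nat.mul_le_mul_left _ h5) _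
      _ = (c + 14) * X ^ (p.depth + 1) * (loop i b p).largeTime S v := by ring

theorem time_le_of_bounds_le (p : LProg) : ∃ c : ℕ, ∀ (v : ℕ → ℕ) (X : ℕ), 0 < X →
    (∀ b ∈ p.bounds, v b ≤ X) → p.time v ≤ c * X ^ p.depth := by
  obtain ⟨c, hc⟩ := p.time_le_largeTime []
  refine ⟨c, fun v X hX hb => ?_⟩
  simpa [largeTime_nil] using hc v X hX (by simp) fun b h _ => hb b h

@[simp] theorem exec_skip (s : RAMState) : skip.exec s = s := rfl

@[simp] theorem exec_assign (i : ℕ) (e : RAMExpr) (s : RAMState) :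
    (assign i e).exec s = s.setReg i (e.eval s) := rfl

@[simp] theorem exec_store (b : ℕ) (a e : RAMExpr) (s : RAMState) :
    (store b a e).exec s = s.setMem b (a.eval s) (e.eval s) := rfl

@[simp] theorem exec_seq (p q : LProg) (s : RAMState) : (seq p q).exec s = q.exec (p.exec s) := rfl

@[simp] theorem exec_ite (e : RAMExpr) (p q : LProg) (s : RAMState) :
    (ite e p q).exec s = if e.eval s = 0 then q.exec s else p.exec s := rfl

end LProg

attribute [simp] RAMExpr.eval

set_option linter.unusedSectionVars false

/-! ### Equality of the optima of Valued APEP and Valued WSP -/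

namespace PenaltyFun

theorem monotone (f : PenaltyFun) : Monotone f.toFun :=
  monotone_int_of_le_succ f.mono

end PenaltyFun

section Rel

variable {U R : Type} [Fintype U] [DecidableEq U] [Fintype R] [DecidableEq R]

@[simp] theorem mem_usersOf {A : Finset (U × R)} {r : R} {u : U} :
    u ∈ usersOf A r ↔ (u, r) ∈ A := by
  simp [usersOf]

@[simp] theorem mem_resourcesOf {A : Finset (U × R)} {u : U} {r : R} :
    r ∈ resourcesOf A u ↔ (u, r) ∈ A := by
  simp [resourcesOf]

end Rel

namespace BSInstance

variable {U R : Type} [Fintype U] [DecidableEq U] [Fintype R] [DecidableEq R]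

theorem exists_step (I : BSInstance U R) (r : R) : ∃ s : I.Step, s.1.1 = r := by
  by_cases h : ∃ r', I.Linked r r'
  · obtain ⟨r', h⟩ := h
    exact ⟨⟨(r, some r'), h⟩, rfl⟩
  · exact ⟨⟨(r, none), fun r' h' => h ⟨r', h'⟩⟩, rfl⟩

theorem mem_stepUsers {I : BSInstance U R} {π : I.Step → U} {r : R} {u : U} :
    u ∈ I.stepUsers π r ↔ ∃ s : I.Step, s.1.1 = r ∧ π s = u := by
  simp only [stepUsers, Finset.mem_image, Finset.mem_filter_univ]

@[simp] theorem usersOf_relOfPlan (I : BSInstance U R) (π : I.Step → U) (r : R) :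
    usersOf (I.relOfPlan π) r = I.stepUsers π r := by
  ext u
  simp [relOfPlan]

theorem complete_relOfPlan (I : BSInstance U R) (π : I.Step → U) :
    ValuedAPEP.Complete (I.relOfPlan π) := by
  intro r
  obtain ⟨s, hs⟩ := I.exists_step r
  exact ⟨π s, by rw [usersOf_relOfPlan]; exact mem_stepUsers.2 ⟨s, hs, rfl⟩⟩

theorem resourcesOf_relOfPlan (I : BSInstance U R) (π : I.Step → U) (u : U) :
    resourcesOf (I.relOfPlan π) u =
      I.resourcesOfSteps (Finset.univ.filter fun s => π s = u) := by
  ext r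
  simp only [mem_resourcesOf, relOfPlan, Finset.mem_filter_univ, mem_stepUsers, resourcesOfSteps,
    Finset.mem_image]
  exact exists_congr fun s => and_comm

theorem weight_constraints_toWSP (I : BSInstance U R) (π : I.Step → U) :
    (I.toWSP.constraints.map fun w => w π).sum =
      (I.C.attach.map fun c => I.planConstraint c.1 c.2 π).sum := by
  simp [toWSP, Function.comp_def]

theorem weight_constraints_toAPEP (I : BSInstance U R) (A : Finset (U × R)) :
    (I.toAPEP.constraints.map fun w => w A).sum =
      (I.C.attach.map fun c => c.1.weight A).sum := by
  have h : I.C.attach.map (fun c => c.1.weight A) = I.C.map fun c => c.weight A := by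
    conv_rhs => rw [← List.attach_map_subtype_val I.C, List.map_map]
    rfl
  rw [h]
  simp [toAPEP, Function.comp_def]

/-- Only binding constraints can make this strict: a common user of the two matched steps lies in
A(r) ∩ A(r'), but this intersection may also be met through other steps. -/
theorem weight_relOfPlan_le (I : BSInstance U R) (π : I.Step → U) :
    I.toAPEP.weight (I.relOfPlan π) ≤ I.toWSP.weight π := by
  rw [ValuedAPEP.weight, ValuedWSP.weight, weight_constraints_toWSP, weight_constraints_toAPEP]
  refine add_le_add (le_of_eq ?_) ?_
  · exact Finset.sum_congr rfl fun u _ => by rw [resourcesOf_relOfPlan]; rfl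
  · refine List.sum_le_sum fun c _ => ?_
    obtain ⟨c, hc⟩ := c
    cases c with
    | bodE r r' l hl =>
      simp only [BSConstraint.weight, planConstraint, usersOf_relOfPlan]
      by_cases h : π ⟨(r, some r'), ⟨l, hl, Or.inl hc⟩⟩ = π ⟨(r', some r), ⟨l, hl, Or.inr hc⟩⟩
      · rw [if_pos]
        · exact Nat.zero_le _
        · exact ⟨_, Finset.mem_inter.2 ⟨mem_stepUsers.2 ⟨_, rfl, rfl⟩,
            mem_stepUsers.2 ⟨_, rfl, h.symm⟩⟩⟩
      · rw [if_neg h]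
        split_ifs <;> omega
    | sodU r r' f =>
      simp [BSConstraint.weight, planConstraint]

/-- Some element of a nonempty finite set. -/
noncomputable def choosePoint [Nonempty U] (S : Finset U) : U :=
  open Classical in if h : S.Nonempty then h.choose else Classical.arbitrary U

theorem choosePoint_mem [Nonempty U] {S : Finset U} (h : S.Nonempty) : choosePoint S ∈ S := by
  rw [choosePoint, dif_pos h]
  exact h.choose_spec

/-- The plan that performs `s^r` by some member of `A(r)`, and `s^r_{r'}` by a member of
`A(r) ∩ A(r')`, if there is one. -/
noncomputable def planOfRel [Nonempty U] (I : BSInstance U R) (A : Finset (U × R)) :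
    I.Step → U
  | ⟨(r, none), _⟩ => choosePoint (usersOf A r)
  | ⟨(r, some r'), _⟩ =>
      if (usersOf A r ∩ usersOf A r').Nonempty then choosePoint (usersOf A r ∩ usersOf A r')
      else choosePoint (usersOf A r)

theorem planOfRel_mem [Nonempty U] (I : BSInstance U R) {A : Finset (U × R)}
    (hA : ValuedAPEP.Complete A) (s : I.Step) : (I.planOfRel A s, s.1.1) ∈ A := by
  rw [← mem_usersOf]
  obtain ⟨⟨r, _ | r'⟩, hs⟩ := s
  · exact choosePoint_mem (hA r)
  · simp only [planOfRel]
    split_ifs with h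
    · exact (Finset.mem_inter.1 (choosePoint_mem h)).1
    · exact choosePoint_mem (hA r)

/-- The plan uses members of A(r) only for the steps of r. Shrinking A(r) to π(S^r) lowers
authorization and separation weights by monotonicity, and every binding constraint that A satisfies
keeps a witness. -/
theorem weight_planOfRel_le [Nonempty U] (I : BSInstance U R) {A : Finset (U × R)}
    (hA : ValuedAPEP.Complete A) : I.toWSP.weight (I.planOfRel A) ≤ I.toAPEP.weight A := by
  have hsub : ∀ r, I.stepUsers (I.planOfRel A) r ⊆ usersOf A r := by
    intro r u hu
    obtain ⟨s, rfl, rfl⟩ := mem_stepUsers.1 hu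
    exact mem_usersOf.2 (I.planOfRel_mem hA s)
  rw [ValuedAPEP.weight, ValuedWSP.weight, weight_constraints_toWSP, weight_constraints_toAPEP]
  refine add_le_add (Finset.sum_le_sum fun u _ => ?_) ?_
  · refine I.auth.mono u _ _ fun r hr => ?_
    obtain ⟨s, hs, rfl⟩ := Finset.mem_image.1 hr
    rw [Finset.mem_filter_univ] at hs
    exact mem_resourcesOf.2 (hs ▸ I.planOfRel_mem hA s)
  · refine List.sum_le_sum fun c _ => ?_
    obtain ⟨c, hc⟩ := c
    cases c with
    | bodE r r' l hl =>
      simp only [BSConstraint.weight, planConstraint]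
      by_cases h : (usersOf A r ∩ usersOf A r').Nonempty
      · rw [if_pos]
        · exact Nat.zero_le _
        -- Both matched steps receive the chosen point of the same intersection, hence the same
        -- user.
        · simp only [planOfRel, Finset.inter_comm (usersOf A r') (usersOf A r), h, if_true]
      · rw [if_neg h]
        split_ifs <;> omega
    | sodU r r' f =>
      simp only [BSConstraint.weight, planConstraint]
      exact f.monotone (Int.ofNat_le.2
        (Finset.card_le_card (Finset.inter_subset_inter (hsub r) (hsub r'))))

theorem exists_isOptimalPlan [Nonempty U] (I : BSInstance U R) :
    ∃ π : I.Step → U, I.toWSP.IsOptimalPlan π :=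
  Finite.exists_min I.toWSP.weight

/-- For the relation of π and any complete A', the weights satisfy w(relation of π) ≤ w(π) ≤ w(plan
of A') ≤ w(A'). -/
theorem isSolution_relOfPlan [Nonempty U] (I : BSInstance U R) {π : I.Step → U}
    (hπ : I.toWSP.IsOptimalPlan π) : I.toAPEP.IsSolution (I.relOfPlan π) :=
  ⟨I.complete_relOfPlan π, fun _ hA => (I.weight_relOfPlan_le π).trans
    ((hπ _).trans (I.weight_planOfRel_le hA))⟩

theorem weight_relOfPlan [Nonempty U] (I : BSInstance U R) {π : I.Step → U}
    (hπ : I.toWSP.IsOptimalPlan π) : I.toAPEP.weight (I.relOfPlan π) = I.toWSP.weight π :=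
  le_antisymm (I.weight_relOfPlan_le π)
    ((hπ _).trans (I.weight_planOfRel_le (I.complete_relOfPlan π)))

theorem exists_isOPT [Nonempty U] (I : BSInstance U R) :
    ∃ m : ℕ, I.toAPEP.IsOPT m ∧ I.toWSP.IsOPT m := by
  obtain ⟨π, hπ⟩ := I.exists_isOptimalPlan
  refine ⟨I.toWSP.weight π, ⟨⟨_, I.complete_relOfPlan π, I.weight_relOfPlan hπ⟩, ?_⟩,
    ⟨⟨π, rfl⟩, ?_⟩⟩
  · rintro _ ⟨A, hA, rfl⟩
    exact (hπ _).trans (I.weight_planOfRel_le hA)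
  · rintro _ ⟨π', rfl⟩
    exact hπ π'

/-- A permutation σ preserves and reflects equality of users, maps π(S^r) onto its image under σ,
commutes with intersection and keeps cardinalities. -/
theorem userIndependent_of_mem (I : BSInstance U R) :
    ∀ w ∈ I.toWSP.constraints, ValuedWSP.UserIndependent w := by
  intro w hw σ π
  simp only [toWSP, List.mem_map] at hw
  obtain ⟨⟨c, hc⟩, -, rfl⟩ := hw
  have h : ∀ r, I.stepUsers (σ ∘ π) r = (I.stepUsers π r).map σ.toEmbedding := by
    intro r
    rw [stepUsers, stepUsers, Finset.map_eq_image, Finset.image_image]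
    rfl
  cases c with
  | bodE r r' l hl => simp [planConstraint]
  | sodU r r' f => simp [planConstraint, h, ← Finset.map_inter]

/-- A resource has one step, or as many as there are resources linked to it. -/
theorem card_filter_step_le (I : BSInstance U R) (r : R) (m : ℕ) (hm : 1 ≤ m)
    (h : ∀ S : Finset R, (∀ r' ∈ S, I.Linked r r') → S.card ≤ m) :
    (Finset.univ.filter fun s : I.Step => s.1.1 = r).card ≤ m := by
  classical
  by_cases hl : ∃ r', I.Linked r r'
  · obtain ⟨r₀, h₀⟩ := hl
    refine le_trans ?_ (h (Finset.univ.filter fun r' => I.Linked r r') (by simp))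
    -- The default `r₀` never occurs: as `r` is linked to `r₀`, it has no step of the form `(r,
    -- none)`.
    refine Finset.card_le_card_of_injOn (fun s => s.1.2.getD r₀) ?_ ?_
    · rintro ⟨⟨r₁, _ | r'⟩, hs⟩ h₁
      · simp only [Finset.coe_filter_univ, Set.mem_ofPred_eq] at h₁
        subst h₁
        exact (hs r₀ h₀).elim
      · simp only [Finset.coe_filter_univ, Set.mem_ofPred_eq] at h₁ ⊢
        subst h₁
        exact hs
    · rintro ⟨⟨r₁, _ | r'⟩, hs⟩ h₁ ⟨⟨r₂, _ | r''⟩, hs'⟩ h₂ heq <;>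
        simp only [Finset.coe_filter_univ, Set.mem_ofPred_eq] at h₁ h₂ heq <;> subst h₁
      · subst h₂; rfl
      · exact (hs r₀ h₀).elim
      · subst h₂; exact (hs' r₀ h₀).elim
      · subst h₂
        simp only [Option.getD_some] at heq
        subst heq
        rfl
  · refine le_trans (Finset.card_le_one.2 ?_) hm
    rintro ⟨⟨r₁, _ | r'⟩, hs⟩ h₁ ⟨⟨r₂, _ | r''⟩, hs'⟩ h₂ <;>
      simp only [Finset.mem_filter_univ] at h₁ h₂ <;> subst h₁
    · subst h₂; rfl
    · subst h₂; exact (hl ⟨_, hs'⟩).elim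
    · exact (hl ⟨_, hs⟩).elim
    · exact (hl ⟨_, hs⟩).elim

theorem card_step_le_mul (I : BSInstance U R) (m : ℕ) (hm : 1 ≤ m)
    (h : ∀ r, ∀ S : Finset R, (∀ r' ∈ S, I.Linked r r') → S.card ≤ m) :
    Fintype.card I.Step ≤ Fintype.card R * m := by
  rw [← Finset.card_univ, Finset.card_eq_sum_card_fiberwise (f := fun s : I.Step => s.1.1)
    (t := Finset.univ) (by simp), ← Finset.card_univ, ← smul_eq_mul]
  exact Finset.sum_le_card_nsmul _ _ _ fun r _ => I.card_filter_step_le r m hm (h r)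

/-- A resource may be linked to itself here, so up to k steps per resource are possible. The
algorithm relies on this bound because it must handle every instance. -/
theorem card_step_le_sq (I : BSInstance U R) :
    Fintype.card I.Step ≤ Fintype.card R * Fintype.card R := by
  rcases Nat.eq_zero_or_pos (Fintype.card R) with h | h
  · have := Fintype.card_eq_zero_iff.1 h
    have : IsEmpty I.Step := ⟨fun s => isEmptyElim s.1.1⟩
    simp
  · exact I.card_step_le_mul _ h fun r S _ => Finset.card_le_univ S

/-- Without self-links a resource has at most k - 1 partners, and an unlinked one still has its
single step; hence the factor max 1 (k - 1). -/
theorem card_step_le (I : BSInstance U R) (hI : ∀ r l hl, BSConstraint.bodE r r l hl ∉ I.C) :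
    Fintype.card I.Step ≤
      max (Fintype.card R) (Fintype.card R * (Fintype.card R - 1)) := by
  have h := I.card_step_le_mul (max 1 (Fintype.card R - 1)) (le_max_left _ _) fun r S hS => by
    refine le_max_of_le_right ?_
    have : S ⊆ Finset.univ.erase r := fun r' hr' => Finset.mem_erase.2 ⟨?_, Finset.mem_univ _⟩
    · simpa [Finset.card_erase_of_mem] using Finset.card_le_card this
    · rintro rfl
      obtain ⟨l, hl, h | h⟩ := hS _ hr' <;> exact hI _ l hl h
  rwa [← Nat.mul_max_mul_left, mul_one] at h

/-- There is an optimal solution in which at most `k²` users have a resource. -/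
theorem exists_isSolution_card_le [Nonempty U] (I : BSInstance U R) :
    ∃ A : Finset (U × R), I.toAPEP.IsSolution A ∧
      (Finset.univ.filter fun u => (resourcesOf A u).Nonempty).card ≤
        Fintype.card R * Fintype.card R := by
  obtain ⟨π, hπ⟩ := I.exists_isOptimalPlan
  refine ⟨_, I.isSolution_relOfPlan hπ, le_trans ?_ I.card_step_le_sq⟩
  refine le_trans (Finset.card_le_card ?_) (Finset.card_image_le (s := Finset.univ) (f := π))
  intro u hu
  simp only [Finset.mem_filter_univ] at hu
  obtain ⟨r, hr⟩ := hu
  rw [mem_resourcesOf, ← mem_usersOf, usersOf_relOfPlan] at hr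
  obtain ⟨s, -, hs⟩ := mem_stepUsers.1 hr
  exact Finset.mem_image.2 ⟨s, Finset.mem_univ _, hs⟩

end BSInstance

/-! ### Minima over nonzero values, zero standing for infeasibility -/

/-- Among the `j < N` with `f j ≠ 0`, the minimum of `f` and the first `j` where it is attained;
`(0, 0)` if there is no such `j`. -/
def minUpTo (f : ℕ → ℕ) : ℕ → ℕ × ℕ
  | 0 => (0, 0)
  | j + 1 =>
    if f j ≠ 0 ∧ ((minUpTo f j).1 = 0 ∨ f j < (minUpTo f j).1) then (f j, j) else minUpTo f j

theorem minUpTo_attained (f : ℕ → ℕ) (N : ℕ) (h : (minUpTo f N).1 ≠ 0) :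
    (minUpTo f N).2 < N ∧ f (minUpTo f N).2 = (minUpTo f N).1 := by
  induction N with
  | zero => simp [minUpTo] at h
  | succ j ih =>
    rw [minUpTo] at h ⊢
    split_ifs with hj
    · exact ⟨j.lt_succ_self, rfl⟩
    · rw [if_neg hj] at h
      exact ⟨(ih h).1.trans j.lt_succ_self, (ih h).2⟩

/-- The default argument 0 is in range too, so picks are valid table indices even in infeasible
cells. -/
theorem minUpTo_arg_lt (f : ℕ → ℕ) {N : ℕ} (hN : 0 < N) : (minUpTo f N).2 < N := by
  induction N with
  | zero => omega
  | succ j ih =>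
    rw [minUpTo]
    split_ifs
    · exact j.lt_succ_self
    · rcases Nat.eq_zero_or_pos j with rfl | hj
      · simp [minUpTo]
      · exact (ih hj).trans j.lt_succ_self

theorem minUpTo_le (f : ℕ → ℕ) (N : ℕ) {j : ℕ} (hj : j < N) (h : f j ≠ 0) :
    (minUpTo f N).1 ≠ 0 ∧ (minUpTo f N).1 ≤ f j := by
  induction N with
  | zero => omega
  | succ N ih =>
    rw [minUpTo]
    rcases Nat.lt_succ_iff_lt_or_eq.1 hj with hj | rfl
    · have := ih hj
      split_ifs <;> omega
    · split_ifs <;> omega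

/-! ## A knapsack problem

Every user `u < n` picks some `T < Q`, of size `size T` and cost `cost u T`. -/

namespace Knapsack

variable (size : ℕ → ℕ) (cost : ℕ → ℕ → ℕ) (Q : ℕ)

/-- One more than the cost of a choice in which user `u` picks `T`, given the optimal values for
the users before `u`. -/
def candidate (opt : ℕ → ℕ) (u c T : ℕ) : ℕ :=
  if size T ≤ c ∧ opt (c - size T) ≠ 0 then opt (c - size T) + cost u T else 0

/-- One more than the minimum cost of a choice of total size `c` for the users below `u`; zero if
there is none. -/
def value : ℕ → ℕ → ℕ
  | 0, c => if c = 0 then 1 else 0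
  | u + 1, c => (minUpTo (candidate size cost (value u) u c) Q).1

/-- The pick of user `u` in an optimal choice of total size `c` for the users up to `u`. -/
def pick (u c : ℕ) : ℕ :=
  (minUpTo (candidate size cost (value size cost Q u) u c) Q).2

/-- An optimal choice of total size `c` for the users below `u`. -/
def choice : ℕ → ℕ → ℕ → ℕ
  | 0, _, _ => 0
  | u + 1, c, v =>
    if v = u then pick size cost Q u c else choice u (c - size (pick size cost Q u c)) v

/-- Unwinding the recurrence: a nonzero value is the candidate of the last user's pick, so the value
for the remaining size is nonzero as well and the induction hypothesis applies to it. -/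
theorem choice_spec (u : ℕ) : ∀ c, value size cost Q u c ≠ 0 →
    (∀ v < u, choice size cost Q u c v < Q) ∧
    ∑ v ∈ Finset.range u, size (choice size cost Q u c v) = c ∧
    ∑ v ∈ Finset.range u, cost v (choice size cost Q u c v) + 1 = value size cost Q u c := by
  induction u with
  | zero =>
    intro c hc
    simp only [value, ne_eq, ite_eq_right_iff, one_ne_zero, imp_false, not_not] at hc
    simp [value, hc]
  | succ u ih =>
    intro c hc
    obtain ⟨h1, h2⟩ := minUpTo_attained _ _ hc
    have h3 := hc
    rw [value, ← h2, candidate] at h3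
    change _ < _ at h1
    change candidate size cost (value size cost Q u) u c (pick size cost Q u c) =
      value size cost Q (u + 1) c at h2
    change (if size (pick size cost Q u c) ≤ c ∧ value size cost Q u
      (c - size (pick size cost Q u c)) ≠ 0 then _ else 0) ≠ 0 at h3
    split_ifs at h3 with h4
    · rw [candidate, if_pos h4] at h2
      obtain ⟨i1, i2, i3⟩ := ih _ h4.2
      have hlt : ∀ v ∈ Finset.range u, choice size cost Q (u + 1) c v =
          choice size cost Q u (c - size (pick size cost Q u c)) v := fun v hv => by
        rw [choice, if_neg (Finset.mem_range.1 hv).ne]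
      have hu : choice size cost Q (u + 1) c u = pick size cost Q u c := by simp [choice]
      refine ⟨fun v hv => ?_, ?_, ?_⟩
      · rcases Nat.lt_succ_iff_lt_or_eq.1 hv with hv | rfl
        · rw [hlt v (Finset.mem_range.2 hv)]
          exact i1 v hv
        · rw [hu]
          exact h1
      · rw [Finset.sum_range_succ, hu, Finset.sum_congr rfl fun v hv => by rw [hlt v hv], i2]
        omega
      · rw [Finset.sum_range_succ, hu, Finset.sum_congr rfl fun v hv => by rw [hlt v hv]]
        omega
    · exact absurd rfl h3

/-- The last pick of `T` is one of the candidates for its total size, and its candidate value builds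
on the inductive bound for the earlier users. -/
theorem value_le (T : ℕ → ℕ) (u : ℕ) (hT : ∀ v < u, T v < Q) :
    value size cost Q u (∑ v ∈ Finset.range u, size (T v)) ≠ 0 ∧
    value size cost Q u (∑ v ∈ Finset.range u, size (T v)) ≤
      ∑ v ∈ Finset.range u, cost v (T v) + 1 := by
  induction u with
  | zero => simp [value]
  | succ u ih =>
    have h1 := ih fun v hv => hT v (by omega)
    rw [Finset.sum_range_succ, Finset.sum_range_succ]
    have h2 : candidate size cost (value size cost Q u) u
        (∑ v ∈ Finset.range u, size (T v) + size (T u)) (T u) =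
        value size cost Q u (∑ v ∈ Finset.range u, size (T v)) + cost u (T u) := by
      rw [candidate, Nat.add_sub_cancel, if_pos ⟨by omega, h1.1⟩]
    have h3 := minUpTo_le _ Q (hT u (by omega)) (h2 ▸ (by omega :
      value size cost Q u (∑ v ∈ Finset.range u, size (T v)) + cost u (T u) ≠ 0))
    rw [value]
    exact ⟨h3.1, by omega⟩

end Knapsack

/-! ## Encoding the number of common users of all pairs of resources in one number -/

namespace PairCode

/-- The pair of resources with number `q` is in order. -/
def ordered (k q : ℕ) : Bool := q / k ≤ q % k

/-- The number of ordered pairs below `q`. -/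
def index (k q : ℕ) : ℕ := Nat.count (fun q => ordered k q = true) q

/-- The place value of the pair `q` in base `B`. -/
def place (k B q : ℕ) : ℕ := if ordered k q then B ^ index k q else 0

theorem index_succ (k q : ℕ) : index k (q + 1) = index k q + if ordered k q then 1 else 0 :=
  Nat.count_succ _ _

/-- A numeral whose digits are all less than the base is below the next power. Pairs out of order
have place value 0, so only the ordered ones count as digits. -/
theorem sum_place_lt (k B : ℕ) (c : ℕ → ℕ) (Q : ℕ) (hc : ∀ q < Q, c q < B) :
    ∑ q ∈ Finset.range Q, c q * place k B q < B ^ index k Q := by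
  induction Q with
  | zero => simp [index]
  | succ Q ih =>
    have h1 := ih fun q hq => hc q (by omega)
    rw [Finset.sum_range_succ, index_succ, place]
    split_ifs with h
    · rw [pow_succ]
      have := Nat.mul_le_mul_right (B ^ index k Q) (Nat.succ_le_of_lt (hc Q (by omega)))
      simp only [Nat.succ_eq_add_one] at this
      nlinarith
    · simpa using h1

/-- Uniqueness of digits below an arbitrary top coefficient `m`. The induction merges the last digit
into that coefficient, as `c Q + m * B`; division by the place value and reduction modulo `B` then
recover the digit. -/
theorem eq_of_sum_place_eq (k B : ℕ) (c c' : ℕ → ℕ) (Q : ℕ) (hc : ∀ q < Q, c q < B)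
    (hc' : ∀ q < Q, c' q < B) (m m' : ℕ)
    (h : ∑ q ∈ Finset.range Q, c q * place k B q + m * B ^ index k Q =
      ∑ q ∈ Finset.range Q, c' q * place k B q + m' * B ^ index k Q) :
    ∀ q < Q, ordered k q → c q = c' q := by
  induction Q generalizing m m' with
  | zero => simp
  | succ Q ih =>
    rw [Finset.sum_range_succ, Finset.sum_range_succ, index_succ, place] at h
    by_cases ho : ordered k Q
    · simp only [ho, if_true, pow_succ] at h
      have h0 : ∑ q ∈ Finset.range Q, c q * place k B q + (c Q + m * B) * B ^ index k Q =
        ∑ q ∈ Finset.range Q, c' q * place k B q + (c' Q + m' * B) * B ^ index k Q := by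
        linarith
      have h1 := ih (fun q hq => hc q (by omega)) (fun q hq => hc' q (by omega)) _ _ h0
      intro q hq hoq
      rcases Nat.lt_succ_iff_lt_or_eq.1 hq with hq | rfl
      · exact h1 q hq hoq
      have hs := sum_place_lt k B c q fun q' hq' => hc q' (by omega)
      have hs' := sum_place_lt k B c' q fun q' hq' => hc' q' (by omega)
      have h2 := congrArg (· / B ^ index k q) h0
      simp only [Nat.add_mul_div_right _ _ (Nat.zero_lt_of_lt hs), Nat.div_eq_of_lt hs,
        Nat.div_eq_of_lt hs', zero_add] at h2
      have h3 := congrArg (· % B) h2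
      simpa [Nat.mod_eq_of_lt (hc q (by omega)), Nat.mod_eq_of_lt (hc' q (by omega))] using h3
    · simp only [ho, if_false, mul_zero, add_zero, Bool.false_eq_true] at h
      intro q hq hoq
      rcases Nat.lt_succ_iff_lt_or_eq.1 hq with hq | rfl
      · exact ih (fun q hq => hc q (by omega)) (fun q hq => hc' q (by omega)) _ _ h q hq hoq
      · exact absurd hoq ho

/-- The contribution of one user with the set `T` of resources: one for every pair in `T`, and one
in the top place if `T` is nonempty. -/
def code (k B T : ℕ) : ℕ :=
  ∑ q ∈ Finset.range (k * k),
    (if T.testBit (q / k) = true ∧ T.testBit (q % k) = true then place k B q else 0) +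
  if T = 0 then 0 else B ^ index k (k * k)

/-- The number of users below `n` that have both `r` and `r'`. -/
def common (n : ℕ) (T : ℕ → ℕ) (r r' : ℕ) : ℕ :=
  ∑ u ∈ Finset.range n, if (T u).testBit r = true ∧ (T u).testBit r' = true then 1 else 0

/-- The number of users below `n` that have a resource. -/
def active (n : ℕ) (T : ℕ → ℕ) : ℕ :=
  ∑ u ∈ Finset.range n, if T u = 0 then 0 else 1

theorem common_le_active (n : ℕ) (T : ℕ → ℕ) (r r' : ℕ) : common n T r r' ≤ active n T := by
  refine Finset.sum_le_sum fun u _ => ?_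
  by_cases h : T u = 0
  · simp [h]
  · rw [if_neg h]
    split_ifs <;> omega

theorem common_comm (n : ℕ) (T : ℕ → ℕ) (r r' : ℕ) : common n T r r' = common n T r' r := by
  simp only [common, and_comm]

theorem sum_code (k B n : ℕ) (T : ℕ → ℕ) :
    ∑ u ∈ Finset.range n, code k B (T u) =
      ∑ q ∈ Finset.range (k * k), common n T (q / k) (q % k) * place k B q +
        active n T * B ^ index k (k * k) := by
  simp only [code, common, active, Finset.sum_add_distrib, Finset.sum_mul]
  rw [Finset.sum_comm]
  simp only [ite_mul, one_mul, zero_mul]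

/-- The top coefficient counts the active users and dominates all other digits. If it is below `B`,
then so are they and nothing is carried; otherwise the top term alone reaches the bound. -/
theorem sum_code_lt_iff (k B n : ℕ) (T : ℕ → ℕ) :
    ∑ u ∈ Finset.range n, code k B (T u) < B ^ index k (k * k) * B ↔ active n T < B := by
  rw [sum_code]
  constructor
  · intro h
    by_contra! h'
    have := Nat.mul_le_mul_right (B ^ index k (k * k)) h'
    rw [mul_comm B] at this
    omega
  · intro h
    have h1 := sum_place_lt k B (fun q => common n T (q / k) (q % k)) (k * k)
      fun q _ => (common_le_active n T _ _).trans_lt h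
    have := Nat.mul_le_mul_right (B ^ index k (k * k)) (Nat.succ_le_of_lt h)
    simp only [Nat.succ_eq_add_one] at this
    nlinarith

/-- The bound on the code limits the active users on both sides to fewer than `B`, so the
coefficients are genuine digits and can be compared. -/
theorem common_eq_of_sum_code_eq (k B n : ℕ) (T T' : ℕ → ℕ)
    (h : ∑ u ∈ Finset.range n, code k B (T u) = ∑ u ∈ Finset.range n, code k B (T' u))
    (hlt : ∑ u ∈ Finset.range n, code k B (T u) < B ^ index k (k * k) * B)
    {r r' : ℕ} (hr : r < k) (hr' : r' < k) : common n T r r' = common n T' r r' := by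
  -- Only ordered pairs own a digit; the number of common users is symmetric.
  wlog hle : r ≤ r' generalizing r r'
  · rw [common_comm, common_comm n T']
    exact this hr' hr (by omega)
  have h1 := (sum_code_lt_iff k B n T).1 hlt
  have h2 := (sum_code_lt_iff k B n T').1 (h ▸ hlt)
  rw [sum_code, sum_code] at h
  have hk : 0 < k := by omega
  have hd : (r * k + r') / k = r := by
    rw [add_comm, Nat.add_mul_div_right _ _ hk, Nat.div_eq_of_lt hr', zero_add]
  have hm : (r * k + r') % k = r' := by
    rw [add_comm, Nat.add_mul_mod_self_right, Nat.mod_eq_of_lt hr']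
  have := eq_of_sum_place_eq k B (fun q => common n T (q / k) (q % k))
    (fun q => common n T' (q / k) (q % k)) (k * k)
    (fun q _ => (common_le_active n T _ _).trans_lt h1)
    (fun q _ => (common_le_active n T' _ _).trans_lt h2) _ _ h (r * k + r') (by nlinarith)
    (by simpa [ordered, hd, hm] using hle)
  simpa only [hd, hm] using this

theorem index_row (k r : ℕ) (j : ℕ) (hj : j ≤ k) :
    index k (r * k + j) = index k (r * k) + (j - r) := by
  induction j with
  | zero => simp
  | succ j ih =>
    have hd : (r * k + j) / k = r := by
      rw [add_comm, Nat.add_mul_div_right _ _ (by omega), Nat.div_eq_of_lt (by omega), zero_add]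
    have hm : (r * k + j) % k = j := by
      rw [add_comm, Nat.add_mul_mod_self_right, Nat.mod_eq_of_lt (by omega)]
    rw [← add_assoc, index_succ, ih (by omega), ordered, hd, hm]
    simp only [decide_eq_true_eq]
    split_ifs <;> omega

theorem two_mul_index_mul_self (k : ℕ) : 2 * index k (k * k) = k * (k + 1) := by
  -- Row i contains k - i ordered pairs; this is twice the sum over i < r, with the negative term
  -- moved to the left.
  suffices h : ∀ r ≤ k, 2 * index k (r * k) + r * r = 2 * r * k + r by
    nlinarith [h k le_rfl]
  intro r
  induction r with
  | zero => simp [index]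
  | succ r ih =>
    intro hr
    have h1 := index_row k r k le_rfl
    rw [add_mul, one_mul, h1]
    obtain ⟨d, hd⟩ := Nat.exists_eq_add_of_lt (show r < k from hr)
    have h2 : k - r = d + 1 := by omega
    rw [h2]
    nlinarith [ih (by omega)]

end PairCode

/-! ## Optimal solutions by solving the knapsack problem -/

/-- The relation that gives the resources with numbers in the bits of `T u` to user `u`. -/
def relOfMasks (n k : ℕ) (T : ℕ → ℕ) : Finset (Fin n × Fin k) :=
  Finset.univ.filter fun p => (T p.1).testBit p.2 = true

theorem resourcesOf_relOfMasks (n k : ℕ) (T : ℕ → ℕ) (u : Fin n) :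
    resourcesOf (relOfMasks n k T) u = maskSet k (T u) := by
  ext r
  simp [relOfMasks, maskSet]

theorem card_usersOf_relOfMasks (n k : ℕ) (T : ℕ → ℕ) (r r' : Fin k) :
    (usersOf (relOfMasks n k T) r ∩ usersOf (relOfMasks n k T) r').card =
      PairCode.common n T r r' := by
  rw [PairCode.common, Finset.sum_range fun u =>
    if (T u).testBit r = true ∧ (T u).testBit r' = true then 1 else 0, Finset.sum_boole]
  simp only [Nat.cast_id]
  congr 1
  ext u
  simp [relOfMasks]

/-- The diagonal pair (r, r) counts the users of r, so the code also decides completeness. -/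
theorem complete_relOfMasks_iff (n k : ℕ) (T : ℕ → ℕ) :
    ValuedAPEP.Complete (relOfMasks n k T) ↔ ∀ r : Fin k, PairCode.common n T r r ≠ 0 := by
  refine forall_congr' fun r => ?_
  rw [← card_usersOf_relOfMasks, Finset.inter_self, Finset.card_ne_zero]

theorem exists_relOfMasks_eq {n k : ℕ} (A : Finset (Fin n × Fin k)) :
    ∃ T : ℕ → ℕ, (∀ u, T u < 2 ^ k) ∧ relOfMasks n k T = A ∧
      PairCode.active n T =
        (Finset.univ.filter fun u => (resourcesOf A u).Nonempty).card := by
  classical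
  -- Numbers `u ≥ n` receive the empty set.
  let T : ℕ → ℕ := fun u => Nat.ofBits fun r : Fin k => decide (∃ h : u < n, (⟨u, h⟩, r) ∈ A)
  have hT : relOfMasks n k T = A := by
    ext ⟨u, r⟩
    simp [relOfMasks, T]
  refine ⟨T, fun u => Nat.ofBits_lt_two_pow _, hT, ?_⟩
  rw [PairCode.active, Finset.sum_range fun u => if T u = 0 then 0 else 1, Finset.card_filter]
  refine Finset.sum_congr rfl fun u _ => ?_
  rw [← ite_not]
  refine if_congr ?_ rfl rfl
  rw [← hT, resourcesOf_relOfMasks]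
  constructor
  · intro h
    obtain ⟨i, hi⟩ := Nat.exists_testBit_of_ne_zero h
    by_cases hik : i < k
    · exact ⟨⟨i, hik⟩, by simpa [maskSet] using hi⟩
    · simp [T, Nat.testBit_ofBits_ge _ _ (not_lt.1 hik)] at hi
  · rintro ⟨r, hr⟩ h
    simp [maskSet, h] at hr

/-- The weight of a constraint as a function of the number of common users. -/
def BSConstraint.countWeight {R : Type} : BSConstraint R → ℕ → ℕ
  | bodE _ _ l _, x => if x = 0 then l else 0
  | sodU _ _ f, x => f.toFun (x : ℤ)

theorem BSConstraint.weight_relOfMasks {n k : ℕ} (c : BSConstraint (Fin k)) (T : ℕ → ℕ) :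
    c.weight (relOfMasks n k T) = c.countWeight (PairCode.common n T c.fst c.snd) := by
  cases c with
  | bodE r r' l hl =>
    simp only [weight, countWeight, fst, snd, ← card_usersOf_relOfMasks, Finset.card_eq_zero,
      ← Finset.not_nonempty_iff_eq_empty, ite_not]
  | sodU r r' f => simp only [weight, countWeight, fst, snd, card_usersOf_relOfMasks]

theorem BSConstraint.fst_lt {k : ℕ} (c : BSConstraint (Fin k)) : c.fst < k := by
  cases c <;> exact Fin.is_lt _

theorem BSConstraint.snd_lt {k : ℕ} (c : BSConstraint (Fin k)) : c.snd < k := by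
  cases c <;> exact Fin.is_lt _

namespace BSInstance

variable {n k : ℕ} (I : BSInstance (Fin n) (Fin k))

/-- The total weight of the constraints in terms of the sets of resources of the users. -/
def maskPenalty (T : ℕ → ℕ) : ℕ :=
  (I.C.map fun c => c.countWeight (PairCode.common n T c.fst c.snd)).sum

/-- The authorization weight in the machine's table. -/
def maskAuth (u T : ℕ) : ℕ := I.memory 1 (u * 2 ^ k + T)

theorem maskAuth_eq (u : Fin n) {T : ℕ} (hT : T < 2 ^ k) :
    I.maskAuth u T = I.auth.toFun u (maskSet k T) := by
  have h : u * 2 ^ k + T < n * 2 ^ k := by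
    nlinarith [Nat.mul_le_mul_right (2 ^ k) (Nat.succ_le_of_lt u.2)]
  have hd : (u * 2 ^ k + T) / 2 ^ k = u := by
    rw [add_comm, Nat.add_mul_div_right _ _ (by positivity), Nat.div_eq_of_lt hT, zero_add]
  have hm : (u * 2 ^ k + T) % 2 ^ k = T := by
    rw [add_comm, Nat.add_mul_mod_self_right, Nat.mod_eq_of_lt hT]
  rw [maskAuth, memory, dif_pos h]
  simp only [hd, hm]

theorem weight_relOfMasks {T : ℕ → ℕ} (hT : ∀ u < n, T u < 2 ^ k) :
    I.toAPEP.weight (relOfMasks n k T) =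
      ∑ u ∈ Finset.range n, I.maskAuth u (T u) + I.maskPenalty T := by
  rw [ValuedAPEP.weight, Finset.sum_range fun u => I.maskAuth u (T u), maskPenalty]
  congr 1
  · refine Finset.sum_congr rfl fun u _ => ?_
    rw [resourcesOf_relOfMasks, I.maskAuth_eq u (hT u u.2)]
    rfl
  · simp [toAPEP, Function.comp_def, BSConstraint.weight_relOfMasks]

/-- The number of values of the code of a relation in which at most `k²` users have a
resource. -/
def codeBound (k : ℕ) : ℕ :=
  (k * k + 1) ^ PairCode.index k (k * k) * (k * k + 1)

/-- An optimal choice of sets of resources with a given code. -/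
def codeChoice (c : ℕ) : ℕ → ℕ :=
  Knapsack.choice (PairCode.code k (k * k + 1)) I.maskAuth (2 ^ k) n c

/-- One more than the minimum weight of a complete relation with code `c`; zero if there is
none. -/
def codeValue (c : ℕ) : ℕ :=
  if Knapsack.value (PairCode.code k (k * k + 1)) I.maskAuth (2 ^ k) n c ≠ 0 ∧
      ∀ r < k, PairCode.common n (I.codeChoice c) r r ≠ 0 then
    Knapsack.value (PairCode.code k (k * k + 1)) I.maskAuth (2 ^ k) n c +
      I.maskPenalty (I.codeChoice c)
  else 0

/-- An optimal relation with at most k² active users has a code c in the searched range. The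
knapsack choice for c has the same common counts, hence is complete with the same penalty, and its
authorization weight is no larger. Conversely, every nonzero `codeValue` is one more than the weight
of an actual complete relation, so the minimum over all codes is the optimum. -/
theorem isSolution_of_minUpTo (hn : 0 < n) :
    I.toAPEP.IsSolution
      (relOfMasks n k (I.codeChoice (minUpTo I.codeValue (codeBound k)).2)) := by
  have : Nonempty (Fin n) := ⟨⟨0, hn⟩⟩
  obtain ⟨A, hA, hcard⟩ := I.exists_isSolution_card_le
  obtain ⟨T, hT, rfl, hact⟩ := exists_relOfMasks_eq A
  simp only [Fintype.card_fin] at hcard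
  rw [← hact] at hcard
  have hlt := (PairCode.sum_code_lt_iff k (k * k + 1) n T).2 (by omega)
  obtain ⟨hv, hle⟩ := Knapsack.value_le (PairCode.code k (k * k + 1)) I.maskAuth (2 ^ k) T n
    fun u _ => hT u
  obtain ⟨-, hsum, -⟩ := Knapsack.choice_spec (PairCode.code k (k * k + 1)) I.maskAuth (2 ^ k) n
    _ hv
  generalize hc : ∑ u ∈ Finset.range n, PairCode.code k (k * k + 1) (T u) = c at *
  change ∑ u ∈ Finset.range n, PairCode.code k (k * k + 1) (I.codeChoice c u) = c at hsum
  have hcommon : ∀ r < k, ∀ r' < k,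
      PairCode.common n (I.codeChoice c) r r' = PairCode.common n T r r' := fun r hr r' hr' =>
    PairCode.common_eq_of_sum_code_eq k (k * k + 1) n _ _ (hsum.trans hc.symm)
      (hsum.symm ▸ hlt) hr hr'
  have hpen : I.maskPenalty (I.codeChoice c) = I.maskPenalty T := by
    rw [maskPenalty, maskPenalty]
    congr 1
    exact List.map_congr_left fun d _ => by rw [hcommon _ d.fst_lt _ d.snd_lt]
  have hcomp := (complete_relOfMasks_iff n k T).1 hA.1
  have hval : I.codeValue c = Knapsack.value (PairCode.code k (k * k + 1)) I.maskAuth (2 ^ k) n c +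
      I.maskPenalty T := by
    rw [codeValue, if_pos ⟨hv, fun r hr => (hcommon r hr r hr).symm ▸ hcomp ⟨r, hr⟩⟩, hpen]
  obtain ⟨hne, hmin⟩ := minUpTo_le I.codeValue (codeBound k) hlt (by omega)
  obtain ⟨-, hatt⟩ := minUpTo_attained _ _ hne
  generalize (minUpTo I.codeValue (codeBound k)).2 = c' at hatt
  rw [← hatt] at hne hmin
  have hne' := hne
  rw [codeValue] at hne'
  split_ifs at hne' with hcond
  · obtain ⟨hv', hcomp'⟩ := hcond
    obtain ⟨hmask, -, hcost⟩ := Knapsack.choice_spec (PairCode.code k (k * k + 1)) I.maskAuth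
      (2 ^ k) n _ hv'
    refine ⟨(complete_relOfMasks_iff n k _).2 fun r => hcomp' r r.2, fun A' hA' => ?_⟩
    refine le_trans ?_ (hA.2 A' hA')
    rw [I.weight_relOfMasks (T := I.codeChoice c') hmask, I.weight_relOfMasks fun u _ => hT u]
    rw [codeValue, if_pos ⟨hv', hcomp'⟩, hval] at hmin
    change ∑ u ∈ Finset.range n, I.maskAuth u (I.codeChoice c' u) + 1 = _ at hcost
    change ∑ u ∈ Finset.range n, I.maskAuth u (I.codeChoice c' u) + _ ≤ _
    omega
  · exact absurd rfl hne'

end BSInstance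

infixr:60 " ⨟ " => LProg.seq

namespace LProg

open RAMExpr

/-! ## Multiplication, powers of two, binary digits -/

/-- Register `dst` := register `x` times register `y`; `i` is an auxiliary register. -/
def mul (dst x y i : ℕ) : LProg :=
  assign dst (const 0) ⨟ loop i y (assign dst (add (reg dst) (reg x)))

theorem exec_mul {dst x y i : ℕ} (s : RAMState) (hx : x ≠ dst) (hy : y ≠ dst) (hd : i ≠ dst)
    (hxi : x ≠ i) :
    (mul dst x y i).exec s = (s.setReg dst (s.reg x * s.reg y)).setReg i (s.reg y) := by
  have h := exec_loop_induct (i := i) (b := y) (p := assign dst (add (reg dst) (reg x)))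
    (by simpa [writesReg] using hd) (s.setReg dst 0)
    (fun j s' => s' = (s.setReg dst (s.reg x * j)).setReg i j) (by simp) (by
      rintro j - _ - rfl
      ext z
      · simp [hd.symm, hx, hxi]
        split_ifs <;> simp [Nat.mul_succ]
      · rfl)
  simpa [mul, hy] using h

/-- Cell `r` of bank 8 := `2 ^ r` for `r < k`, and register 4 := `2 ^ k`, where register 1 holds
`k`. -/
def powers : LProg :=
  assign 4 (const 1) ⨟
  loop 10 1 (store 8 (reg 10) (reg 4) ⨟ assign 4 (add (reg 4) (reg 4)))

theorem exec_powers (s : RAMState) :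
    (powers.exec s).reg 4 = 2 ^ s.reg 1 ∧ ∀ r < s.reg 1, (powers.exec s).mem 8 r = 2 ^ r := by
  refine exec_loop_induct (i := 10) (b := 1) rfl (s.setReg 4 1)
    (fun j s' => s'.reg 4 = 2 ^ j ∧ ∀ r < j, s'.mem 8 r = 2 ^ r) (by simp) ?_
  rintro j - s' hs ⟨h4, h8⟩
  refine ⟨by simp [h4, pow_succ, mul_two], fun r hr => ?_⟩
  simp only [exec_seq, exec_store, exec_assign, RAMState.setReg_mem, RAMState.setMem_mem_same, eval,
    hs.counter, h4]
  split_ifs with h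
  · rw [h]
  · exact h8 r (by omega)

/-- Cells `r < k` of bank 9 := the binary digits of register 20, where register 1 holds `k`. -/
def bits : LProg :=
  loop 21 1 (
    assign 22 (sub (sub (reg 1) (reg 21)) (const 1)) ⨟
    -- With truncated subtraction, x + 1 - y is nonzero exactly if y ≤ x.
    ite (sub (add (reg 20) (const 1)) (load 8 (reg 22)))
      (store 9 (reg 22) (const 1) ⨟ assign 20 (sub (reg 20) (load 8 (reg 22))))
      (store 9 (reg 22) (const 0)))

/-- There is no division, so digits are split off greedily from the top: after j turns register 20
holds the number modulo 2^(k-j), and the next digit is 1 iff the next stored power fits. -/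
theorem exec_bits (s : RAMState) (hx : s.reg 20 < 2 ^ s.reg 1)
    (h8 : ∀ r < s.reg 1, s.mem 8 r = 2 ^ r) :
    ∀ r < s.reg 1, (bits.exec s).mem 9 r = ((s.reg 20).testBit r).toNat := by
  let Inv : ℕ → RAMState → Prop := fun j s' => s'.reg 20 = s.reg 20 % 2 ^ (s.reg 1 - j) ∧
    ∀ r < s.reg 1, s.reg 1 - j ≤ r → s'.mem 9 r = ((s.reg 20).testBit r).toNat
  have h : Inv (s.reg 1) (bits.exec s) := exec_loop_induct (i := 21) (b := 1) rfl s Inv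
    ⟨by simpa using (Nat.mod_eq_of_lt hx).symm, fun r h1 h2 => by omega⟩ (by
      rintro j hj s' hs ⟨h20, h9⟩
      obtain ⟨d, hd⟩ : ∃ d, s.reg 1 = j + d + 1 := ⟨s.reg 1 - j - 1, by omega⟩
      have e1 : s.reg 1 - j = d + 1 := by omega
      have e2 : s.reg 1 - (j + 1) = d := by omega
      have hs1 : s'.reg 1 = s.reg 1 := hs.reg 1 rfl
      have hs8 : s'.mem 8 d = 2 ^ d := by rw [hs.mem 8 rfl]; exact h8 d (by omega)
      rw [e1] at h20 h9
      simp only [Inv]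
      rw [e2]
      have key := Nat.mod_pow_succ (x := s.reg 20) (b := 2) (k := d)
      have hlt := Nat.mod_lt (s.reg 20) (show 0 < 2 ^ d by positivity)
      have hbit : (s.reg 20).testBit d = decide (s.reg 20 / 2 ^ d % 2 = 1) :=
        Nat.testBit_eq_decide_div_mod_eq
      have hrest : ∀ r < s.reg 1, d ≤ r → r ≠ d →
          s'.mem 9 r = ((s.reg 20).testBit r).toNat := fun r h1 h2 h3 => h9 r h1 (by omega)
      simp only [exec_seq, exec_store, exec_assign, exec_ite, eval, RAMState.setReg_reg, hs.counter,
        RAMState.setReg_mem, hs1, e1, Nat.add_sub_cancel, hs8, h20, reduceIte]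
      rcases Nat.mod_two_eq_zero_or_one (s.reg 20 / 2 ^ d) with h | h
      · rw [h, mul_zero, add_zero] at key
        rw [h] at hbit
        have hc : s.reg 20 % 2 ^ d + 1 - 2 ^ d = 0 := by omega
        rw [key]
        simp only [hc, reduceIte, Nat.reduceEqDiff]
        refine ⟨by simp [h20, key], fun r h1 h2 => ?_⟩
        simp only [RAMState.setReg_mem, RAMState.setMem_mem_same]
        split_ifs with hr
        · subst hr; simp [hbit]
        · exact hrest r h1 h2 hr
      · rw [h, mul_one] at key
        rw [h] at hbit
        have hc : s.reg 20 % 2 ^ d + 2 ^ d + 1 - 2 ^ d ≠ 0 := by omega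
        rw [key]
        simp only [hc, reduceIte, Nat.reduceEqDiff]
        refine ⟨by simp [h20, key, RAMState.setMem_mem_of_ne, hs8], fun r h1 h2 => ?_⟩
        simp only [RAMState.setReg_mem, RAMState.setMem_mem_same]
        split_ifs with hr
        · subst hr; simp [hbit]
        · exact hrest r h1 h2 hr)
  intro r hr
  exact h.2 r hr (by omega)

/-- One step of the computation of a minimum: if register `cand` is nonzero, and less than register
`best` or the latter is zero, then register `best` := register `cand` and register `arg` := register
`idx`. -/
def minStep (best arg cand idx : ℕ) : LProg :=
  ite (reg cand)
    (ite (reg best)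
      (ite (sub (reg best) (reg cand)) (assign best (reg cand) ⨟ assign arg (reg idx)) skip)
      (assign best (reg cand) ⨟ assign arg (reg idx)))
    skip

theorem exec_minStep {best arg cand idx : ℕ} (s : RAMState) (f : ℕ → ℕ) (j : ℕ)
    (hb : s.reg best = (minUpTo f j).1) (ha : s.reg arg = (minUpTo f j).2)
    (hc : s.reg cand = f j) (hi : s.reg idx = j) (hba : best ≠ arg := by decide)
    (hbi : idx ≠ best := by decide) :
    ((minStep best arg cand idx).exec s).reg best = (minUpTo f (j + 1)).1 ∧
      ((minStep best arg cand idx).exec s).reg arg = (minUpTo f (j + 1)).2 := by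
  simp only [minStep, exec_ite, exec_seq, exec_assign, exec_skip, eval, minUpTo, hb, hc]
  by_cases h1 : f j = 0
  · simp [h1, hb, ha]
  by_cases h2 : (minUpTo f j).1 = 0
  · simp [h1, h2, hba, hbi, hi]
  by_cases h3 : (minUpTo f j).1 - f j = 0
  · have : ¬ f j < (minUpTo f j).1 := by omega
    simp [h1, h2, h3, this, hb, ha]
  · have : f j < (minUpTo f j).1 := by omega
    simp [h1, h2, h3, this, hba, hbi, hi]

/-- Register 52 := the number of users that have, according to bank `b`, both the resources in the
registers 50 and 51. -/
def countCommon (b : ℕ) : LProg :=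
  assign 52 (const 0) ⨟
  loop 53 2 (
    mul 54 53 1 55 ⨟
    ite (load b (add (reg 54) (reg 50)))
      (ite (load b (add (reg 54) (reg 51))) (assign 52 (add (reg 52) (const 1))) skip)
      skip)

theorem exec_countCommon (b : ℕ) (s : RAMState) :
    ((countCommon b).exec s).reg 52 = ∑ u ∈ Finset.range (s.reg 2),
      if s.mem b (u * s.reg 1 + s.reg 50) ≠ 0 ∧ s.mem b (u * s.reg 1 + s.reg 51) ≠ 0
      then 1 else 0 := by
  refine exec_loop_induct (i := 53) (b := 2) rfl (s.setReg 52 0)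
    (fun j s' => s'.reg 52 = ∑ u ∈ Finset.range j,
      if s.mem b (u * s.reg 1 + s.reg 50) ≠ 0 ∧ s.mem b (u * s.reg 1 + s.reg 51) ≠ 0
      then 1 else 0) (by simp) ?_
  rintro j - s' hs h
  have h1 : s'.reg 1 = s.reg 1 := hs.reg 1 rfl
  have h50 : s'.reg 50 = s.reg 50 := hs.reg 50 rfl
  have h51 : s'.reg 51 = s.reg 51 := hs.reg 51 rfl
  have hm : s'.mem b = s.mem b := hs.mem b rfl
  rw [Finset.sum_range_succ, ← h]
  rw [exec_seq, exec_mul _ (by decide) (by decide) (by decide) (by decide)]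
  simp only [exec_ite, exec_assign, exec_skip, eval, RAMState.setReg_reg,
    RAMState.setReg_mem, hs.counter, h1, h50, h51, hm]
  simp only [reduceIte, Nat.reduceEqDiff]
  by_cases c1 : s.mem b (j * s.reg 1 + s.reg 50) = 0 <;>
  by_cases c2 : s.mem b (j * s.reg 1 + s.reg 51) = 0 <;> simp [c1, c2]

end LProg

/-! ### Numbers of the steps and the contents of the input banks -/

theorem Nat.mul_add_inj_of_lt {m a b a' b' : ℕ} (hb : b < m) (hb' : b' < m)
    (h : a * m + b = a' * m + b') : a = a' ∧ b = b' := by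
  have hm : 0 < m := by omega
  have h1 := congrArg (· / m) h
  have h2 := congrArg (· % m) h
  simp only [add_comm (_ * m), Nat.add_mul_div_right _ _ hm, Nat.div_eq_of_lt hb,
    Nat.div_eq_of_lt hb', Nat.add_mul_mod_self_right, Nat.mod_eq_of_lt hb,
    Nat.mod_eq_of_lt hb'] at h1 h2
  omega

/-- Rows have length k + 1: offset 0 is `none`, and offset r' + 1 ≤ k is `some r'`. -/
theorem stepCode_injective {k : ℕ} :
    Function.Injective (stepCode : Fin k × Option (Fin k) → ℕ) := by
  rintro ⟨r, _ | r'⟩ ⟨r₁, _ | r₁'⟩ h <;> simp only [stepCode] at h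
  · obtain ⟨h1, -⟩ := Nat.mul_add_inj_of_lt (b := 0) (b' := 0) k.succ_pos k.succ_pos h
    rw [Fin.ext h1]
  · obtain ⟨-, h2⟩ := Nat.mul_add_inj_of_lt (b := 0) k.succ_pos (Nat.succ_lt_succ r₁'.2) h
    omega
  · obtain ⟨-, h2⟩ := Nat.mul_add_inj_of_lt (b' := 0) (Nat.succ_lt_succ r'.2) k.succ_pos h
    omega
  · obtain ⟨h1, h2⟩ := Nat.mul_add_inj_of_lt (Nat.succ_lt_succ r'.2) (Nat.succ_lt_succ r₁'.2) h
    rw [Fin.ext h1, Fin.ext (Nat.succ_injective h2)]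

/-- The step with number `r * (k + 1) + j`. -/
theorem exists_stepCode_eq {k r j : ℕ} (hr : r < k) (hj : j < k + 1) :
    ∃ p : Fin k × Option (Fin k), p.1 = r ∧ stepCode p = r * (k + 1) + j := by
  rcases j with _ | j
  · exact ⟨(⟨r, hr⟩, none), rfl, rfl⟩
  · exact ⟨(⟨r, hr⟩, some ⟨j, by omega⟩), rfl, rfl⟩

theorem stepCode_div {k : ℕ} (p : Fin k × Option (Fin k)) : stepCode p / (k + 1) = p.1 := by
  obtain ⟨r, _ | r'⟩ := p
  · simp [stepCode]
  · rw [stepCode, add_comm, Nat.add_mul_div_right _ _ (by omega), Nat.div_eq_of_lt (by omega),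
      zero_add]

namespace BSInstance

variable {n k : ℕ} (I : BSInstance (Fin n) (Fin k))

theorem planArray_stepCode (π : I.Step → Fin n) (s : I.Step) :
    I.planArray π (stepCode s.1) = π s := by
  rw [planArray, Finset.sum_eq_single s]
  · simp
  · intro s' _ h
    rw [if_neg fun h' => h (Subtype.ext (stepCode_injective h'))]
  · simp

theorem stepSetArray_eq_zero_iff (T : Finset I.Step) (a : ℕ) :
    I.stepSetArray T a = 0 ↔ ∀ s ∈ T, stepCode s.1 ≠ a := by
  simp [stepSetArray]

theorem memory_two {i : ℕ} (hi : i < I.C.length) : I.memory 2 i = I.C[i].kind := by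
  simp [memory, hi]

theorem memory_three {i : ℕ} (hi : i < I.C.length) : I.memory 3 i = I.C[i].fst := by
  simp [memory, hi]

theorem memory_four {i : ℕ} (hi : i < I.C.length) : I.memory 4 i = I.C[i].snd := by
  simp [memory, hi]

theorem memory_five {i x : ℕ} (hi : i < I.C.length) (hx : x < n + 1) :
    I.memory 5 (i * (n + 1) + x) = I.C[i].table x := by
  have hd : (i * (n + 1) + x) / (n + 1) = i := by
    rw [add_comm, Nat.add_mul_div_right _ _ (by omega), Nat.div_eq_of_lt hx, zero_add]
  have hm : (i * (n + 1) + x) % (n + 1) = x := by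
    rw [add_comm, Nat.add_mul_mod_self_right, Nat.mod_eq_of_lt hx]
  simp [memory, hd, hm, hi]

end BSInstance

/-! ## The input registers -/

/-- The state holds the instance: `k`, `n`, `|C|`, `k + 1` are in registers 1, 2, 3, 8. -/
structure Loaded {n k : ℕ} (I : BSInstance (Fin n) (Fin k)) (s : RAMState) : Prop where
  reg_k : s.reg 1 = k
  reg_n : s.reg 2 = n
  reg_len : s.reg 3 = I.C.length
  reg_k_succ : s.reg 8 = k + 1
  mem : ∀ b ∈ [1, 2, 3, 4, 5], s.mem b = I.memory b

namespace LProg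

open RAMExpr

/-- The program changes neither the instance nor the registers that hold its dimensions. -/
def keepsInput (p : LProg) : Bool :=
  ([1, 2, 3, 8].all fun i => !p.writesReg i) && [1, 2, 3, 4, 5].all fun b => !p.writesMem b

end LProg

namespace Loaded

variable {n k : ℕ} {I : BSInstance (Fin n) (Fin k)} {s s' : RAMState}

theorem congr (h : Loaded I s) (hr : ∀ x ∈ [1, 2, 3, 8], s'.reg x = s.reg x)
    (hm : ∀ b ∈ [1, 2, 3, 4, 5], s'.mem b = s.mem b) : Loaded I s' :=
  ⟨(hr 1 (by decide)).trans h.reg_k, (hr 2 (by decide)).trans h.reg_n, (hr 3 (by decide)).trans h.reg_len,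
    (hr 8 (by decide)).trans h.reg_k_succ, fun b hb => (hm b hb).trans (h.mem b hb)⟩

theorem exec (h : Loaded I s) (p : LProg) (hp : p.keepsInput = true) : Loaded I (p.exec s) := by
  simp only [LProg.keepsInput, Bool.and_eq_true, List.all_eq_true, Bool.not_eq_true'] at hp
  exact h.congr (fun x hx => LProg.exec_reg x (hp.1 x hx)) fun b hb => LProg.exec_mem b (hp.2 b hb)

theorem atHead {i b j : ℕ} {p : LProg} (h : Loaded I s) (hs : LProg.AtHead i b p s j s')
    (hp : (LProg.loop i b p).keepsInput = true) : Loaded I s' := by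
  simp only [LProg.keepsInput, Bool.and_eq_true, List.all_eq_true, Bool.not_eq_true'] at hp
  exact h.congr (fun x hx => hs.reg x (hp.1 x hx)) fun b hb => hs.mem b (hp.2 b hb)

theorem setReg (h : Loaded I s) (i v : ℕ) (hi : i ∉ [1, 2, 3, 8]) : Loaded I (s.setReg i v) :=
  h.congr (fun x hx => by
    have : x ≠ i := fun h => hi (h ▸ hx)
    simp [this]) fun b _ => rfl

end Loaded

namespace LProg

open RAMExpr

/-- Load the dimensions of the instance. -/
def loadSizes : LProg :=
  assign 1 (load 0 (const 0)) ⨟ assign 2 (load 0 (const 1)) ⨟ assign 3 (load 0 (const 2)) ⨟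
  assign 8 (add (reg 1) (const 1))

theorem loaded_loadSizes {n k : ℕ} (I : BSInstance (Fin n) (Fin k)) (r0 : ℕ) (aux : ℕ → ℕ) :
    Loaded I (loadSizes.exec (I.inputState r0 aux)) := by
  refine ⟨?_, ?_, ?_, ?_, fun b hb => ?_⟩
  iterate 4 simp [loadSizes, BSInstance.inputState, BSInstance.memory]
  have hb7 : b ≠ 7 := by rintro rfl; simp at hb
  simp [loadSizes, BSInstance.inputState, hb7]

theorem mem_loadSizes {n k : ℕ} (I : BSInstance (Fin n) (Fin k)) (r0 : ℕ) (aux : ℕ → ℕ)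
    {b : ℕ} (hb : 5 < b) (hb7 : b ≠ 7) :
    (loadSizes.exec (I.inputState r0 aux)).mem b = fun _ => 0 := by
  rw [exec_mem _ rfl]
  funext a
  obtain ⟨b, rfl⟩ := Nat.exists_eq_add_of_lt hb
  simp only [BSInstance.inputState, Function.update_of_ne hb7]
  rw [BSInstance.memory] <;> omega

theorem mem_seven_loadSizes {n k : ℕ} (I : BSInstance (Fin n) (Fin k)) (r0 : ℕ) (aux : ℕ → ℕ) :
    (loadSizes.exec (I.inputState r0 aux)).mem 7 = aux := by
  rw [exec_mem _ rfl]
  simp [BSInstance.inputState]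

theorem reg_loadSizes {n k : ℕ} (I : BSInstance (Fin n) (Fin k)) (r0 : ℕ) (aux : ℕ → ℕ) :
    (loadSizes.exec (I.inputState r0 aux)).reg 0 = r0 := by
  rw [exec_reg _ rfl]
  simp [BSInstance.inputState]

/-! ## The steps of the Valued WSP instance -/

/-- Mark in bank `b` the two steps of an existential binding-of-duty constraint whose number is in
register 60, and in bank 10 its two resources. -/
def linkSteps (b : ℕ) : LProg :=
  assign 61 (load 3 (reg 60)) ⨟
  assign 62 (load 4 (reg 60)) ⨟
  mul 63 61 8 64 ⨟
  mul 65 62 8 64 ⨟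
  store b (add (reg 63) (add (reg 62) (const 1))) (const 1) ⨟
  store b (add (reg 65) (add (reg 61) (const 1))) (const 1) ⨟
  store 10 (reg 61) (const 1) ⨟
  store 10 (reg 62) (const 1)

theorem exec_linkSteps {b : ℕ} (hb : 10 < b ∨ b = 6) (s : RAMState) {x y : ℕ}
    (hx : s.mem 3 (s.reg 60) = x) (hy : s.mem 4 (s.reg 60) = y) :
    (∀ a, ((linkSteps b).exec s).mem b a =
      if a = y * s.reg 8 + (x + 1) then 1 else if a = x * s.reg 8 + (y + 1) then 1
      else s.mem b a) ∧
    ∀ a, ((linkSteps b).exec s).mem 10 a =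
      if a = y then 1 else if a = x then 1 else s.mem 10 a := by
  have hb10 : b ≠ 10 := by omega
  simp only [linkSteps, exec_seq, exec_assign, exec_store, eval,
    exec_mul _ (show 61 ≠ 63 by decide) (show 8 ≠ 63 by decide) (show 64 ≠ 63 by decide)
      (show 61 ≠ 64 by decide),
    exec_mul _ (show 62 ≠ 65 by decide) (show 8 ≠ 65 by decide) (show 64 ≠ 65 by decide)
      (show 62 ≠ 64 by decide), RAMState.setMem_mem_apply, RAMState.setMem_reg,
    RAMState.setReg_reg, RAMState.setReg_mem, Nat.reduceEqDiff, reduceIte, hx, hy, hb10,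
    hb10.symm, false_and, true_and, implies_true, and_self]

/-- Mark the numbers of the steps in bank `b`. -/
def steps (b : ℕ) : LProg :=
  loop 60 3 (ite (load 2 (reg 60)) skip (linkSteps b)) ⨟
  loop 60 1 (
    mul 63 60 8 64 ⨟
    store b (reg 63) (sub (const 1) (load 10 (reg 60))))

/-- `r'` is linked to `r` by one of the first `j` constraints. -/
def LinkedBefore {n k : ℕ} (I : BSInstance (Fin n) (Fin k)) (j : ℕ) (r r' : Fin k) : Prop :=
  BSInstance.Linked (⟨I.C.take j, I.auth⟩ : BSInstance (Fin n) (Fin k)) r r'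

theorem linkedBefore_length {n k : ℕ} (I : BSInstance (Fin n) (Fin k)) (r r' : Fin k) :
    LinkedBefore I I.C.length r r' ↔ I.Linked r r' := by
  simp [LinkedBefore, BSInstance.Linked]

theorem linkedBefore_succ {n k : ℕ} (I : BSInstance (Fin n) (Fin k)) {j : ℕ}
    (hj : j < I.C.length) (r r' : Fin k) :
    LinkedBefore I (j + 1) r r' ↔ LinkedBefore I j r r' ∨ I.C[j].kind = 0 ∧
      (I.C[j].fst = r ∧ I.C[j].snd = r' ∨ I.C[j].fst = r' ∧ I.C[j].snd = r) := by
  simp only [LinkedBefore, BSInstance.Linked, List.take_succ_eq_append_getElem hj, List.mem_append,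
    List.mem_singleton]
  cases I.C[j] with
  | bodE a b l hl =>
    simp only [BSConstraint.kind, BSConstraint.fst, BSConstraint.snd, BSConstraint.bodE.injEq,
      true_and, Fin.val_inj]
    constructor
    · rintro ⟨l', hl', (h | ⟨rfl, rfl, rfl⟩) | (h | ⟨rfl, rfl, rfl⟩)⟩
      · exact Or.inl ⟨l', hl', Or.inl h⟩
      · exact Or.inr (Or.inl ⟨rfl, rfl⟩)
      · exact Or.inl ⟨l', hl', Or.inr h⟩
      · exact Or.inr (Or.inr ⟨rfl, rfl⟩)
    · rintro (⟨l', hl', h⟩ | ⟨rfl, rfl⟩ | ⟨rfl, rfl⟩)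
      · exact ⟨l', hl', h.imp Or.inl Or.inl⟩
      · exact ⟨l, hl, Or.inl (Or.inr ⟨rfl, rfl, rfl⟩)⟩
      · exact ⟨l, hl, Or.inr (Or.inr ⟨rfl, rfl, rfl⟩)⟩
  | sodU a b f => simp [BSConstraint.kind]

theorem ite_eq_ite_or {P Q R : Prop} [Decidable P] [Decidable Q] [Decidable R]
    [Decidable (R ∨ Q ∨ P)] :
    (if P then 1 else if Q then 1 else if R then 1 else 0) = if R ∨ Q ∨ P then 1 else 0 := by
  by_cases P <;> by_cases Q <;> by_cases R <;> simp [*]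

/-- The loop invariant says that the two banks describe the instance cut off after its first j
constraints. -/
theorem exec_steps_links {n k : ℕ} {I : BSInstance (Fin n) (Fin k)} {b : ℕ}
    (hb : b = 6 ∨ b = 12) {s : RAMState} (hs : Loaded I s) (hsb : s.mem b = fun _ => 0)
    (hs10 : s.mem 10 = fun _ => 0) [∀ r r', Decidable (I.Linked r r')]
    [∀ r, Decidable (∃ r', I.Linked r r')] :
    (∀ r r' : Fin k, ((loop 60 3 (ite (load 2 (reg 60)) skip (linkSteps b))).exec s).mem b
        (r * (k + 1) + (r' + 1)) = if I.Linked r r' then 1 else 0) ∧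
      ∀ r : Fin k, ((loop 60 3 (ite (load 2 (reg 60)) skip (linkSteps b))).exec s).mem 10 r =
        if ∃ r', I.Linked r r' then 1 else 0 := by
  classical
  simp only [← linkedBefore_length I]
  rw [← hs.reg_len]
  refine exec_loop_induct (i := 60) (b := 3) (by rcases hb with rfl | rfl <;> rfl) s
    (fun j s' => (∀ r r' : Fin k, s'.mem b (r * (k + 1) + (r' + 1)) =
        if LinkedBefore I j r r' then 1 else 0) ∧
      ∀ r : Fin k, s'.mem 10 r = if ∃ r', LinkedBefore I j r r' then 1 else 0) ?_ ?_
  · simp [LinkedBefore, BSInstance.Linked, hsb, hs10]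
  · rintro j hj s' hs' ⟨hlink, hflag⟩
    have hl : Loaded I s' := hs.atHead hs' (by rcases hb with rfl | rfl <;> rfl)
    rw [hs.reg_len] at hj
    have m2 : s'.mem 2 (s'.reg 60) = I.C[j].kind := by
      rw [hs'.counter, hl.mem 2 (by decide), I.memory_two hj]
    have m3 : s'.mem 3 (s'.reg 60) = I.C[j].fst := by
      rw [hs'.counter, hl.mem 3 (by decide), I.memory_three hj]
    have m4 : s'.mem 4 (s'.reg 60) = I.C[j].snd := by
      rw [hs'.counter, hl.mem 4 (by decide), I.memory_four hj]
    simp only [linkedBefore_succ I hj, RAMState.setReg_mem, exec_ite, eval, m2, exec_skip]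
    by_cases hk : I.C[j].kind = 0
    · obtain ⟨e1, e2⟩ := exec_linkSteps (b := b) (by omega) s' m3 m4
      simp only [hk, reduceIte, true_and, e1, e2, hl.reg_k_succ]
      have f1 := I.C[j].fst_lt
      have f2 := I.C[j].snd_lt
      generalize I.C[j].fst = x at f1
      generalize I.C[j].snd = y at f2
      constructor
      · intro r r'
        rw [hlink]
        have e1 : (r * (k + 1) + (r' + 1) = x * (k + 1) + (y + 1)) ↔ x = r ∧ y = r' :=
          ⟨fun h => by
            have := Nat.mul_add_inj_of_lt (Nat.succ_lt_succ r'.2) (Nat.succ_lt_succ f2) h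
            omega, by rintro ⟨rfl, rfl⟩; rfl⟩
        have e2 : (r * (k + 1) + (r' + 1) = y * (k + 1) + (x + 1)) ↔ x = r' ∧ y = r :=
          ⟨fun h => by
            have := Nat.mul_add_inj_of_lt (Nat.succ_lt_succ r'.2) (Nat.succ_lt_succ f1) h
            omega, by rintro ⟨rfl, rfl⟩; rfl⟩
        simp only [e1, e2]
        exact ite_eq_ite_or
      · intro r
        rw [hflag]
        have e : (∃ r', LinkedBefore I j r r' ∨ (x = r ∧ y = r' ∨ x = r' ∧ y = r)) ↔
            (∃ r', LinkedBefore I j r r') ∨ r = x ∨ r = y := by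
          constructor
          · rintro ⟨r', h | ⟨h, -⟩ | ⟨-, h⟩⟩
            · exact Or.inl ⟨r', h⟩
            · exact Or.inr (Or.inl h.symm)
            · exact Or.inr (Or.inr h.symm)
          · rintro (⟨r', h⟩ | h | h)
            · exact ⟨r', Or.inl h⟩
            · exact ⟨⟨y, f2⟩, Or.inr (Or.inl ⟨h.symm, rfl⟩)⟩
            · exact ⟨⟨x, f1⟩, Or.inr (Or.inr ⟨rfl, h.symm⟩)⟩
        simp only [e]
        exact ite_eq_ite_or
    · simp only [hk, reduceIte, false_and, or_false]
      exact ⟨hlink, hflag⟩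

theorem exec_steps {n k : ℕ} {I : BSInstance (Fin n) (Fin k)} {b : ℕ} (hb : b = 6 ∨ b = 12)
    {s : RAMState} (hs : Loaded I s) (hsb : s.mem b = fun _ => 0)
    (hs10 : s.mem 10 = fun _ => 0) (p : Fin k × Option (Fin k)) :
    (I.IsStep p → ((steps b).exec s).mem b (stepCode p) = 1) ∧
      (¬ I.IsStep p → ((steps b).exec s).mem b (stepCode p) = 0) := by
  classical
  rw [steps, exec_seq]
  have h₁ := exec_steps_links hb hs hsb hs10
  have hl₁ := hs.exec (loop 60 3 (ite (load 2 (reg 60)) skip (linkSteps b)))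
    (by rcases hb with rfl | rfl <;> rfl)
  generalize (loop 60 3 (ite (load 2 (reg 60)) skip (linkSteps b))).exec s = s₁ at h₁ hl₁
  have h₂ : (∀ r r' : Fin k, ((loop 60 1 (mul 63 60 8 64 ⨟
        store b (reg 63) (sub (const 1) (load 10 (reg 60))))).exec s₁).mem b
          (r * (k + 1) + (r' + 1)) = if I.Linked r r' then 1 else 0) ∧
      ∀ r : Fin k, r < s₁.reg 1 → ((loop 60 1 (mul 63 60 8 64 ⨟
        store b (reg 63) (sub (const 1) (load 10 (reg 60))))).exec s₁).mem b
          (r * (k + 1)) = if ∃ r', I.Linked r r' then 0 else 1 := by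
    refine exec_loop_induct (i := 60) (b := 1) (by rcases hb with rfl | rfl <;> rfl) s₁
      (fun j s' => (∀ r r' : Fin k, s'.mem b (r * (k + 1) + (r' + 1)) =
          if I.Linked r r' then 1 else 0) ∧
        ∀ r : Fin k, r < j → s'.mem b (r * (k + 1)) = if ∃ r', I.Linked r r' then 0 else 1)
      ⟨h₁.1, by simp⟩ ?_
    rintro j hj s' hs' ⟨hlink, hflag⟩
    have hl : Loaded I s' := hl₁.atHead hs' (by rcases hb with rfl | rfl <;> rfl)
    have m10 : s'.mem 10 = s₁.mem 10 := hs'.mem 10 (by rcases hb with rfl | rfl <;> rfl)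
    have hb10 : 10 ≠ b := by omega
    rw [hl₁.reg_k] at hj
    simp only [exec_seq, exec_store, eval, hs'.counter,
      reduceIte, RAMState.setReg_reg, RAMState.setReg_mem, Nat.reduceEqDiff, 
      exec_mul _ (show 60 ≠ 63 by decide) (show 8 ≠ 63 by decide) (show 64 ≠ 63 by decide)
        (show 60 ≠ 64 by decide), hl.reg_k_succ, RAMState.setMem_mem_same, m10, h₁.2 ⟨j, hj⟩]
    constructor
    · intro r r'
      -- The cell written in this turn has offset 0 in its row, whereas linked steps have offset r'
      -- + 1.
      rw [if_neg, hlink]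
      intro h
      have := Nat.mul_add_inj_of_lt (b' := 0) (by omega) (by omega) h
      omega
    · intro r hr
      by_cases hrj : r = ⟨j, hj⟩
      · rw [if_pos (by rw [hrj]), ← hrj]
        split_ifs <;> rfl
      · have hne : r.1 ≠ j := fun h => hrj (Fin.ext h)
        rw [if_neg, hflag r (by omega)]
        intro h
        exact hne (Nat.eq_of_mul_eq_mul_right k.succ_pos h)
  obtain ⟨r, _ | r'⟩ := p
  · rw [stepCode, h₂.2 r (by rw [hl₁.reg_k]; exact r.2)]
    simp only [BSInstance.IsStep, ← not_exists]
    exact ⟨fun h => if_neg h, fun h => if_pos (not_not.1 h)⟩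
  · rw [stepCode, h₂.1 r r']
    exact ⟨fun h => if_pos h, fun h => if_neg h⟩

end LProg

/-! ### The relation read off a plan -/

theorem stepCode_lt {k : ℕ} (p : Fin k × Option (Fin k)) : stepCode p < k * (k + 1) := by
  rw [← Nat.div_lt_iff_lt_mul k.succ_pos, Nat.succ_eq_add_one, stepCode_div]
  exact p.1.2

namespace LProg

open RAMExpr

/-- Bank 12 marks the steps. -/
def StepsMarked {n k : ℕ} (I : BSInstance (Fin n) (Fin k)) (s : RAMState) : Prop :=
  ∀ p : Fin k × Option (Fin k),
    (I.IsStep p → s.mem 12 (stepCode p) = 1) ∧ (¬ I.IsStep p → s.mem 12 (stepCode p) = 0)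

/-- From the plan in bank 7 and the steps in bank 12, mark in bank `b` the pairs of a user and a
resource such that the user performs a step of the resource. -/
def planRel (b : ℕ) : LProg :=
  loop 60 1 (
    mul 63 60 8 64 ⨟
    loop 61 8 (
      ite (load 12 (add (reg 63) (reg 61)))
        (assign 62 (load 7 (add (reg 63) (reg 61))) ⨟
          mul 65 62 1 66 ⨟
          store b (add (reg 65) (reg 60)) (const 1))
        skip))

/-- Both nested loops share one invariant, indexed by the number L = j(k+1) + i of step numbers
visited so far. Bank 12 filters out the numbers that belong to no step. -/
theorem exec_planRel {n k : ℕ} {I : BSInstance (Fin n) (Fin k)} {b : ℕ} (hb : b = 6 ∨ b = 11)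
    {s : RAMState} (hs : Loaded I s) (hsb : s.mem b = fun _ => 0) (π : I.Step → Fin n)
    (h7 : s.mem 7 = I.planArray π) (h12 : StepsMarked I s) (a : ℕ) :
    ((planRel b).exec s).mem b a ≠ 0 ↔ ∃ t : I.Step, a = π t * k + t.1.1 := by
  let Inv : ℕ → RAMState → Prop := fun L s' =>
    ∀ a, s'.mem b a ≠ 0 ↔ ∃ t : I.Step, stepCode t.1 < L ∧ a = π t * k + t.1.1
  have hmain : Inv (s.reg 1 * (k + 1)) ((planRel b).exec s) := by
    refine exec_loop_induct (i := 60) (b := 1) (by rcases hb with rfl | rfl <;> rfl) s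
      (fun j s' => Inv (j * (k + 1)) s') (by simp [Inv, hsb]) ?_
    intro j hj s₁ hs₁ h₁
    have hl₁ : Loaded I s₁ := hs.atHead hs₁ (by rcases hb with rfl | rfl <;> rfl)
    have g7 : s₁.mem 7 = s.mem 7 := hs₁.mem 7 (by rcases hb with rfl | rfl <;> rfl)
    have g12 : s₁.mem 12 = s.mem 12 := hs₁.mem 12 (by rcases hb with rfl | rfl <;> rfl)
    rw [hs.reg_k] at hj
    rw [exec_seq, exec_mul _ (by decide) (by decide) (by decide) (by decide), hs₁.counter,
      hl₁.reg_k_succ]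
    obtain ⟨s₂, hs₂⟩ : ∃ s₂, s₂ = (s₁.setReg 63 (j * (k + 1))).setReg 64 (k + 1) := ⟨_, rfl⟩
    rw [← hs₂]
    have hl₂ : Loaded I s₂ := hs₂ ▸ (hl₁.setReg _ _ (by decide)).setReg _ _ (by decide)
    have e60 : s₂.reg 60 = j := by simp [hs₂, hs₁.counter]
    have e63 : s₂.reg 63 = j * (k + 1) := by simp [hs₂]
    have em : s₂.mem = s₁.mem := by simp [hs₂]
    suffices h : Inv (j * (k + 1) + s₂.reg 8) ((loop 61 8 (
      ite (load 12 (add (reg 63) (reg 61)))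
        (assign 62 (load 7 (add (reg 63) (reg 61))) ⨟
          mul 65 62 1 66 ⨟
          store b (add (reg 65) (reg 60)) (const 1))
        skip)).exec s₂) by
      rwa [hl₂.reg_k_succ, show j * (k + 1) + (k + 1) = (j + 1) * (k + 1) by ring] at h
    refine exec_loop_induct (i := 61) (b := 8) rfl s₂
      (fun i s' => Inv (j * (k + 1) + i) s') (by simpa [Inv, em] using h₁) ?_
    intro i hi s₃ hs₃ h₃
    rw [hl₂.reg_k_succ] at hi
    have hl₃ : Loaded I s₃ := hl₂.atHead hs₃ (by rcases hb with rfl | rfl <;> rfl)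
    have f60 : s₃.reg 60 = j := (hs₃.reg 60 rfl).trans e60
    have f63 : s₃.reg 63 = j * (k + 1) := (hs₃.reg 63 rfl).trans e63
    have f7 : s₃.mem 7 = I.planArray π := by
      rw [hs₃.mem 7 (by rcases hb with rfl | rfl <;> rfl), em, g7, h7]
    have f12 : s₃.mem 12 = s.mem 12 := by
      rw [hs₃.mem 12 (by rcases hb with rfl | rfl <;> rfl), em, g12]
    obtain ⟨p, hp1, hp2⟩ := exists_stepCode_eq hj hi
    simp only [exec_ite, exec_seq, exec_assign, exec_store, exec_skip, eval, RAMState.setReg_reg,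
      f60, f63, f7, f12, hs₃.counter, Nat.reduceEqDiff, reduceIte,
      exec_mul _ (show 62 ≠ 65 by decide) (show 1 ≠ 65 by decide) (show 66 ≠ 65 by decide)
        (show 62 ≠ 66 by decide), hl₃.reg_k]
    rw [← hp2]
    intro a
    by_cases hstep : I.IsStep p
    · rw [(h12 p).1 hstep, if_neg one_ne_zero]
      rw [I.planArray_stepCode π ⟨p, hstep⟩]
      simp only [RAMState.setMem_mem_same, RAMState.setReg_mem]
      have e : ∀ t : I.Step, stepCode t.1 < j * (k + 1) + (i + 1) ↔
          stepCode t.1 < j * (k + 1) + i ∨ t = ⟨p, hstep⟩ := by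
        intro t
        rw [← add_assoc, Nat.lt_succ_iff_lt_or_eq, ← hp2]
        exact or_congr_right ⟨fun h => Subtype.ext (stepCode_injective h), fun h => by rw [h]⟩
      by_cases ha : a = π ⟨p, hstep⟩ * k + j
      · rw [if_pos ha]
        simp only [ne_eq, one_ne_zero, not_false_eq_true, true_iff]
        exact ⟨⟨p, hstep⟩, (e _).2 (Or.inr rfl), by rw [ha, ← hp1]⟩
      · rw [if_neg ha, h₃ a]
        refine exists_congr fun t => ?_
        rw [e]
        constructor
        · exact fun h => ⟨Or.inl h.1, h.2⟩
        · rintro ⟨h | rfl, h'⟩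
          · exact ⟨h, h'⟩
          · exact absurd (by rw [h', ← hp1]) ha
    · rw [(h12 p).2 hstep, if_pos rfl]
      simp only [RAMState.setReg_mem]
      rw [h₃ a]
      refine exists_congr fun t => and_congr_left fun _ => ?_
      rw [← add_assoc, Nat.lt_succ_iff_lt_or_eq, ← hp2]
      refine (or_iff_left fun h => hstep ?_).symm
      rw [← stepCode_injective h]
      exact t.2
  rw [hs.reg_k] at hmain
  rw [hmain a]
  exact exists_congr fun t => and_iff_right (stepCode_lt _)

theorem exec_planRel_iff {n k : ℕ} {I : BSInstance (Fin n) (Fin k)} {b : ℕ} (hb : b = 6 ∨ b = 11)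
    {s : RAMState} (hs : Loaded I s) (hsb : s.mem b = fun _ => 0) (π : I.Step → Fin n)
    (h7 : s.mem 7 = I.planArray π) (h12 : StepsMarked I s) (u : Fin n) (r : Fin k) :
    ((planRel b).exec s).mem b (u * k + r) ≠ 0 ↔ u ∈ I.stepUsers π r := by
  rw [exec_planRel hb hs hsb π h7 h12, BSInstance.mem_stepUsers]
  refine exists_congr fun t => ⟨fun h => ?_, ?_⟩
  · obtain ⟨h1, h2⟩ := Nat.mul_add_inj_of_lt r.2 t.1.1.2 h
    exact ⟨(Fin.ext h2).symm, (Fin.ext h1).symm⟩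
  · rintro ⟨rfl, rfl⟩
    rfl

end LProg

/-! ## Polynomial time -/

/-- A program that consists of a part without loops and a part whose loops are bounded by the size
of the instance runs in polynomial time. -/
theorem ParamProblem.isPolyTime_of_lprog (Q : ParamProblem) (p q : LProg) (hp : p.wf = true)
    (hpb : p.bounds = []) (hq : q.wf = true) (hsize : ∀ x, 0 < Q.size x)
    (hb : ∀ x, ∀ b ∈ q.bounds, (p.exec (Q.input x)).reg b ≤ 2 * Q.size x)
    (hcorrect : ∀ x, Q.Correct x (q.exec (p.exec (Q.input x)))) : Q.IsPolyTime := by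
  obtain ⟨c₁, hc₁⟩ := p.time_le_of_bounds_le
  obtain ⟨c₂, hc₂⟩ := q.time_le_of_bounds_le
  -- A single constant must serve as factor and as exponent, so factors and depths are added up. The
  -- program is split because `wf` forbids `q` to set its own loop bounds.
  refine ⟨.seq p.compile q.compile, c₁ + c₂ * 2 ^ q.depth + p.depth + q.depth, fun x => ?_⟩
  obtain ⟨t₁, ht₁, h₁⟩ := p.runs hp (Q.input x)
  obtain ⟨t₂, ht₂, h₂⟩ := q.runs hq (p.exec (Q.input x))
  refine ⟨_, _, h₁.seq h₂, hcorrect x, ?_⟩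
  have h3 := hc₁ (Q.input x).reg (Q.size x) (hsize x) (by simp [hpb])
  have h4 := hc₂ (p.exec (Q.input x)).reg (2 * Q.size x) (by have := hsize x; omega) (hb x)
  rw [mul_pow] at h4
  have hX := hsize x
  generalize Q.size x = X at *
  set c := c₁ + c₂ * 2 ^ q.depth + p.depth + q.depth with hc
  have e1 : X ^ p.depth ≤ X ^ c := Nat.pow_le_pow_right hX (by omega)
  have e2 : X ^ q.depth ≤ X ^ c := Nat.pow_le_pow_right hX (by omega)
  have : t₁ + t₂ ≤ c * X ^ c := by
    have f1 := Nat.mul_le_mul_left c₁ e1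
    have f2 := Nat.mul_le_mul_left (c₂ * 2 ^ q.depth) e2
    calc t₁ + t₂ ≤ c₁ * X ^ c + c₂ * 2 ^ q.depth * X ^ c := by
          rw [← mul_assoc] at h4
          omega
      _ = (c₁ + c₂ * 2 ^ q.depth) * X ^ c := by ring
      _ ≤ c * X ^ c := Nat.mul_le_mul_right _ (by omega)
  rw [one_mul]
  exact_mod_cast this

open LProg RAMExpr

theorem NumberedInstance.size_pos (x : NumberedInstance) : 0 < x.size := by
  have := x.n_pos
  rw [size]
  omega

theorem computeSteps_isPolyTime : computeSteps.IsPolyTime := by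
  refine computeSteps.isPolyTime_of_lprog loadSizes (steps 6) rfl rfl rfl
    NumberedInstance.size_pos (fun x => ?_) fun x => ?_
  · have hl := loaded_loadSizes x.I 0 fun _ => 0
    have h : ∀ b ∈ (steps 6).bounds, b ∈ [1, 3, 8] := by decide
    intro b hb
    have hn := x.n_pos
    have := h b hb
    simp only [List.mem_cons, List.not_mem_nil, or_false] at this
    change (loadSizes.exec (x.I.inputState 0 fun _ => 0)).reg b ≤ 2 * (x.k + x.n + x.I.C.length)
    rcases this with rfl | rfl | rfl
    · exact hl.reg_k.trans_le (by omega)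
    · exact hl.reg_len.trans_le (by omega)
    · exact hl.reg_k_succ.trans_le (by omega)
  · exact exec_steps (Or.inl rfl) (loaded_loadSizes _ _ _)
      (mem_loadSizes _ _ _ (by decide) (by decide)) (mem_loadSizes _ _ _ (by decide) (by decide))

theorem stepsMarked_exec {n k : ℕ} {I : BSInstance (Fin n) (Fin k)} {s : RAMState}
    (hs : Loaded I s) (h12 : s.mem 12 = fun _ => 0) (h10 : s.mem 10 = fun _ => 0) :
    StepsMarked I ((steps 12).exec s) :=
  exec_steps (Or.inr rfl) hs h12 h10

theorem solutionFromPlan_isPolyTime : solutionFromPlan.IsPolyTime := by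
  refine solutionFromPlan.isPolyTime_of_lprog loadSizes (steps 12 ⨟ planRel 6) rfl rfl rfl
    (fun y => y.1.size_pos) (fun ⟨x, π⟩ => ?_) fun ⟨x, π⟩ => ?_
  · have hl := loaded_loadSizes x.I 0 (x.I.planArray π.1)
    have h : ∀ b ∈ (steps 12 ⨟ planRel 6).bounds, b ∈ [1, 3, 8] := by decide
    intro b hb
    have hn := x.n_pos
    have := h b hb
    simp only [List.mem_cons, List.not_mem_nil, or_false] at this
    change (loadSizes.exec (x.I.inputState 0 (x.I.planArray π.1))).reg b ≤
      2 * (x.k + x.n + x.I.C.length)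
    rcases this with rfl | rfl | rfl
    · exact hl.reg_k.trans_le (by omega)
    · exact hl.reg_len.trans_le (by omega)
    · exact hl.reg_k_succ.trans_le (by omega)
  · have : Nonempty (Fin x.n) := ⟨⟨0, x.n_pos⟩⟩
    have hsol := x.I.isSolution_relOfPlan π.2
    change x.I.toAPEP.IsSolution (outputRel x.n x.k
      ((planRel 6).exec ((steps 12).exec (loadSizes.exec
        (x.I.inputState 0 (x.I.planArray π.1))))))
    convert hsol
    have hl := loaded_loadSizes x.I 0 (x.I.planArray π.1)
    ext ⟨u, r⟩
    rw [outputRel, Finset.mem_filter_univ,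
      exec_planRel_iff (Or.inl rfl) (hl.exec (steps 12) rfl)
        ((exec_mem 6 rfl).trans (mem_loadSizes _ _ _ (by decide) (by decide))) π.1
        ((exec_mem 7 rfl).trans (mem_seven_loadSizes _ _ _))
        (stepsMarked_exec hl (mem_loadSizes _ _ _ (by decide) (by decide))
          (mem_loadSizes _ _ _ (by decide) (by decide))),
      BSInstance.relOfPlan, Finset.mem_filter_univ]

/-! ### The weight of a constraint on a plan -/

namespace LProg

/-- The weight of the constraint with number in register 38 on the plan in bank 7. -/
def planWeight : LProg :=
  steps 12 ⨟ planRel 11 ⨟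
  assign 50 (load 3 (reg 38)) ⨟
  assign 51 (load 4 (reg 38)) ⨟
  countCommon 11 ⨟
  -- Register 56 becomes i·n + i, the start of row i in bank 5.
  mul 56 38 2 57 ⨟
  assign 56 (add (reg 56) (reg 38)) ⨟
  mul 63 50 8 64 ⨟
  mul 65 51 8 64 ⨟
  ite (load 2 (reg 38))
    (assign 0 (load 5 (add (reg 56) (reg 52))))
    -- The two truncated differences add up to the absolute difference, which vanishes iff the
    -- matched steps have the same user.
    (ite (add (sub (load 7 (add (reg 63) (add (reg 51) (const 1))))
            (load 7 (add (reg 65) (add (reg 50) (const 1)))))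
          (sub (load 7 (add (reg 65) (add (reg 50) (const 1))))
            (load 7 (add (reg 63) (add (reg 51) (const 1))))))
      (assign 0 (load 5 (reg 56)))
      (assign 0 (const 0)))

/-- The constraint is a free variable `c` equal to the list entry, so that it can be split into its
two kinds although `planConstraint` depends on a proof of membership. -/
theorem exec_planWeight {n k : ℕ} {I : BSInstance (Fin n) (Fin k)} {s : RAMState}
    (hs : Loaded I s) (h10 : s.mem 10 = fun _ => 0) (h11 : s.mem 11 = fun _ => 0)
    (h12 : s.mem 12 = fun _ => 0) (π : I.Step → Fin n) (h7 : s.mem 7 = I.planArray π)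
    {i : ℕ} (h38 : s.reg 38 = i) (hi : i < I.C.length) {c : BSConstraint (Fin k)}
    (hmem : c ∈ I.C) (hci : I.C[i] = c) :
    (planWeight.exec s).reg 0 = I.planConstraint c hmem π := by
  have hl₁ : Loaded I ((steps 12).exec s) := hs.exec _ rfl
  have hrel := exec_planRel_iff (Or.inr rfl) hl₁ ((exec_mem 11 rfl).trans h11) π
    ((exec_mem 7 rfl).trans h7) (stepsMarked_exec hs h12 h10)
  have hl₂ : Loaded I ((planRel 11).exec ((steps 12).exec s)) := hl₁.exec _ rfl
  have e38 : ((planRel 11).exec ((steps 12).exec s)).reg 38 = i := by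
    rw [exec_reg _ rfl, exec_reg _ rfl, h38]
  have e7 : ((planRel 11).exec ((steps 12).exec s)).mem 7 = I.planArray π := by
    rw [exec_mem _ rfl, exec_mem _ rfl, h7]
  rw [planWeight, exec_seq, exec_seq]
  generalize (planRel 11).exec ((steps 12).exec s) = s₂ at hrel hl₂ e38 e7
  clear hl₁ h7 h38 h10 h11 h12 hs
  have m2 : s₂.mem 2 i = c.kind := by rw [hl₂.mem 2 (by decide), I.memory_two hi, hci]
  have m3 : s₂.mem 3 i = c.fst := by rw [hl₂.mem 3 (by decide), I.memory_three hi, hci]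
  have m4 : s₂.mem 4 i = c.snd := by rw [hl₂.mem 4 (by decide), I.memory_four hi, hci]
  have f1 := c.fst_lt
  have f2 := c.snd_lt
  have hl₃ : Loaded I ((s₂.setReg 50 c.fst).setReg 51 c.snd) :=
    (hl₂.setReg _ _ (by decide)).setReg _ _ (by decide)
  have hcount := exec_countCommon 11 ((s₂.setReg 50 c.fst).setReg 51 c.snd)
  rw [hl₃.reg_n, hl₃.reg_k, Finset.sum_range] at hcount
  simp only [RAMState.setReg_reg, RAMState.setReg_mem, Nat.reduceEqDiff, reduceIte] at hcount
  have hcard : ((countCommon 11).exec ((s₂.setReg 50 c.fst).setReg 51 c.snd)).reg 52 =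
      (I.stepUsers π ⟨c.fst, f1⟩ ∩ I.stepUsers π ⟨c.snd, f2⟩).card := by
    rw [hcount, Finset.sum_boole, Nat.cast_id]
    congr 1
    ext u
    rw [Finset.mem_filter_univ, Finset.mem_inter, ← hrel, ← hrel]
  have hl₄ : Loaded I ((countCommon 11).exec ((s₂.setReg 50 c.fst).setReg 51 c.snd)) :=
    hl₃.exec _ rfl
  have e50 : ((countCommon 11).exec ((s₂.setReg 50 c.fst).setReg 51 c.snd)).reg 50 =
      c.fst := by rw [exec_reg _ rfl]; simp
  have e51 : ((countCommon 11).exec ((s₂.setReg 50 c.fst).setReg 51 c.snd)).reg 51 =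
      c.snd := by rw [exec_reg _ rfl]; simp
  have g38 : ((countCommon 11).exec ((s₂.setReg 50 c.fst).setReg 51 c.snd)).reg 38 =
      i := by rw [exec_reg _ rfl]; simp [e38]
  have g7 : ((countCommon 11).exec ((s₂.setReg 50 c.fst).setReg 51 c.snd)).mem 7 =
      I.planArray π := by rw [exec_mem _ rfl]; simp [e7]
  simp only [exec_seq, exec_assign, eval, e38, m3, m4, RAMState.setReg_reg, RAMState.setReg_mem,
    Nat.reduceEqDiff, reduceIte]
  generalize (countCommon 11).exec ((s₂.setReg 50 c.fst).setReg 51 c.snd) = s₄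
    at hl₄ e50 e51 g38 g7 hcard
  rw [exec_mul _ (by decide) (by decide) (by decide) (by decide),
    exec_mul _ (by decide) (by decide) (by decide) (by decide),
    exec_mul _ (by decide) (by decide) (by decide) (by decide)]
  have q2 : s₄.mem 2 i = c.kind := by rw [hl₄.mem 2 (by decide), I.memory_two hi, hci]
  simp only [exec_ite, exec_assign, eval, RAMState.setReg_reg, RAMState.setReg_mem,
    Nat.reduceEqDiff, reduceIte, e50, e51, g38, g7, hl₄.reg_k_succ, hl₄.reg_n, hcard, q2,
    hl₄.mem 5 (by decide)]
  have hle : (I.stepUsers π ⟨c.fst, f1⟩ ∩ I.stepUsers π ⟨c.snd, f2⟩).card < n + 1 :=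
    Nat.lt_succ_of_le ((Finset.card_le_univ _).trans (Fintype.card_fin n).le)
  have t0 : I.memory 5 (i * n + i) = c.table 0 := by
    rw [← hci, ← I.memory_five hi n.succ_pos]; ring_nf
  have tc := I.memory_five hi hle
  rw [hci] at tc
  rw [show ∀ c, i * (n + 1) + c = i * n + i + c by intro c; ring] at tc
  rw [t0, tc]
  clear tc t0 hle q2 hcard g7 g38 e50 e51 hcount hl₃ m2 m3 m4 hrel
  generalize hX : I.planArray π (c.fst * (k + 1) + (c.snd + 1)) = X
  generalize hY : I.planArray π (c.snd * (k + 1) + (c.fst + 1)) = Y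
  cases c with
  | bodE r r' l hl =>
    have p1 := I.planArray_stepCode π ⟨(r, some r'), ⟨l, hl, Or.inl hmem⟩⟩
    have p2 := I.planArray_stepCode π ⟨(r', some r), ⟨l, hl, Or.inr hmem⟩⟩
    rw [show stepCode (r, some r') = r * (k + 1) + (r' + 1) from rfl] at p1
    rw [show stepCode (r', some r) = r' * (k + 1) + (r + 1) from rfl] at p2
    simp only [BSConstraint.fst, BSConstraint.snd, p1, p2] at hX hY
    simp only [BSConstraint.kind, BSConstraint.fst, BSConstraint.snd, BSConstraint.table, reduceIte,
      BSInstance.planConstraint]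
    split_ifs with h1 h2 h2
    · simp
    · exact absurd (Fin.ext (by omega)) h2
    · have := congrArg Fin.val h2
      omega
    · simp
  | sodU r r' f =>
    simp [BSConstraint.kind, BSConstraint.fst, BSConstraint.snd, BSConstraint.table,
      BSInstance.planConstraint]

end LProg

theorem computeWSPConstraint_input (x : NumberedInstance) (i : Fin x.I.C.length)
    (π : x.I.Step → Fin x.n) :
    computeWSPConstraint.input ⟨x, i, π⟩ = x.I.inputState i (x.I.planArray π) := rfl

theorem computeWSPConstraint_correct_iff (x : NumberedInstance) (i : Fin x.I.C.length)
    (π : x.I.Step → Fin x.n) (s : RAMState) :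
    computeWSPConstraint.Correct ⟨x, i, π⟩ s ↔
      s.reg 0 = x.I.planConstraint x.I.C[i] (List.getElem_mem _) π := Iff.rfl

theorem computeWSPConstraint_isPolyTime : computeWSPConstraint.IsPolyTime := by
  refine computeWSPConstraint.isPolyTime_of_lprog (loadSizes ⨟ assign 38 (reg 0)) planWeight
    rfl rfl rfl (fun y => y.1.size_pos) (fun ⟨x, i, π⟩ => ?_) fun ⟨x, i, π⟩ => ?_
  · have hl := (loaded_loadSizes x.I i (x.I.planArray π)).exec (assign 38 (reg 0)) rfl
    have h : ∀ b ∈ planWeight.bounds, b ∈ [1, 2, 3, 8] := by decide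
    intro b hb
    have hn := x.n_pos
    have := h b hb
    simp only [List.mem_cons, List.not_mem_nil, or_false] at this
    change ((assign 38 (reg 0)).exec (loadSizes.exec (x.I.inputState i (x.I.planArray π)))).reg b ≤
      2 * (x.k + x.n + x.I.C.length)
    rcases this with rfl | rfl | rfl | rfl
    · exact hl.reg_k.trans_le (by omega)
    · exact hl.reg_n.trans_le (by omega)
    · exact hl.reg_len.trans_le (by omega)
    · exact hl.reg_k_succ.trans_le (by omega)
  · have hl := (loaded_loadSizes x.I i (x.I.planArray π)).exec (assign 38 (reg 0)) rfl
    have hmem : ∀ b, 5 < b → b ≠ 7 → ((assign 38 (reg 0)).exec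
        (loadSizes.exec (x.I.inputState i (x.I.planArray π)))).mem b = fun _ => 0 :=
      fun b h h' => (exec_mem b rfl).trans (mem_loadSizes _ _ _ h h')
    have h7 : ((assign 38 (reg 0)).exec
        (loadSizes.exec (x.I.inputState i (x.I.planArray π)))).mem 7 = x.I.planArray π :=
      (exec_mem 7 rfl).trans (mem_seven_loadSizes _ _ _)
    rw [computeWSPConstraint_correct_iff, computeWSPConstraint_input, exec_seq]
    exact exec_planWeight hl (hmem 10 (by decide) (by decide)) (hmem 11 (by decide) (by decide)) (hmem 12 (by decide) (by decide)) π
      h7 (by simp [reg_loadSizes]) i.2 (List.getElem_mem _) rfl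

/-! ### The authorization weight of a set of steps -/

namespace LProg

/-- Add to register 34 the cells of bank 7 from the address in register 32 on, as many as
register 8 says. -/
def rowSum : LProg :=
  loop 35 8 (assign 34 (add (reg 34) (load 7 (add (reg 32) (reg 35)))))

/-- Collect in register 30 the bits of the resources that have a step in bank 7. -/
def stepResources : LProg :=
  loop 31 1 (
    mul 32 31 8 33 ⨟
    assign 34 (const 0) ⨟
    rowSum ⨟
    ite (reg 34) (assign 30 (add (reg 30) (load 8 (reg 31)))) skip)

/-- The authorization weight of the user in register 38 on the set of steps in bank 7. -/
def planAuth : LProg :=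
  powers ⨟
  assign 30 (const 0) ⨟
  stepResources ⨟
  -- The loop adds 2^k as often as the user's number says; looping 2^k times instead would not be
  -- polynomial.
  mul 36 4 38 37 ⨟
  assign 0 (load 1 (add (reg 36) (reg 30)))

/-- After j turns register 30 is the mask, below 2^j, of the resources below j that have a step in
T. Adding 2^j to such a number sets the bit j and no other. -/
theorem exec_planAuth {n k : ℕ} {I : BSInstance (Fin n) (Fin k)} {s : RAMState}
    (hs : Loaded I s) (T : Finset I.Step) (h7 : s.mem 7 = I.stepSetArray T)
    (u : Fin n) (h38 : s.reg 38 = u) :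
    (planAuth.exec s).reg 0 = I.toWSP.auth.toFun u T := by
  have hl₁ : Loaded I (powers.exec s) := hs.exec _ rfl
  obtain ⟨e4, e8⟩ := exec_powers s
  rw [hs.reg_k] at e4 e8
  have e7 : (powers.exec s).mem 7 = I.stepSetArray T := (exec_mem _ rfl).trans h7
  have e38 : (powers.exec s).reg 38 = u := (exec_reg _ rfl).trans h38
  rw [planAuth, exec_seq]
  generalize powers.exec s = s₁ at *
  let Inv : ℕ → RAMState → Prop := fun j s' => s'.reg 30 < 2 ^ j ∧
    ∀ r, (s'.reg 30).testBit r = true ↔ r < j ∧ ∃ t ∈ T, t.1.1 = r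
  have h : Inv ((s₁.setReg 30 0).reg 1) (stepResources.exec (s₁.setReg 30 0)) := by
    refine exec_loop_induct (i := 31) (b := 1) rfl (s₁.setReg 30 0) Inv (by simp [Inv]) ?_
    rintro j hj s₂ hs₂ ⟨hlt, hbit⟩
    have hl₂ : Loaded I s₂ := (hl₁.setReg _ _ (by decide)).atHead hs₂ rfl
    have g7 : s₂.mem 7 = I.stepSetArray T := (hs₂.mem 7 rfl).trans e7
    have g8 : s₂.mem 8 = s₁.mem 8 := hs₂.mem 8 rfl
    simp only [RAMState.setReg_reg, Nat.reduceEqDiff, reduceIte, hl₁.reg_k] at hj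
    rw [exec_seq, exec_mul _ (by decide) (by decide) (by decide) (by decide), exec_seq, exec_seq]
    obtain ⟨s₃, hs₃⟩ : ∃ s₃, s₃ = (assign 34 (const 0)).exec
      ((s₂.setReg 32 (s₂.reg 31 * s₂.reg 8)).setReg 33 (s₂.reg 8)) := ⟨_, rfl⟩
    rw [← hs₃]
    have f8 : s₃.reg 8 = k + 1 := by simp [hs₃, hl₂.reg_k_succ]
    have f31 : s₃.reg 31 = j := by simp [hs₃, hs₂.counter]
    have f30 : s₃.reg 30 = s₂.reg 30 := by simp [hs₃]
    have f32 : s₃.reg 32 = j * (k + 1) := by simp [hs₃, hs₂.counter, hl₂.reg_k_succ]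
    have f34 : s₃.reg 34 = 0 := by simp [hs₃]
    have fm : s₃.mem = s₂.mem := by simp [hs₃]
    have hsum : (rowSum.exec s₃).reg 34 =
        ∑ x ∈ Finset.range (s₃.reg 8), I.stepSetArray T (j * (k + 1) + x) :=
      exec_loop_induct (i := 35) (b := 8)
      (p := assign 34 (add (reg 34) (load 7 (add (reg 32) (reg 35))))) rfl s₃
      (fun i s' => s'.reg 34 = ∑ x ∈ Finset.range i, I.stepSetArray T (j * (k + 1) + x))
      (by simp [f34]) (by
        intro i _ s₄ hs₄ h₄
        have a32 : s₄.reg 32 = j * (k + 1) := (hs₄.reg 32 rfl).trans f32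
        have a7 : s₄.mem 7 = I.stepSetArray T := by rw [hs₄.mem 7 rfl, fm, g7]
        simp [Finset.sum_range_succ, h₄, a32, a7, hs₄.counter])
    have b30 := exec_reg (p := rowSum)
      (s := s₃) 30 rfl
    have b31 := exec_reg (p := rowSum)
      (s := s₃) 31 rfl
    have b8 := exec_mem (p := rowSum)
      (s := s₃) 8 rfl
    generalize rowSum.exec s₃ = s₅
      at *
    rw [f8] at hsum
    rw [f30] at b30
    rw [f31] at b31
    rw [fm, g8] at b8
    have hiff : s₅.reg 34 = 0 ↔ ¬ ∃ t ∈ T, t.1.1 = j := by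
      rw [hsum, Finset.sum_eq_zero_iff]
      simp only [Finset.mem_range, I.stepSetArray_eq_zero_iff]
      constructor
      · rintro h ⟨t, ht, htj⟩
        have h1 := stepCode_div t.1
        have h2 := Nat.div_add_mod (stepCode t.1) (k + 1)
        refine h (stepCode t.1 % (k + 1)) (Nat.mod_lt _ k.succ_pos) t ht ?_
        rw [← htj, ← h1, mul_comm, h2]
      · intro h x hx t ht heq
        refine h ⟨t, ht, ?_⟩
        rw [← stepCode_div, heq, add_comm, Nat.add_mul_div_right _ _ k.succ_pos,
          Nat.div_eq_of_lt hx, zero_add]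
    simp only [exec_ite, exec_assign, exec_skip, eval, b30, b31, b8, e8 j hj]
    by_cases hc : s₅.reg 34 = 0
    · have hno := hiff.1 hc
      refine ⟨?_, fun r => ?_⟩
      · simp only [hc, reduceIte, RAMState.setReg_reg, Nat.reduceEqDiff, b30, pow_succ]
        omega
      · simp only [hc, reduceIte, RAMState.setReg_reg, Nat.reduceEqDiff, b30, hbit]
        rw [Nat.lt_succ_iff_lt_or_eq]
        constructor
        · exact fun h => ⟨Or.inl h.1, h.2⟩
        · rintro ⟨h | rfl, h'⟩
          · exact ⟨h, h'⟩
          · exact absurd h' hno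
    · have hyes := not_not.1 (mt hiff.2 hc)
      refine ⟨?_, fun r => ?_⟩
      · simp only [hc, reduceIte, RAMState.setReg_reg, Nat.reduceEqDiff, pow_succ]
        omega
      · simp only [hc, reduceIte, RAMState.setReg_reg, Nat.reduceEqDiff]
        rcases lt_trichotomy r j with h | rfl | h
        · rw [add_comm, Nat.testBit_two_pow_add_gt h, hbit]
          simp [h, h.trans j.lt_succ_self]
        · rw [add_comm, Nat.testBit_two_pow_add_eq, Nat.testBit_lt_two_pow hlt]
          simpa using hyes
        · rw [Nat.testBit_lt_two_pow]
          · simp only [Bool.false_eq_true, false_iff, not_and]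
            omega
          · have := Nat.pow_le_pow_right (show 0 < 2 by decide) h
            simp only [Nat.succ_eq_add_one, pow_succ] at this
            omega
  simp only [RAMState.setReg_reg, Nat.reduceEqDiff, reduceIte, hl₁.reg_k] at h
  simp only [exec_seq (assign 30 (const 0)), exec_assign 30, eval]
  rw [exec_seq]
  have b1 : Loaded I (stepResources.exec (s₁.setReg 30 0)) :=
    (hl₁.setReg _ _ (by decide)).exec _ rfl
  have b4 := exec_reg (p := stepResources) (s := s₁.setReg 30 0) 4 rfl
  have b38 := exec_reg (p := stepResources) (s := s₁.setReg 30 0) 38 rfl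
  generalize stepResources.exec (s₁.setReg 30 0) = s₆
    at *
  simp only [RAMState.setReg_reg, Nat.reduceEqDiff, reduceIte, e4, e38] at b4 b38
  rw [exec_seq, exec_mul _ (by decide) (by decide) (by decide) (by decide)]
  simp only [exec_assign, eval, RAMState.setReg_reg, RAMState.setReg_mem, Nat.reduceEqDiff,
    reduceIte, b4, b38, b1.mem 1 (by decide)]
  rw [mul_comm]
  change I.maskAuth u (s₆.reg 30) = I.auth.toFun u (I.resourcesOfSteps T)
  rw [I.maskAuth_eq u h.1]
  congr 1
  ext r
  simp only [maskSet, Finset.mem_filter_univ, h.2, BSInstance.resourcesOfSteps, Finset.mem_image,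
    Fin.is_lt, true_and, Fin.val_inj]

end LProg

theorem computeWSPAuth_isPolyTime : computeWSPAuth.IsPolyTime := by
  refine computeWSPAuth.isPolyTime_of_lprog (loadSizes ⨟ assign 38 (reg 0)) planAuth
    rfl rfl rfl (fun y => y.1.size_pos) (fun ⟨x, u, T⟩ => ?_) fun ⟨x, u, T⟩ => ?_
  · have hl := (loaded_loadSizes x.I u (x.I.stepSetArray T)).exec (assign 38 (reg 0)) rfl
    have h : ∀ b ∈ planAuth.bounds, b ∈ [1, 8, 38] := by decide
    intro b hb
    have hn := u.2
    have := h b hb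
    simp only [List.mem_cons, List.not_mem_nil, or_false] at this
    change ((assign 38 (reg 0)).exec (loadSizes.exec
      (x.I.inputState u (x.I.stepSetArray T)))).reg b ≤ 2 * (x.k + x.n + x.I.C.length)
    rcases this with rfl | rfl | rfl
    · exact hl.reg_k.trans_le (by omega)
    · exact hl.reg_k_succ.trans_le (by omega)
    · simp only [exec_assign, eval, RAMState.setReg_reg, reduceIte, reg_loadSizes]; omega
  · have hl := (loaded_loadSizes x.I u (x.I.stepSetArray T)).exec (assign 38 (reg 0)) rfl
    change (planAuth.exec ((assign 38 (reg 0)).exec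
        (loadSizes.exec (x.I.inputState u (x.I.stepSetArray T))))).reg 0 =
      x.I.toWSP.auth.toFun u T
    exact exec_planAuth hl T ((exec_mem 7 rfl).trans (mem_seven_loadSizes _ _ _)) u
      (by simp [reg_loadSizes])

theorem Nat.mul_add_div_of_lt {m a b : ℕ} (hb : b < m) : (a * m + b) / m = a := by
  rw [add_comm, Nat.add_mul_div_right _ _ (by omega), Nat.div_eq_of_lt hb, zero_add]

theorem Nat.mul_add_mod_of_lt' {m a b : ℕ} (hb : b < m) : (a * m + b) % m = b := by
  rw [add_comm, Nat.add_mul_mod_self_right, Nat.mod_eq_of_lt hb]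

namespace LProg

open RAMExpr

/-! ## The codes of all sets of resources -/

/-- Bank 13 := the place values of the pairs of resources in the base in register 5; register 6 :=
the next place value. -/
def places : LProg :=
  assign 6 (const 1) ⨟
  loop 10 1 (
    mul 11 10 1 12 ⨟
    loop 13 1 (
      ite (sub (add (reg 13) (const 1)) (reg 10))
        (store 13 (add (reg 11) (reg 13)) (reg 6) ⨟ mul 14 6 5 15 ⨟ assign 6 (reg 14))
        skip))

/-- The invariant also keeps all later cells at zero: pairs out of order are skipped, and their
place value 0 is the initial content of the cell. -/
theorem exec_places {k B : ℕ} {s : RAMState} (hk : s.reg 1 = k) (hB : s.reg 5 = B)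
    (h13 : s.mem 13 = fun _ => 0) :
    (places.exec s).reg 6 = B ^ PairCode.index k (k * k) ∧
      ∀ q < k * k, (places.exec s).mem 13 q = PairCode.place k B q := by
  let Inv : ℕ → RAMState → Prop := fun L s' => s'.reg 6 = B ^ PairCode.index k L ∧
    (∀ q < L, s'.mem 13 q = PairCode.place k B q) ∧ ∀ q, L ≤ q → s'.mem 13 q = 0
  suffices h : Inv ((s.setReg 6 1).reg 1 * k) (places.exec s) by
    simp only [RAMState.setReg_reg, Nat.reduceEqDiff, reduceIte, hk] at h
    exact ⟨h.1, h.2.1⟩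
  refine exec_loop_induct (i := 10) (b := 1) rfl (s.setReg 6 1) (fun j s' => Inv (j * k) s')
    ⟨by simp [PairCode.index], by simp, by simp [h13]⟩ ?_
  intro j hj s₁ hs₁ h₁
  simp only [RAMState.setReg_reg, Nat.reduceEqDiff, reduceIte, hk] at hj
  have g1 : s₁.reg 1 = k := (hs₁.reg 1 rfl).trans (by simp [hk])
  have g5 : s₁.reg 5 = B := (hs₁.reg 5 rfl).trans (by simp [hB])
  rw [exec_seq, exec_mul _ (by decide) (by decide) (by decide) (by decide), hs₁.counter, g1]
  obtain ⟨s₂, hs₂⟩ : ∃ s₂, s₂ = (s₁.setReg 11 (j * k)).setReg 12 k := ⟨_, rfl⟩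
  rw [← hs₂]
  have e1 : s₂.reg 1 = k := by simp [hs₂, g1]
  have e5 : s₂.reg 5 = B := by simp [hs₂, g5]
  have e6 : s₂.reg 6 = s₁.reg 6 := by simp [hs₂]
  have e10 : s₂.reg 10 = j := by simp [hs₂, hs₁.counter]
  have e11 : s₂.reg 11 = j * k := by simp [hs₂]
  have em : s₂.mem = s₁.mem := by simp [hs₂]
  suffices h : Inv (j * k + s₂.reg 1) ((loop 13 1 (
      ite (sub (add (reg 13) (const 1)) (reg 10))
        (store 13 (add (reg 11) (reg 13)) (reg 6) ⨟ mul 14 6 5 15 ⨟ assign 6 (reg 14))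
        skip)).exec s₂) by
    rw [e1, show j * k + k = (j + 1) * k by ring] at h
    exact h
  refine exec_loop_induct (i := 13) (b := 1) rfl s₂ (fun i s' => Inv (j * k + i) s')
    (by simpa [Inv, em, e6] using h₁) ?_
  rintro i hi s₃ hs₃ ⟨h6, hlt, hge⟩
  rw [e1] at hi
  have f5 : s₃.reg 5 = B := (hs₃.reg 5 rfl).trans e5
  have f10 : s₃.reg 10 = j := (hs₃.reg 10 rfl).trans e10
  have f11 : s₃.reg 11 = j * k := (hs₃.reg 11 rfl).trans e11
  have hord : PairCode.ordered k (j * k + i) = decide (j ≤ i) := by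
    rw [PairCode.ordered, Nat.mul_add_div_of_lt hi, Nat.mul_add_mod_of_lt' hi]
  have hplace : PairCode.place k B (j * k + i) = if j ≤ i then s₃.reg 6 else 0 := by
    rw [PairCode.place, hord, h6]; simp
  simp only [Inv, ← add_assoc, PairCode.index_succ, hord, exec_ite, exec_skip, eval, hs₃.counter,
    f10]
  by_cases hji : j ≤ i
  · have hc : i + 1 - j ≠ 0 := by omega
    simp only [hc, reduceIte, exec_seq, exec_store, exec_assign, eval, hji, decide_true,
      exec_mul _ (show 6 ≠ 14 by decide) (show 5 ≠ 14 by decide) (show 15 ≠ 14 by decide)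
        (show 6 ≠ 15 by decide), RAMState.setReg_reg, RAMState.setReg_mem, RAMState.setMem_reg,
      Nat.reduceEqDiff, RAMState.setMem_mem_same, f5, f11, hs₃.counter]
    rw [if_pos hji] at hplace
    refine ⟨by rw [h6, pow_succ], fun q hq => ?_, fun q hq => ?_⟩
    · split_ifs with h
      · rw [h, hplace]
      · exact hlt q (by omega)
    · rw [if_neg (by omega)]
      exact hge q (by omega)
  · have hc : i + 1 - j = 0 := by omega
    simp only [hc, reduceIte, hji, decide_false, RAMState.setReg_reg, RAMState.setReg_mem,
      Nat.reduceEqDiff, Bool.false_eq_true, add_zero]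
    rw [if_neg hji] at hplace
    refine ⟨h6, fun q hq => ?_, fun q hq => hge q (by omega)⟩
    rcases Nat.lt_succ_iff_lt_or_eq.1 hq with h | rfl
    · exact hlt q h
    · rw [hplace]
      exact hge _ le_rfl

/-- Add to register 24 the place values of the pairs in the set whose digits are in bank 9. -/
def pairSum : LProg :=
  loop 25 1 (
    mul 26 25 1 27 ⨟
    loop 28 1 (
      ite (load 9 (reg 25))
        (ite (load 9 (reg 28)) (assign 24 (add (reg 24) (load 13 (add (reg 26) (reg 28))))) skip)
        skip))

theorem exec_pairSum {k B x : ℕ} {s : RAMState} (hk : s.reg 1 = k) (h24 : s.reg 24 = 0)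
    (h9 : ∀ r < k, s.mem 9 r = (x.testBit r).toNat)
    (h13 : ∀ q < k * k, s.mem 13 q = PairCode.place k B q) :
    (pairSum.exec s).reg 24 = ∑ q ∈ Finset.range (k * k),
      if x.testBit (q / k) = true ∧ x.testBit (q % k) = true then PairCode.place k B q else 0 := by
  let Inv : ℕ → RAMState → Prop := fun L s' => s'.reg 24 = ∑ q ∈ Finset.range L,
    if x.testBit (q / k) = true ∧ x.testBit (q % k) = true then PairCode.place k B q else 0
  suffices h : Inv (s.reg 1 * k) (pairSum.exec s) by rwa [hk] at h
  refine exec_loop_induct (i := 25) (b := 1) rfl s (fun j s' => Inv (j * k) s')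
    (by simp [Inv, h24]) ?_
  intro j hj s₁ hs₁ h₁
  rw [hk] at hj
  have g1 : s₁.reg 1 = k := (hs₁.reg 1 rfl).trans hk
  rw [exec_seq, exec_mul _ (by decide) (by decide) (by decide) (by decide), hs₁.counter, g1]
  obtain ⟨s₂, hs₂⟩ : ∃ s₂, s₂ = (s₁.setReg 26 (j * k)).setReg 27 k := ⟨_, rfl⟩
  rw [← hs₂]
  have e1 : s₂.reg 1 = k := by simp [hs₂, g1]
  have e24 : s₂.reg 24 = s₁.reg 24 := by simp [hs₂]
  have e25 : s₂.reg 25 = j := by simp [hs₂, hs₁.counter]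
  have e26 : s₂.reg 26 = j * k := by simp [hs₂]
  have em : s₂.mem = s₁.mem := by simp [hs₂]
  suffices h : Inv (j * k + s₂.reg 1) ((loop 28 1 (
      ite (load 9 (reg 25))
        (ite (load 9 (reg 28)) (assign 24 (add (reg 24) (load 13 (add (reg 26) (reg 28))))) skip)
        skip)).exec s₂) by
    rw [e1, show j * k + k = (j + 1) * k by ring] at h
    exact h
  refine exec_loop_induct (i := 28) (b := 1) rfl s₂ (fun i s' => Inv (j * k + i) s')
    (by simpa [Inv, e24] using h₁) ?_
  rintro i hi s₃ hs₃ h₃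
  rw [e1] at hi
  have f25 : s₃.reg 25 = j := (hs₃.reg 25 rfl).trans e25
  have f26 : s₃.reg 26 = j * k := (hs₃.reg 26 rfl).trans e26
  have f9 : s₃.mem 9 = s.mem 9 := by rw [hs₃.mem 9 rfl, em, hs₁.mem 9 rfl]
  have f13 : s₃.mem 13 = s.mem 13 := by rw [hs₃.mem 13 rfl, em, hs₁.mem 13 rfl]
  have hq : j * k + i < k * k := by
    have := Nat.mul_le_mul_right k (Nat.succ_le_of_lt hj)
    rw [Nat.succ_mul] at this
    omega
  simp only [Inv] at h₃ ⊢
  rw [← add_assoc, Finset.sum_range_succ, ← h₃, Nat.mul_add_div_of_lt hi,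
    Nat.mul_add_mod_of_lt' hi]
  simp only [exec_ite, exec_skip, exec_assign, eval, hs₃.counter, f25, f26, f9, f13, h9 j hj,
    h9 i hi, h13 _ hq]
  cases x.testBit j <;> cases x.testBit i <;> simp

/-- Bank 14 := the codes of all sets of resources. -/
def codes : LProg :=
  loop 23 4 (
    assign 20 (reg 23) ⨟
    bits ⨟
    assign 24 (const 0) ⨟
    pairSum ⨟
    ite (reg 23) (assign 24 (add (reg 24) (reg 6))) skip ⨟
    store 14 (reg 23) (reg 24))

theorem exec_codes {k B : ℕ} {s : RAMState} (hk : s.reg 1 = k) (h4 : s.reg 4 = 2 ^ k)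
    (h6 : s.reg 6 = B ^ PairCode.index k (k * k)) (h8 : ∀ r < k, s.mem 8 r = 2 ^ r)
    (h13 : ∀ q < k * k, s.mem 13 q = PairCode.place k B q) :
    ∀ T < 2 ^ k, (codes.exec s).mem 14 T = PairCode.code k B T := by
  rw [← h4]
  refine exec_loop_induct (i := 23) (b := 4) rfl s
    (fun j s' => ∀ T < j, s'.mem 14 T = PairCode.code k B T) (by simp) ?_
  intro j hj s₁ hs₁ h₁
  rw [h4] at hj
  have g1 : s₁.reg 1 = k := (hs₁.reg 1 rfl).trans hk
  have g6 : s₁.reg 6 = s.reg 6 := hs₁.reg 6 rfl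
  have g8 : s₁.mem 8 = s.mem 8 := hs₁.mem 8 rfl
  have g13 : s₁.mem 13 = s.mem 13 := hs₁.mem 13 rfl
  rw [exec_seq, exec_seq, exec_assign, eval, hs₁.counter]
  have hb := exec_bits (s₁.setReg 20 j) (by simpa [g1] using hj) (by simpa [g1, g8] using h8)
  have e1 : (bits.exec (s₁.setReg 20 j)).reg 1 = k := (exec_reg 1 rfl).trans (by simp [g1])
  have e6 : (bits.exec (s₁.setReg 20 j)).reg 6 = s.reg 6 := (exec_reg 6 rfl).trans (by simp [g6])
  have e23 : (bits.exec (s₁.setReg 20 j)).reg 23 = j :=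
    (exec_reg 23 rfl).trans (by simp [hs₁.counter])
  have e13 : (bits.exec (s₁.setReg 20 j)).mem 13 = s.mem 13 := (exec_mem 13 rfl).trans g13
  have e14 : (bits.exec (s₁.setReg 20 j)).mem 14 = s₁.mem 14 := exec_mem 14 rfl
  simp only [RAMState.setReg_reg, Nat.reduceEqDiff, reduceIte, g1] at hb
  generalize bits.exec (s₁.setReg 20 j) = s₂ at *
  rw [exec_seq, exec_seq, exec_assign, eval]
  have hp := exec_pairSum (k := k) (B := B) (x := j) (s := s₂.setReg 24 0) (by simp [e1]) (by simp)
    (by simpa using hb) (by simpa [e13] using h13)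
  have f6 : (pairSum.exec (s₂.setReg 24 0)).reg 6 = s.reg 6 := (exec_reg 6 rfl).trans (by simp [e6])
  have f23 : (pairSum.exec (s₂.setReg 24 0)).reg 23 = j := (exec_reg 23 rfl).trans (by simp [e23])
  have f14 : (pairSum.exec (s₂.setReg 24 0)).mem 14 = s₁.mem 14 := (exec_mem 14 rfl).trans e14
  generalize pairSum.exec (s₂.setReg 24 0) = s₃ at *
  intro T hT
  have hcode : PairCode.code k B j = s₃.reg 24 + if j = 0 then 0 else s₃.reg 6 := by
    rw [PairCode.code, hp, f6, h6]
  by_cases hj0 : j = 0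
  · simp only [exec_seq, exec_ite, exec_skip, exec_assign, exec_store, eval, f23, hj0, reduceIte,
      RAMState.setReg_mem, RAMState.setMem_mem_same]
    rw [if_pos (by omega), show T = j by omega, hcode, hj0]
    simp
  · simp only [exec_seq, exec_ite, exec_skip, exec_assign, exec_store, eval, f23, hj0, reduceIte,
      RAMState.setReg_mem, RAMState.setMem_mem_same, RAMState.setReg_reg, Nat.reduceEqDiff, f14]
    rw [if_neg hj0] at hcode
    split_ifs with h
    · rw [h, hcode]
    · exact h₁ T (by omega)

/-! ## The knapsack problem -/

/-- Registers 34 and 35 := the optimal value and the pick for the size in register 33 and the user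
whose authorization weights start at the address in register 31, where the optimal values for the
users before start at the address in register 30. -/
def knapsackCell : LProg :=
  loop 36 4 (
    assign 37 (const 0) ⨟
    ite (sub (add (reg 33) (const 1)) (load 14 (reg 36)))
      (ite (load 15 (add (reg 30) (sub (reg 33) (load 14 (reg 36)))))
        (assign 37 (add (load 15 (add (reg 30) (sub (reg 33) (load 14 (reg 36)))))
          (load 1 (add (reg 31) (reg 36)))))
        skip)
      skip ⨟
    minStep 34 35 37 36)

theorem exec_knapsackCell {size opt : ℕ → ℕ} {cost : ℕ → ℕ → ℕ} {u c : ℕ} {s : RAMState}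
    (h34 : s.reg 34 = 0) (h35 : s.reg 35 = 0) (h33 : s.reg 33 = c)
    (h14 : ∀ T < s.reg 4, s.mem 14 T = size T)
    (h15 : ∀ c' ≤ c, s.mem 15 (s.reg 30 + c') = opt c')
    (h1 : ∀ T < s.reg 4, s.mem 1 (s.reg 31 + T) = cost u T) :
    (knapsackCell.exec s).reg 34 =
        (minUpTo (Knapsack.candidate size cost opt u c) (s.reg 4)).1 ∧
      (knapsackCell.exec s).reg 35 =
        (minUpTo (Knapsack.candidate size cost opt u c) (s.reg 4)).2 := by
  refine exec_loop_induct (i := 36) (b := 4) rfl s (fun j s' =>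
    s'.reg 34 = (minUpTo (Knapsack.candidate size cost opt u c) j).1 ∧
      s'.reg 35 = (minUpTo (Knapsack.candidate size cost opt u c) j).2)
    (by simp [minUpTo, h34, h35]) ?_
  rintro j hj s₁ hs₁ ⟨h₁, h₂⟩
  have g30 : s₁.reg 30 = s.reg 30 := hs₁.reg 30 rfl
  have g31 : s₁.reg 31 = s.reg 31 := hs₁.reg 31 rfl
  have g33 : s₁.reg 33 = c := (hs₁.reg 33 rfl).trans h33
  have g14 : s₁.mem 14 j = size j := by rw [hs₁.mem 14 rfl, h14 j hj]
  have g1 : s₁.mem 1 (s.reg 31 + j) = cost u j := by rw [hs₁.mem 1 rfl, h1 j hj]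
  have g15 : s₁.mem 15 (s.reg 30 + (c - size j)) = opt (c - size j) := by
    rw [hs₁.mem 15 rfl, h15 _ (Nat.sub_le _ _)]
  rw [exec_seq, exec_seq, exec_assign, eval]
  obtain ⟨s₂, hs₂⟩ : ∃ s₂, s₂ = (ite (sub (add (reg 33) (const 1)) (load 14 (reg 36)))
      (ite (load 15 (add (reg 30) (sub (reg 33) (load 14 (reg 36)))))
        (assign 37 (add (load 15 (add (reg 30) (sub (reg 33) (load 14 (reg 36)))))
          (load 1 (add (reg 31) (reg 36)))))
        skip)
      skip).exec (s₁.setReg 37 0) := ⟨_, rfl⟩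
  rw [← hs₂]
  have e37 : s₂.reg 37 = Knapsack.candidate size cost opt u c j := by
    simp only [hs₂, exec_ite, exec_assign, exec_skip, eval, RAMState.setReg_reg,
      RAMState.setReg_mem, Nat.reduceEqDiff, reduceIte, hs₁.counter, g33, g14, g30, g31, g15, g1,
      Knapsack.candidate]
    by_cases c1 : size j ≤ c
    · have c2 : c + 1 - size j ≠ 0 := by omega
      by_cases c3 : opt (c - size j) = 0 <;> simp [c1, c2, c3]
    · have c2 : c + 1 - size j = 0 := by omega
      simp [c1, c2]
  have e34 : s₂.reg 34 = s₁.reg 34 := by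
    rw [hs₂, exec_reg 34 rfl]; simp
  have e35 : s₂.reg 35 = s₁.reg 35 := by
    rw [hs₂, exec_reg 35 rfl]; simp
  have e36 : s₂.reg 36 = j := by
    rw [hs₂, exec_reg 36 rfl]; simp [hs₁.counter]
  have := exec_minStep s₂ _ j (e34.trans h₁) (e35.trans h₂) e37 e36
  simpa using this

end LProg

theorem Knapsack.pick_lt (size : ℕ → ℕ) (cost : ℕ → ℕ → ℕ) {Q : ℕ} (hQ : 0 < Q) (u c : ℕ) :
    Knapsack.pick size cost Q u c < Q :=
  minUpTo_arg_lt _ hQ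

namespace LProg

open RAMExpr

/-- For all sizes below register 7, solve the knapsack problem for one more user. -/
def knapsackRow : LProg :=
  loop 33 7 (
    assign 34 (const 0) ⨟
    assign 35 (const 0) ⨟
    knapsackCell ⨟
    store 15 (add (add (reg 30) (reg 7)) (reg 33)) (reg 34) ⨟
    store 16 (add (reg 30) (reg 33)) (reg 35))

/-- Bank 15 := the optimal values of the knapsack problem for all initial segments of the users;
bank 16 := the picks. -/
def knapsack : LProg :=
  -- Without users only size 0 is possible, at cost 0, recorded as 1; the other cells of row 0 are
  -- zero from the start.
  store 15 (const 0) (const 1) ⨟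
  assign 30 (const 0) ⨟
  assign 31 (const 0) ⨟
  loop 32 2 (knapsackRow ⨟ assign 30 (add (reg 30) (reg 7)) ⨟ assign 31 (add (reg 31) (reg 4)))

/-- The tables of values and picks are correct up to the row of user `u` and size `c`. -/
def TableAt (size : ℕ → ℕ) (cost : ℕ → ℕ → ℕ) (Q M u c : ℕ) (s : RAMState) : Prop :=
  -- Bank 15 is one row ahead: its row 0 belongs to no users, while row u of bank 16 holds the picks
  -- of user u.
  (∀ a < (u + 1) * M + c, s.mem 15 a = Knapsack.value size cost Q (a / M) (a % M)) ∧
    ∀ a < u * M + c, s.mem 16 a = Knapsack.pick size cost Q (a / M) (a % M)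

theorem exec_knapsackRow {size : ℕ → ℕ} {cost : ℕ → ℕ → ℕ} {M u : ℕ} {s : RAMState}
    (h7 : s.reg 7 = M) (h30 : s.reg 30 = u * M)
    (h14 : ∀ T < s.reg 4, s.mem 14 T = size T)
    (h1 : ∀ T < s.reg 4, s.mem 1 (s.reg 31 + T) = cost u T)
    (h : TableAt size cost (s.reg 4) M u 0 s) :
    TableAt size cost (s.reg 4) M (u + 1) 0 (knapsackRow.exec s) := by
  -- M finished columns of one row are the same as zero finished columns of the next.
  suffices hrow : TableAt size cost (s.reg 4) M u (s.reg 7) (knapsackRow.exec s) by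
    rw [h7] at hrow
    refine ⟨fun a ha => hrow.1 a ?_, fun a ha => hrow.2 a ?_⟩
    · rwa [add_zero, Nat.succ_mul] at ha
    · rwa [add_zero, Nat.succ_mul] at ha
  refine exec_loop_induct (i := 33) (b := 7) rfl s
    (fun c s' => TableAt size cost (s.reg 4) M u c s') h ?_
  rintro c hc s₁ hs₁ ⟨hv, hp⟩
  rw [h7] at hc
  have g4 : s₁.reg 4 = s.reg 4 := hs₁.reg 4 rfl
  have g7 : s₁.reg 7 = M := (hs₁.reg 7 rfl).trans h7
  have g30 : s₁.reg 30 = u * M := (hs₁.reg 30 rfl).trans h30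
  have g31 : s₁.reg 31 = s.reg 31 := hs₁.reg 31 rfl
  have g14 : s₁.mem 14 = s.mem 14 := hs₁.mem 14 rfl
  have g1 : s₁.mem 1 = s.mem 1 := hs₁.mem 1 rfl
  rw [exec_seq, exec_seq, exec_seq, exec_assign, exec_assign, eval, eval]
  have hcell := exec_knapsackCell (size := size) (opt := Knapsack.value size cost (s.reg 4) u)
    (cost := cost) (u := u) (c := c) (s := (s₁.setReg 34 0).setReg 35 0) (by simp) (by simp)
    (by simp [hs₁.counter]) (by simpa [g4, g14] using h14)
    (by
      intro c' hc'
      have : c' < M := by omega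
      simp only [RAMState.setReg_mem, RAMState.setReg_reg, Nat.reduceEqDiff, reduceIte, g30]
      rw [hv _ (by rw [Nat.succ_mul]; omega), Nat.mul_add_div_of_lt this,
        Nat.mul_add_mod_of_lt' this])
    (by simpa [g4, g1, g31] using h1)
  have e15 : (knapsackCell.exec ((s₁.setReg 34 0).setReg 35 0)).mem 15 = s₁.mem 15 :=
    exec_mem 15 rfl
  have e16 : (knapsackCell.exec ((s₁.setReg 34 0).setReg 35 0)).mem 16 = s₁.mem 16 :=
    exec_mem 16 rfl
  have e7 : (knapsackCell.exec ((s₁.setReg 34 0).setReg 35 0)).reg 7 = M :=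
    (exec_reg 7 rfl).trans (by simp [g7])
  have e30 : (knapsackCell.exec ((s₁.setReg 34 0).setReg 35 0)).reg 30 = u * M :=
    (exec_reg 30 rfl).trans (by simp [g30])
  have e33 : (knapsackCell.exec ((s₁.setReg 34 0).setReg 35 0)).reg 33 = c :=
    (exec_reg 33 rfl).trans (by simp [hs₁.counter])
  simp only [RAMState.setReg_reg, Nat.reduceEqDiff, reduceIte, g4] at hcell
  generalize knapsackCell.exec ((s₁.setReg 34 0).setReg 35 0) = s₂ at *
  rw [exec_seq, exec_store, exec_store]
  simp only [eval, RAMState.setMem_reg, e7, e30, e33, hcell.1, hcell.2]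
  constructor
  · intro a ha
    rw [RAMState.setReg_mem, RAMState.setMem_mem_of_ne _ _ _ (show 15 ≠ 16 by decide),
      RAMState.setMem_mem_same, e15, ← Nat.succ_mul]
    split_ifs with h
    · rw [h, Nat.mul_add_div_of_lt hc, Nat.mul_add_mod_of_lt' hc]
      rfl
    · exact hv a (by simp only [Nat.succ_eq_add_one] at h; omega)
  · intro a ha
    rw [RAMState.setReg_mem, RAMState.setMem_mem_same,
      RAMState.setMem_mem_of_ne _ _ _ (show 16 ≠ 15 by decide), e16]
    split_ifs with h
    · rw [h, Nat.mul_add_div_of_lt hc, Nat.mul_add_mod_of_lt' hc]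
      rfl
    · exact hp a (by omega)

theorem exec_knapsack {size : ℕ → ℕ} {cost : ℕ → ℕ → ℕ} {M n Q : ℕ} {s : RAMState}
    (h2 : s.reg 2 = n) (h7 : s.reg 7 = M) (h4 : s.reg 4 = Q)
    (h14 : ∀ T < Q, s.mem 14 T = size T)
    (h1 : ∀ u < n, ∀ T < Q, s.mem 1 (u * Q + T) = cost u T) (h15 : s.mem 15 = fun _ => 0) :
    (knapsack.exec s).reg 30 = n * M ∧ TableAt size cost Q M n 0 (knapsack.exec s) := by
  subst h2 h4
  let Inv : ℕ → RAMState → Prop := fun j s' => s'.reg 30 = j * M ∧ s'.reg 31 = j * s.reg 4 ∧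
    TableAt size cost (s.reg 4) M j 0 s'
  suffices h : Inv (s.reg 2) (knapsack.exec s) from ⟨h.1, h.2.2⟩
  refine exec_loop_induct (i := 32) (b := 2) rfl (((s.setMem 15 0 1).setReg 30 0).setReg 31 0)
    Inv ?_ ?_
  · refine ⟨by simp, by simp, fun a ha => ?_, fun a ha => by simp at ha⟩
    simp only [zero_add, one_mul, add_zero] at ha
    simp [h15, Nat.div_eq_of_lt ha, Nat.mod_eq_of_lt ha, Knapsack.value]
  · rintro j hj s₁ hs₁ ⟨h30, h31, htab⟩
    simp only [RAMState.setReg_reg, RAMState.setMem_reg, Nat.reduceEqDiff, reduceIte] at hj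
    have g4 : s₁.reg 4 = s.reg 4 := (hs₁.reg 4 rfl).trans (by simp)
    have g7 : s₁.reg 7 = M := (hs₁.reg 7 rfl).trans (by simp [h7])
    have g14 : s₁.mem 14 = s.mem 14 :=
      (hs₁.mem 14 rfl).trans (RAMState.setMem_mem_of_ne s 0 1 (show 14 ≠ 15 by decide))
    have g1 : s₁.mem 1 = s.mem 1 :=
      (hs₁.mem 1 rfl).trans (RAMState.setMem_mem_of_ne s 0 1 (show 1 ≠ 15 by decide))
    have hrow := exec_knapsackRow (size := size) (cost := cost) g7 h30
      (by rw [g4, g14]; exact h14) (by rw [g4, g1, h31]; exact h1 j hj) (by rw [g4]; exact htab)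
    have e30 : (knapsackRow.exec s₁).reg 30 = j * M := (exec_reg 30 rfl).trans h30
    have e31 : (knapsackRow.exec s₁).reg 31 = j * s.reg 4 := (exec_reg 31 rfl).trans h31
    have e4 : (knapsackRow.exec s₁).reg 4 = s.reg 4 := (exec_reg 4 rfl).trans g4
    have e7 : (knapsackRow.exec s₁).reg 7 = M := (exec_reg 7 rfl).trans g7
    rw [g4] at hrow
    rw [exec_seq]
    generalize knapsackRow.exec s₁ = s₂ at *
    refine ⟨?_, ?_, hrow⟩
    · simp [e30, e7, Nat.succ_mul]
    · simp [e31, e4, Nat.succ_mul]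

/-! ## Reading off and evaluating the relations -/

/-- Write the relation for the code in register 44 to bank 6. Register 30 holds the address of the
last row of bank 15. -/
def writeRel : LProg :=
  assign 47 (reg 30) ⨟
  loop 48 2 (
    assign 47 (sub (reg 47) (reg 7)) ⨟
    assign 20 (load 16 (add (reg 47) (reg 44))) ⨟
    assign 44 (sub (reg 44) (load 14 (reg 20))) ⨟
    assign 49 (sub (sub (reg 2) (reg 48)) (const 1)) ⨟
    mul 56 49 1 57 ⨟
    bits ⨟
    loop 58 1 (store 6 (add (reg 56) (reg 58)) (load 9 (reg 58))))

/-- Bank 6 holds the relation given by the digits of the numbers `T u`. -/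
def HoldsRel (n k : ℕ) (T : ℕ → ℕ) (s : RAMState) : Prop :=
  ∀ u < n, ∀ r < k, s.mem 6 (u * k + r) = ((T u).testBit r).toNat

theorem exec_copyRow {k a : ℕ} {s : RAMState} (h1 : s.reg 1 = k) (h56 : s.reg 56 = a) (x : ℕ) :
    ((loop 58 1 (store 6 (add (reg 56) (reg 58)) (load 9 (reg 58)))).exec s).mem 6 x =
      if a ≤ x ∧ x < a + k then s.mem 9 (x - a) else s.mem 6 x := by
  rw [← h1]
  refine exec_loop_induct (i := 58) (b := 1) rfl s
    (fun j s' => s'.mem 6 x = if a ≤ x ∧ x < a + j then s.mem 9 (x - a) else s.mem 6 x) ?_ ?_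
  · rw [if_neg (by omega)]; rfl
  · intro j _ s₁ hs₁ h
    have g56 : s₁.reg 56 = a := (hs₁.reg 56 rfl).trans h56
    have g9 : s₁.mem 9 = s.mem 9 := hs₁.mem 9 rfl
    simp only [exec_store, eval, RAMState.setReg_mem, RAMState.setMem_mem_same, h, hs₁.counter,
      g56, g9]
    by_cases c : x = a + j
    · rw [if_pos c, if_pos (by omega), c]
      congr 1
      omega
    · rw [if_neg c]
      exact if_congr (by omega) rfl rfl

/-- Backtracking through the picks from the last user down, with the remaining size in register 44.
Feasibility of c plays no role, since the remaining size never grows and so stays below M. Zeros are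
written as well as ones, so earlier contents of bank 6 do not matter. -/
theorem exec_writeRel {size : ℕ → ℕ} {cost : ℕ → ℕ → ℕ} {M n k c : ℕ} {s : RAMState}
    (h1 : s.reg 1 = k) (h2 : s.reg 2 = n) (h7 : s.reg 7 = M) (h30 : s.reg 30 = n * M)
    (h44 : s.reg 44 = c) (hc : c < M) (h8 : ∀ r < k, s.mem 8 r = 2 ^ r)
    (h14 : ∀ T < 2 ^ k, s.mem 14 T = size T)
    (h16 : ∀ a < n * M, s.mem 16 a = Knapsack.pick size cost (2 ^ k) (a / M) (a % M)) :
    HoldsRel n k (Knapsack.choice size cost (2 ^ k) n c) (writeRel.exec s) := by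
  let Inv : ℕ → RAMState → Prop := fun j s' => s'.reg 47 = (n - j) * M ∧ s'.reg 44 < M ∧
    (∀ v < n - j, Knapsack.choice size cost (2 ^ k) n c v =
      Knapsack.choice size cost (2 ^ k) (n - j) (s'.reg 44) v) ∧
    ∀ v, n - j ≤ v → v < n → ∀ r < k, s'.mem 6 (v * k + r) =
      ((Knapsack.choice size cost (2 ^ k) n c v).testBit r).toNat
  suffices h : Inv ((s.setReg 47 (s.reg 30)).reg 2) (writeRel.exec s) by
    simp only [RAMState.setReg_reg, Nat.reduceEqDiff, reduceIte, h2] at h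
    exact fun u hu => h.2.2.2 u (by omega) hu
  refine exec_loop_induct (i := 48) (b := 2) rfl (s.setReg 47 (s.reg 30)) Inv ?_ ?_
  · refine ⟨by simp [h30], by simpa [h44] using hc, by simp [h44], fun v h h' => by omega⟩
  · rintro j hj s₁ hs₁ ⟨h47, hlt, hchoice, hrel⟩
    simp only [RAMState.setReg_reg, Nat.reduceEqDiff, reduceIte, h2] at hj
    obtain ⟨d, hd⟩ : ∃ d, n = j + d + 1 := ⟨n - j - 1, by omega⟩
    have d1 : n - j = d + 1 := by omega
    have d2 : n - (j + 1) = d := by omega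
    rw [d1] at h47 hchoice hrel
    have g1 : s₁.reg 1 = k := (hs₁.reg 1 rfl).trans (by simp [h1])
    have g2 : s₁.reg 2 = n := (hs₁.reg 2 rfl).trans (by simp [h2])
    have g7 : s₁.reg 7 = M := (hs₁.reg 7 rfl).trans (by simp [h7])
    have g8 : s₁.mem 8 = s.mem 8 := hs₁.mem 8 rfl
    have g14 : s₁.mem 14 = s.mem 14 := hs₁.mem 14 rfl
    have g16 : s₁.mem 16 = s.mem 16 := hs₁.mem 16 rfl
    set p := Knapsack.pick size cost (2 ^ k) d (s₁.reg 44) with hp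
    have hplt : p < 2 ^ k := Knapsack.pick_lt _ _ (by positivity) _ _
    have hread : s.mem 16 (d * M + s₁.reg 44) = p := by
      rw [h16, Nat.mul_add_div_of_lt hlt, Nat.mul_add_mod_of_lt' hlt]
      calc d * M + s₁.reg 44 < d * M + M := by omega
        _ = (d + 1) * M := by ring
        _ ≤ n * M := Nat.mul_le_mul_right _ (by omega)
    have hsub : (d + 1) * M - M = d * M := by rw [Nat.succ_mul, Nat.add_sub_cancel]
    simp only [exec_seq, exec_assign, eval, RAMState.setReg_reg, RAMState.setReg_mem,
      Nat.reduceEqDiff, reduceIte,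
      exec_mul _ (show 49 ≠ 56 by decide) (show 1 ≠ 56 by decide) (show 57 ≠ 56 by decide)
        (show 49 ≠ 57 by decide), h47, g7, hsub, g16, hread, g14, h14 p hplt, g2, hs₁.counter, d1,
      Nat.add_sub_cancel, g1]
    obtain ⟨s₂, hs₂⟩ : ∃ s₂, s₂ = (((((s₁.setReg 47 (d * M)).setReg 20 p).setReg 44
      (s₁.reg 44 - size p)).setReg 49 d).setReg 56 (d * k)).setReg 57 k := ⟨_, rfl⟩
    rw [← hs₂]
    have hb := exec_bits s₂ (by simpa [hs₂, g1] using hplt) (by simpa [hs₂, g1, g8] using h8)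
    have e1 : (bits.exec s₂).reg 1 = k := (exec_reg 1 rfl).trans (by simp [hs₂, g1])
    have e44 : (bits.exec s₂).reg 44 = s₁.reg 44 - size p :=
      (exec_reg 44 rfl).trans (by simp [hs₂])
    have e47 : (bits.exec s₂).reg 47 = d * M := (exec_reg 47 rfl).trans (by simp [hs₂])
    have e56 : (bits.exec s₂).reg 56 = d * k := (exec_reg 56 rfl).trans (by simp [hs₂])
    have e6 : (bits.exec s₂).mem 6 = s₁.mem 6 := (exec_mem 6 rfl).trans (by simp [hs₂])
    have hb' : ∀ r < k, (bits.exec s₂).mem 9 r = (p.testBit r).toNat := by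
      simpa [hs₂, g1] using hb
    generalize bits.exec s₂ = s₃ at *
    have hcopy := exec_copyRow e1 e56
    have f44 : ((loop 58 1 (store 6 (add (reg 56) (reg 58)) (load 9 (reg 58)))).exec s₃).reg 44 =
      s₁.reg 44 - size p := (exec_reg 44 rfl).trans e44
    have f47 : ((loop 58 1 (store 6 (add (reg 56) (reg 58)) (load 9 (reg 58)))).exec s₃).reg 47 =
      d * M := (exec_reg 47 rfl).trans e47
    generalize (loop 58 1 (store 6 (add (reg 56) (reg 58)) (load 9 (reg 58)))).exec s₃ = s₄ at *
    have hd' : Knapsack.choice size cost (2 ^ k) n c d = p := by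
      rw [hchoice d (by omega), Knapsack.choice, if_pos rfl]
    simp only [Inv, d2, RAMState.setReg_reg, RAMState.setReg_mem, Nat.reduceEqDiff, reduceIte,
      f44, f47, hcopy, true_and]
    refine ⟨by omega, fun v hv => ?_, fun v hv hvn r hr => ?_⟩
    · rw [hchoice v (by omega), Knapsack.choice, if_neg (by omega)]
    · rcases Nat.eq_or_lt_of_le hv with rfl | hv
      · rw [if_pos (by omega), hd', Nat.add_sub_cancel_left, hb' r hr]
      · have := Nat.mul_le_mul_right k (Nat.succ_le_of_lt hv)
        rw [Nat.succ_mul] at this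
        rw [if_neg (by omega), e6]
        exact hrel v hv hvn r hr

theorem exec_countCommon_of_holdsRel {n k x y : ℕ} {T : ℕ → ℕ} {s : RAMState}
    (hT : HoldsRel n k T s) (h1 : s.reg 1 = k) (h2 : s.reg 2 = n) (h50 : s.reg 50 = x)
    (h51 : s.reg 51 = y) (hx : x < k) (hy : y < k) :
    ((countCommon 6).exec s).reg 52 = PairCode.common n T x y := by
  rw [exec_countCommon, h1, h2, h50, h51, PairCode.common]
  refine Finset.sum_congr rfl fun u hu => ?_
  rw [Finset.mem_range] at hu
  rw [hT u hu x hx, hT u hu y hy]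
  cases (T u).testBit x <;> cases (T u).testBit y <;> simp

/-- Register 45 := one if every resource has a user according to bank 6, zero otherwise. -/
def testComplete : LProg :=
  assign 45 (const 1) ⨟
  loop 59 1 (
    assign 50 (reg 59) ⨟
    assign 51 (reg 59) ⨟
    countCommon 6 ⨟
    ite (reg 52) skip (assign 45 (const 0)))

theorem exec_testComplete {n k : ℕ} {T : ℕ → ℕ} {s : RAMState}
    (hT : HoldsRel n k T s) (h1 : s.reg 1 = k) (h2 : s.reg 2 = n) :
    (testComplete.exec s).reg 45 = 0 ↔ ¬ ∀ r < k, PairCode.common n T r r ≠ 0 := by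
  suffices h : (testComplete.exec s).reg 45 = 0 ↔
      ¬ ∀ r < (s.setReg 45 1).reg 1, PairCode.common n T r r ≠ 0 by
    simpa [h1] using h
  refine exec_loop_induct (i := 59) (b := 1) rfl (s.setReg 45 1)
    (fun j s' => s'.reg 45 = 0 ↔ ¬ ∀ r < j, PairCode.common n T r r ≠ 0) (by simp) ?_
  intro j hj s₁ hs₁ h
  simp only [RAMState.setReg_reg, Nat.reduceEqDiff, reduceIte, h1] at hj
  have g1 : s₁.reg 1 = k := (hs₁.reg 1 rfl).trans (by simp [h1])
  have g2 : s₁.reg 2 = n := (hs₁.reg 2 rfl).trans (by simp [h2])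
  have g6 : s₁.mem 6 = s.mem 6 := hs₁.mem 6 rfl
  simp only [exec_seq, exec_assign, eval, RAMState.setReg_reg, Nat.reduceEqDiff, reduceIte,
    hs₁.counter]
  have hcount := exec_countCommon_of_holdsRel (n := n) (k := k) (x := j) (y := j) (T := T)
    (s := (s₁.setReg 50 j).setReg 51 j) (by simpa [HoldsRel, g6] using hT) (by simp [g1])
    (by simp [g2]) (by simp) (by simp) hj hj
  have e45 : ((countCommon 6).exec ((s₁.setReg 50 j).setReg 51 j)).reg 45 = s₁.reg 45 :=
    (exec_reg 45 rfl).trans (by simp)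
  generalize (countCommon 6).exec ((s₁.setReg 50 j).setReg 51 j) = s₂ at *
  rw [exec_ite, eval, hcount]
  by_cases hc : PairCode.common n T j j = 0
  · simp only [hc, reduceIte, exec_assign, eval, RAMState.setReg_reg, true_iff]
    exact fun h => h j j.lt_succ_self hc
  · simp only [hc, reduceIte, exec_skip, e45, h]
    refine not_congr ⟨fun h r hr => ?_, fun h r hr => h r (by omega)⟩
    rcases Nat.lt_succ_iff_lt_or_eq.1 hr with hr | rfl
    · exact h r hr
    · exact hc

/-- Register 46 := the weight of the constraints on the relation in bank 6. -/
def penalty : LProg :=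
  assign 46 (const 0) ⨟
  loop 60 3 (
    assign 50 (load 3 (reg 60)) ⨟
    assign 51 (load 4 (reg 60)) ⨟
    countCommon 6 ⨟
    mul 61 60 2 62 ⨟
    assign 61 (add (reg 61) (reg 60)) ⨟
    ite (load 2 (reg 60))
      (assign 46 (add (reg 46) (load 5 (add (reg 61) (reg 52)))))
      (ite (reg 52) skip (assign 46 (add (reg 46) (load 5 (reg 61))))))

theorem common_le (n : ℕ) (T : ℕ → ℕ) (r r' : ℕ) : PairCode.common n T r r' ≤ n := by
  refine (Finset.sum_le_card_nsmul _ _ 1 fun u _ => ?_).trans (by simp)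
  split_ifs <;> omega

theorem exec_penalty {n k : ℕ} {I : BSInstance (Fin n) (Fin k)} {T : ℕ → ℕ} {s : RAMState}
    (hT : HoldsRel n k T s) (hs : Loaded I s) :
    (penalty.exec s).reg 46 = I.maskPenalty T := by
  suffices h : (penalty.exec s).reg 46 = ((I.C.take ((s.setReg 46 0).reg 3)).map fun c =>
      c.countWeight (PairCode.common n T c.fst c.snd)).sum by
    simpa [hs.reg_len, BSInstance.maskPenalty] using h
  refine exec_loop_induct (i := 60) (b := 3) rfl (s.setReg 46 0)
    (fun j s' => s'.reg 46 = ((I.C.take j).map fun c =>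
      c.countWeight (PairCode.common n T c.fst c.snd)).sum) (by simp) ?_
  intro j hj s₁ hs₁ h
  simp only [RAMState.setReg_reg, Nat.reduceEqDiff, reduceIte, hs.reg_len] at hj
  have hl₁ : Loaded I s₁ := (hs.setReg _ _ (by decide)).atHead hs₁ rfl
  have g6 : s₁.mem 6 = s.mem 6 := hs₁.mem 6 rfl
  obtain ⟨c, hc⟩ : ∃ c, I.C[j] = c := ⟨_, rfl⟩
  have m2 : s₁.mem 2 j = c.kind := by rw [hl₁.mem 2 (by decide), I.memory_two hj, hc]
  have m3 : s₁.mem 3 j = c.fst := by rw [hl₁.mem 3 (by decide), I.memory_three hj, hc]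
  have m4 : s₁.mem 4 j = c.snd := by rw [hl₁.mem 4 (by decide), I.memory_four hj, hc]
  simp only [exec_seq, exec_assign, eval, RAMState.setReg_reg, RAMState.setReg_mem,
    Nat.reduceEqDiff, reduceIte, hs₁.counter, m3, m4]
  have hcount := exec_countCommon_of_holdsRel (n := n) (k := k) (x := c.fst) (y := c.snd) (T := T)
    (s := (s₁.setReg 50 c.fst).setReg 51 c.snd) (by simpa [HoldsRel, g6] using hT)
    (by simp [hl₁.reg_k]) (by simp [hl₁.reg_n]) (by simp) (by simp) c.fst_lt c.snd_lt
  have hl₂ : Loaded I ((countCommon 6).exec ((s₁.setReg 50 c.fst).setReg 51 c.snd)) :=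
    ((hl₁.setReg _ _ (by decide)).setReg _ _ (by decide)).exec _ rfl
  have e46 : ((countCommon 6).exec ((s₁.setReg 50 c.fst).setReg 51 c.snd)).reg 46 = s₁.reg 46 :=
    (exec_reg 46 rfl).trans (by simp)
  have e60 : ((countCommon 6).exec ((s₁.setReg 50 c.fst).setReg 51 c.snd)).reg 60 = j :=
    (exec_reg 60 rfl).trans (by simp [hs₁.counter])
  generalize (countCommon 6).exec ((s₁.setReg 50 c.fst).setReg 51 c.snd) = s₂ at *
  have q2 : s₂.mem 2 j = c.kind := by rw [hl₂.mem 2 (by decide), I.memory_two hj, hc]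
  have t0 : I.memory 5 (j * n + j) = c.table 0 := by
    rw [← hc, ← I.memory_five hj n.succ_pos]; ring_nf
  have tc := I.memory_five hj (Nat.lt_succ_of_le (common_le n T c.fst c.snd))
  rw [hc, show ∀ c, j * (n + 1) + c = j * n + j + c by intro c; ring] at tc
  rw [List.take_succ_eq_append_getElem hj, List.map_append, List.sum_append, ← h, hc]
  rw [exec_mul _ (by decide) (by decide) (by decide) (by decide)]
  simp only [exec_ite, exec_skip, exec_assign, eval, RAMState.setReg_reg, RAMState.setReg_mem,
    Nat.reduceEqDiff, reduceIte, e46, e60, hl₂.reg_n, q2, hl₂.mem 5 (by decide), hcount, t0, tc,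
    List.map_cons, List.map_nil, List.sum_cons, List.sum_nil, add_zero]
  clear tc t0 q2 hcount m2 m3 m4
  generalize PairCode.common n T c.fst c.snd = x
  cases c with
  | bodE r r' l hl =>
    simp only [BSConstraint.kind, reduceIte, BSConstraint.table, BSConstraint.countWeight]
    by_cases hx : x = 0 <;> simp [hx, e46]
  | sodU r r' f =>
    simp [BSConstraint.kind, BSConstraint.table, BSConstraint.countWeight]

end LProg

/-- The state holds the instance, the codes of all sets of resources, and the solution of the
knapsack problem. -/
structure Ready {n k : ℕ} (I : BSInstance (Fin n) (Fin k)) (s : RAMState) : Prop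
    extends Loaded I s where
  reg_bound : s.reg 7 = BSInstance.codeBound k
  reg_last : s.reg 30 = n * BSInstance.codeBound k
  powers : ∀ r < k, s.mem 8 r = 2 ^ r
  codes : ∀ T < 2 ^ k, s.mem 14 T = PairCode.code k (k * k + 1) T
  table : LProg.TableAt (PairCode.code k (k * k + 1)) I.maskAuth (2 ^ k) (BSInstance.codeBound k)
    n 0 s

namespace LProg

/-- The program changes neither the instance nor the tables. -/
def keepsTables (p : LProg) : Bool :=
  p.keepsInput && ([7, 30].all fun i => !p.writesReg i) &&
    [8, 14, 15, 16].all fun b => !p.writesMem b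

end LProg

namespace Ready

variable {n k : ℕ} {I : BSInstance (Fin n) (Fin k)} {s s' : RAMState}

theorem congr (h : Ready I s) (hl : Loaded I s') (hr : ∀ x ∈ [7, 30], s'.reg x = s.reg x)
    (hm : ∀ b ∈ [8, 14, 15, 16], s'.mem b = s.mem b) : Ready I s' where
  toLoaded := hl
  reg_bound := (hr 7 (by decide)).trans h.reg_bound
  reg_last := (hr 30 (by decide)).trans h.reg_last
  powers := by rw [hm 8 (by decide)]; exact h.powers
  codes := by rw [hm 14 (by decide)]; exact h.codes
  table := by
    rw [LProg.TableAt, hm 15 (by decide), hm 16 (by decide)]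
    exact h.table

theorem exec (h : Ready I s) (p : LProg) (hp : p.keepsTables = true) : Ready I (p.exec s) := by
  simp only [LProg.keepsTables, Bool.and_eq_true, List.all_eq_true, Bool.not_eq_true'] at hp
  exact h.congr (h.toLoaded.exec p hp.1.1) (fun x hx => LProg.exec_reg x (hp.1.2 x hx))
    fun b hb => LProg.exec_mem b (hp.2 b hb)

theorem atHead {i b j : ℕ} {p : LProg} (h : Ready I s) (hs : LProg.AtHead i b p s j s')
    (hp : (LProg.loop i b p).keepsTables = true) : Ready I s' := by
  simp only [LProg.keepsTables, Bool.and_eq_true, List.all_eq_true, Bool.not_eq_true'] at hp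
  exact h.congr (h.toLoaded.atHead hs hp.1.1) (fun x hx => hs.reg x (hp.1.2 x hx))
    fun b hb => hs.mem b (hp.2 b hb)

theorem value_eq (h : Ready I s) {c : ℕ} (hc : c < BSInstance.codeBound k) :
    s.mem 15 (n * BSInstance.codeBound k + c) =
      Knapsack.value (PairCode.code k (k * k + 1)) I.maskAuth (2 ^ k) n c := by
  rw [h.table.1 _ (by rw [Nat.succ_mul]; omega), Nat.mul_add_div_of_lt hc,
    Nat.mul_add_mod_of_lt' hc]

theorem holdsRel (h : Ready I s) {c : ℕ} (hc : c < BSInstance.codeBound k)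
    (h44 : s.reg 44 = c) : LProg.HoldsRel n k (I.codeChoice c) (LProg.writeRel.exec s) :=
  LProg.exec_writeRel h.reg_k h.reg_n h.reg_bound h.reg_last h44 hc h.powers h.codes h.table.2

end Ready

/-! ### The search through all codes -/

namespace LProg

open RAMExpr

/-- Register 43 := one more than the minimum weight of a complete relation with the code in
register 42, or zero if there is none. -/
def evalCode : LProg :=
  assign 43 (load 15 (add (reg 30) (reg 42))) ⨟
  ite (reg 43)
    (assign 44 (reg 42) ⨟
      writeRel ⨟
      testComplete ⨟
      penalty ⨟
      ite (reg 45) (assign 43 (add (reg 43) (reg 46))) (assign 43 (const 0)))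
    skip

theorem exec_evalCode {n k c : ℕ} {I : BSInstance (Fin n) (Fin k)} {s : RAMState}
    (hs : Ready I s) (h42 : s.reg 42 = c) (hc : c < BSInstance.codeBound k) :
    (evalCode.exec s).reg 43 = I.codeValue c := by
  simp only [evalCode, exec_seq, exec_assign, exec_ite, exec_skip, eval, RAMState.setReg_reg,
    reduceIte, h42, hs.reg_last, hs.value_eq hc, BSInstance.codeValue, Nat.reduceEqDiff]
  generalize hv : Knapsack.value (PairCode.code k (k * k + 1)) I.maskAuth (2 ^ k) n c = v
  by_cases h0 : v = 0
  · simp [h0]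
  obtain ⟨s₁, hs₁⟩ : ∃ s₁, s₁ = (s.setReg 43 v).setReg 44 c := ⟨_, rfl⟩
  rw [← hs₁]
  have hr₁ : Ready I s₁ := by
    rw [hs₁]
    exact (hs.exec (assign 43 (const v)) rfl).exec (assign 44 (const c)) rfl
  have hT := hr₁.holdsRel hc (by simp [hs₁])
  have hr₂ : Ready I (writeRel.exec s₁) := hr₁.exec _ rfl
  have e43 : (writeRel.exec s₁).reg 43 = v := (exec_reg 43 rfl).trans (by simp [hs₁])
  generalize writeRel.exec s₁ = s₂ at *
  have hcomp := exec_testComplete hT hr₂.reg_k hr₂.reg_n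
  have hr₃ : Ready I (testComplete.exec s₂) := hr₂.exec _ rfl
  have f43 : (testComplete.exec s₂).reg 43 = v := (exec_reg 43 rfl).trans e43
  have f6 : (testComplete.exec s₂).mem 6 = s₂.mem 6 := exec_mem 6 rfl
  generalize testComplete.exec s₂ = s₃ at *
  have hpen := exec_penalty (T := I.codeChoice c) (by simpa only [HoldsRel, f6] using hT)
    hr₃.toLoaded
  have g43 : (penalty.exec s₃).reg 43 = v := (exec_reg 43 rfl).trans f43
  have g45 : (penalty.exec s₃).reg 45 = s₃.reg 45 := exec_reg 45 rfl
  simp only [h0, reduceIte, g43, g45, hcomp, ne_eq, not_false_eq_true, true_and, hpen]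
  by_cases hall : ∀ r < k, ¬ PairCode.common n (I.codeChoice c) r r = 0
  · rw [if_neg (not_not.2 hall), if_pos hall]
    simp
  · rw [if_pos hall, if_neg hall]
    simp

/-- Write a complete relation of minimum weight to bank 6. -/
def optimum : LProg :=
  assign 40 (const 0) ⨟
  assign 41 (const 0) ⨟
  loop 42 7 (evalCode ⨟ minStep 40 41 43 42) ⨟
  -- Bank 6 still holds the relation for the last code that was expanded, so the best one is written
  -- again.
  assign 44 (reg 41) ⨟
  writeRel

theorem codeBound_pos (k : ℕ) : 0 < BSInstance.codeBound k := by
  unfold BSInstance.codeBound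
  positivity

theorem exec_optimum {n k : ℕ} {I : BSInstance (Fin n) (Fin k)} {s : RAMState}
    (hs : Ready I s) :
    HoldsRel n k (I.codeChoice (minUpTo I.codeValue (BSInstance.codeBound k)).2)
      (optimum.exec s) := by
  simp only [optimum, exec_seq, exec_assign, eval]
  obtain ⟨s₁, hs₁⟩ : ∃ s₁, s₁ = (s.setReg 40 0).setReg 41 0 := ⟨_, rfl⟩
  rw [← hs₁]
  have hr₁ : Ready I s₁ := by
    rw [hs₁]
    exact (hs.exec (assign 40 (const 0)) rfl).exec (assign 41 (const 0)) rfl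
  have hloop : ((loop 42 7 (evalCode ⨟ minStep 40 41 43 42)).exec s₁).reg 40 =
        (minUpTo I.codeValue (s₁.reg 7)).1 ∧
      ((loop 42 7 (evalCode ⨟ minStep 40 41 43 42)).exec s₁).reg 41 =
        (minUpTo I.codeValue (s₁.reg 7)).2 := by
    refine exec_loop_induct (i := 42) (b := 7) rfl s₁
      (fun j s' => s'.reg 40 = (minUpTo I.codeValue j).1 ∧ s'.reg 41 = (minUpTo I.codeValue j).2)
      (by simp [hs₁, minUpTo]) ?_
    rintro j hj s₂ hs₂ ⟨h40, h41⟩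
    rw [hr₁.reg_bound] at hj
    have hr₂ : Ready I s₂ := hr₁.atHead hs₂ rfl
    have h43 := exec_evalCode hr₂ hs₂.counter hj
    have e40 : (evalCode.exec s₂).reg 40 = s₂.reg 40 := exec_reg 40 rfl
    have e41 : (evalCode.exec s₂).reg 41 = s₂.reg 41 := exec_reg 41 rfl
    have e42 : (evalCode.exec s₂).reg 42 = j := (exec_reg 42 rfl).trans hs₂.counter
    have := exec_minStep _ I.codeValue j (e40.trans h40) (e41.trans h41) h43 e42
    simpa using this
  have hr₂ : Ready I ((loop 42 7 (evalCode ⨟ minStep 40 41 43 42)).exec s₁) := hr₁.exec _ rfl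
  generalize (loop 42 7 (evalCode ⨟ minStep 40 41 43 42)).exec s₁ = s₂ at *
  rw [hr₁.reg_bound] at hloop
  rw [hloop.2]
  refine Ready.holdsRel (hr₂.exec (assign 44 (const _)) rfl)
    (minUpTo_arg_lt _ (codeBound_pos k)) ?_
  simp

/-! ## The whole algorithm -/

/-- The powers of two, and the base of the codes in register 5. -/
def prepareBase : LProg :=
  powers ⨟ mul 5 1 1 9 ⨟ assign 5 (add (reg 5) (const 1))

/-- The place values, and the number of codes in register 7. -/
def preparePlaces : LProg :=
  -- The loop is bounded by the base in register 5, which is polynomial, and not by the huge place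
  -- value in register 6.
  places ⨟ mul 7 6 5 9

/-- Once all dimensions have been computed, find an optimal solution. -/
def solve : LProg :=
  codes ⨟ knapsack ⨟ optimum

theorem exec_prepareBase {n k : ℕ} {I : BSInstance (Fin n) (Fin k)} {s : RAMState}
    (hs : Loaded I s) :
    (prepareBase.exec s).reg 4 = 2 ^ k ∧ (prepareBase.exec s).reg 5 = k * k + 1 ∧
      ∀ r < k, (prepareBase.exec s).mem 8 r = 2 ^ r := by
  obtain ⟨h4, h8⟩ := exec_powers s
  have hl : Loaded I (LProg.powers.exec s) := hs.exec _ rfl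
  rw [hs.reg_k] at h4 h8
  rw [prepareBase, exec_seq, exec_seq,
    exec_mul _ (by decide) (by decide) (by decide) (by decide)]
  generalize LProg.powers.exec s = s₁ at *
  simp only [exec_assign, eval, RAMState.setReg_reg, RAMState.setReg_mem, Nat.reduceEqDiff,
    reduceIte, hl.reg_k]
  exact ⟨h4, trivial, h8⟩

theorem exec_preparePlaces {k : ℕ} {s : RAMState} (h1 : s.reg 1 = k) (h5 : s.reg 5 = k * k + 1)
    (h13 : s.mem 13 = fun _ => 0) :
    (preparePlaces.exec s).reg 6 = (k * k + 1) ^ PairCode.index k (k * k) ∧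
      (preparePlaces.exec s).reg 7 = BSInstance.codeBound k ∧
      ∀ q < k * k, (preparePlaces.exec s).mem 13 q = PairCode.place k (k * k + 1) q := by
  obtain ⟨h6, hp⟩ := exec_places h1 h5 h13
  have e5 : (places.exec s).reg 5 = k * k + 1 := (exec_reg 5 rfl).trans h5
  rw [preparePlaces, exec_seq, exec_mul _ (by decide) (by decide) (by decide) (by decide)]
  generalize places.exec s = s₁ at *
  simp only [RAMState.setReg_reg, RAMState.setReg_mem, Nat.reduceEqDiff, reduceIte, h6, e5,
    true_and]
  exact ⟨rfl, hp⟩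

theorem exec_solve {n k : ℕ} {I : BSInstance (Fin n) (Fin k)} {s : RAMState} (hs : Loaded I s)
    (h4 : s.reg 4 = 2 ^ k) (h6 : s.reg 6 = (k * k + 1) ^ PairCode.index k (k * k))
    (h7 : s.reg 7 = BSInstance.codeBound k) (h8 : ∀ r < k, s.mem 8 r = 2 ^ r)
    (h13 : ∀ q < k * k, s.mem 13 q = PairCode.place k (k * k + 1) q)
    (h15 : s.mem 15 = fun _ => 0) :
    HoldsRel n k (I.codeChoice (minUpTo I.codeValue (BSInstance.codeBound k)).2)
      (solve.exec s) := by
  have h14 := exec_codes hs.reg_k h4 h6 h8 h13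
  have hl : Loaded I (codes.exec s) := hs.exec _ rfl
  have e4 : (codes.exec s).reg 4 = 2 ^ k := (exec_reg 4 rfl).trans h4
  have e7 : (codes.exec s).reg 7 = BSInstance.codeBound k := (exec_reg 7 rfl).trans h7
  have e8 : (codes.exec s).mem 8 = s.mem 8 := exec_mem 8 rfl
  have e15 : (codes.exec s).mem 15 = fun _ => 0 := (exec_mem 15 rfl).trans h15
  rw [solve, exec_seq, exec_seq]
  generalize codes.exec s = s₁ at *
  have hk := exec_knapsack (cost := I.maskAuth) hl.reg_n e7 e4 h14
    (fun u _ T _ => by rw [hl.mem 1 (by decide)]; rfl) e15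
  refine exec_optimum ⟨hl.exec _ rfl, (exec_reg 7 rfl).trans e7, hk.1, ?_, ?_, hk.2⟩
  · rw [exec_mem 8 rfl, e8]
    exact h8
  · rw [exec_mem 14 rfl]
    exact h14

/-- The state from which `solve` starts. -/
def prepared {n k : ℕ} (I : BSInstance (Fin n) (Fin k)) : RAMState :=
  preparePlaces.exec (prepareBase.exec (loadSizes.exec (I.inputState 0 fun _ => 0)))

theorem isSolution_solve {n k : ℕ} (I : BSInstance (Fin n) (Fin k)) (hn : 0 < n) :
    I.toAPEP.IsSolution (outputRel n k (solve.exec (prepared I))) := by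
  have hl₁ := loaded_loadSizes I 0 fun _ => 0
  have z13 := mem_loadSizes I 0 (fun _ => 0) (b := 13) (by decide) (by decide)
  have z15 := mem_loadSizes I 0 (fun _ => 0) (b := 15) (by decide) (by decide)
  rw [prepared]
  generalize loadSizes.exec (I.inputState 0 fun _ => 0) = s₁ at *
  obtain ⟨h4, h5, h8⟩ := exec_prepareBase hl₁
  have hl₂ : Loaded I (prepareBase.exec s₁) := hl₁.exec _ rfl
  have y13 : (prepareBase.exec s₁).mem 13 = fun _ => 0 := (exec_mem 13 rfl).trans z13
  have y15 : (prepareBase.exec s₁).mem 15 = fun _ => 0 := (exec_mem 15 rfl).trans z15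
  generalize prepareBase.exec s₁ = s₂ at *
  obtain ⟨h6, h7, h13⟩ := exec_preparePlaces hl₂.reg_k h5 y13
  have hrel := exec_solve (hl₂.exec preparePlaces rfl) ((exec_reg 4 rfl).trans h4) h6 h7
    (by rw [exec_mem 8 rfl]; exact h8) h13 ((exec_mem 15 rfl).trans y15)
  convert I.isSolution_of_minUpTo hn
  ext ⟨u, r⟩
  rw [outputRel, relOfMasks, Finset.mem_filter_univ, Finset.mem_filter_univ, hrel u u.2 r r.2]
  simp

end LProg

/-! ### The running time -/

namespace LProg

/-- Only the loops over the sets of resources (register 4) and over the codes (register 7) are long.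
They are nested at most once, when a knapsack row runs through all picks for each code, hence the
product. -/
theorem time_solve_le : ∃ c : ℕ, ∀ (v : ℕ → ℕ) (X : ℕ), 0 < X → 0 < v 4 → 0 < v 7 →
    v 1 ≤ X → v 2 ≤ X → v 3 ≤ X → solve.time v ≤ c * X ^ solve.depth * (v 7 * v 4) := by
  obtain ⟨c, hc⟩ := solve.time_le_largeTime [4, 7]
  refine ⟨c, fun v X hX h4 h7 h1 h2 h3 => ?_⟩
  have h : ∀ b ∈ solve.bounds, b ∉ [4, 7] → b = 1 ∨ b = 2 ∨ b = 3 := by decide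
  refine (hc v X hX (by simp [h4, h7]) fun b hb hb' => ?_).trans (Nat.mul_le_mul_left _ ?_)
  · obtain rfl | rfl | rfl := h b hb hb' <;> assumption
  · have e : solve.largeTime [4, 7] v = max (v 4) (max (v 7 * v 4) (v 7)) := by
      have e4 : max 1 (v 4) = v 4 := max_eq_right h4
      have e7 : max 1 (v 7) = v 7 := max_eq_right h7
      simp [e4, e7, solve, codes, knapsack, optimum, largeTime, bits, pairSum, knapsackRow, knapsackCell,
        evalCode, writeRel, minStep, mul, testComplete, penalty, countCommon, max_comm _ 1]
      rw [← max_assoc, max_comm _ 1, e4]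
    rw [e]
    exact max_le (Nat.le_mul_of_pos_left _ h7) (max_le le_rfl (Nat.le_mul_of_pos_right _ h4))

end LProg

/-- For k ≥ 2 one has k² + 1 ≤ k³ and 2 ≤ k, so k(k+1)/2 digits and the factor 2^k cost at most the
exponent 3k(k+1)/2 + k ≤ 2k² + 4 of k. The surplus k⁴ and the top digit's range k² + 1 ≤ 2X² go into
the polynomial factor. The case k = 1, where k² + 1 > k³, is what the factor 4 inside 8 = 4 · 2 pays
for. -/
theorem BSInstance.codeBound_mul_two_pow_le {k X : ℕ} (hk : k ≤ X) (hX : 0 < X) :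
    codeBound k * 2 ^ k ≤ 8 * (k ^ (2 * k ^ 2) * X ^ 6) := by
  have hB : k * k + 1 ≤ 2 * X ^ 2 := by nlinarith
  suffices h : (k * k + 1) ^ PairCode.index k (k * k) * 2 ^ k ≤ 4 * (k ^ (2 * k ^ 2) * X ^ 4) by
    calc codeBound k * 2 ^ k
        = (k * k + 1) ^ PairCode.index k (k * k) * 2 ^ k * (k * k + 1) := by
          rw [codeBound]; ring
      _ ≤ 4 * (k ^ (2 * k ^ 2) * X ^ 4) * (2 * X ^ 2) := Nat.mul_le_mul h hB
      _ = 8 * (k ^ (2 * k ^ 2) * X ^ 6) := by ring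
  have hP := PairCode.two_mul_index_mul_self k
  have hX4 : 0 < X ^ 4 := Nat.pow_pos hX
  obtain rfl | rfl | hk2 : k = 0 ∨ k = 1 ∨ 2 ≤ k := by omega
  · have : PairCode.index 0 (0 * 0) = 0 := by omega
    rw [this]
    simp
    omega
  · have : PairCode.index 1 (1 * 1) = 1 := by omega
    rw [this]
    simp
    omega
  · have h1 : k * k + 1 ≤ k ^ 3 := by nlinarith [Nat.mul_le_mul_right (k * k) hk2]
    have h2 : 4 ≤ k ^ 2 := by nlinarith
    have h3 : 3 * (k * (k + 1)) + 2 * k ≤ 4 * k ^ 2 + 8 := by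
      obtain ⟨m, rfl⟩ : ∃ m, k = m + 2 := ⟨k - 2, by omega⟩
      rcases m with _ | _ | m
      · norm_num
      · norm_num
      · ring_nf
        nlinarith
    -- Squaring turns the exponent k(k+1)/2 into k(k+1) and avoids halving.
    have h4 : ((k * k + 1) ^ PairCode.index k (k * k) * 2 ^ k) ^ 2 ≤ (k ^ (2 * k ^ 2) * k ^ 4) ^ 2 :=
      calc ((k * k + 1) ^ PairCode.index k (k * k) * 2 ^ k) ^ 2
          = (k * k + 1) ^ (k * (k + 1)) * 4 ^ k := by
            rw [mul_pow, ← pow_mul, ← hP, mul_comm 2, pow_right_comm 2]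
            rfl
        _ ≤ (k ^ 3) ^ (k * (k + 1)) * (k ^ 2) ^ k :=
            Nat.mul_le_mul (Nat.pow_le_pow_left h1 _) (Nat.pow_le_pow_left h2 _)
        _ = k ^ (3 * (k * (k + 1)) + 2 * k) := by rw [← pow_mul, ← pow_mul, ← pow_add]
        _ ≤ k ^ (4 * k ^ 2 + 8) := Nat.pow_le_pow_right (by omega) h3
        _ = (k ^ (2 * k ^ 2) * k ^ 4) ^ 2 := by
            rw [← pow_add, ← pow_mul]
            congr 1
            ring
    calc (k * k + 1) ^ PairCode.index k (k * k) * 2 ^ k ≤ k ^ (2 * k ^ 2) * k ^ 4 :=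
          (Nat.pow_le_pow_iff_left two_ne_zero).1 h4
      _ ≤ k ^ (2 * k ^ 2) * X ^ 4 := Nat.mul_le_mul_left _ (Nat.pow_le_pow_left hk 4)
      _ ≤ _ := Nat.le_mul_of_pos_left _ (by norm_num)

open LProg

theorem valuedAPEPBoDESoDU_solvable :
    valuedAPEPBoDESoDU.SolvableInOStar fun k => ((k ^ (2 * k ^ 2) : ℕ) : ℝ) := by
  obtain ⟨c₁, hc₁⟩ := loadSizes.time_le_of_bounds_le
  obtain ⟨c₂, hc₂⟩ := prepareBase.time_le_of_bounds_le
  obtain ⟨c₃, hc₃⟩ := preparePlaces.time_le_of_bounds_le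
  obtain ⟨c₄, hc₄⟩ := time_solve_le
  -- Again one constant for factor and exponent: 2^depth and the doubled depth stem from the loop
  -- bound 2X² of `preparePlaces`, and 8 and 6 from `codeBound_mul_two_pow_le`.
  set C := c₁ + c₂ + c₃ * 2 ^ preparePlaces.depth + c₄ * 8 + loadSizes.depth + prepareBase.depth +
    2 * preparePlaces.depth + solve.depth + 6 with hC
  -- Separate stages are needed because each computes loop bounds of later ones, and a well-formed
  -- program does not write its own bounds.
  refine ⟨.seq loadSizes.compile (.seq prepareBase.compile
    (.seq preparePlaces.compile solve.compile)), C, fun (x : NumberedInstance) => ?_⟩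
  have hl₁ := loaded_loadSizes x.I 0 fun _ => 0
  obtain ⟨t₁, ht₁, r₁⟩ := loadSizes.runs rfl (x.I.inputState 0 fun _ => 0)
  have hcorrect := isSolution_solve x.I x.n_pos
  rw [prepared] at hcorrect
  have b₁ := hc₁ (x.I.inputState 0 fun _ => 0).reg x.size x.size_pos fun b hb => by simp [loadSizes, bounds] at hb
  have z13 := mem_loadSizes x.I 0 (fun _ => 0) (b := 13) (by decide) (by decide)
  generalize loadSizes.exec (x.I.inputState 0 fun _ => 0) = s₁ at *
  obtain ⟨t₂, ht₂, r₂⟩ := prepareBase.runs rfl s₁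
  obtain ⟨h4, h5, -⟩ := exec_prepareBase hl₁
  have hl₂ : Loaded x.I (prepareBase.exec s₁) := hl₁.exec _ rfl
  have y13 : (prepareBase.exec s₁).mem 13 = fun _ => 0 := (exec_mem 13 rfl).trans z13
  have hX := x.size_pos
  have hkX : x.k ≤ x.size := by rw [NumberedInstance.size]; omega
  have hnX : x.n ≤ x.size := by rw [NumberedInstance.size]; omega
  have hCX : x.I.C.length ≤ x.size := by rw [NumberedInstance.size]; omega
  have b₂ := hc₂ s₁.reg x.size hX fun b hb => by
    have h : ∀ b ∈ prepareBase.bounds, b = 1 := by decide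
    rw [h b hb, hl₁.reg_k]
    exact hkX
  generalize prepareBase.exec s₁ = s₂ at *
  obtain ⟨t₃, ht₃, r₃⟩ := preparePlaces.runs rfl s₂
  obtain ⟨-, h7, -⟩ := exec_preparePlaces hl₂.reg_k h5 y13
  have hl₃ : Loaded x.I (preparePlaces.exec s₂) := hl₂.exec _ rfl
  have f4 : (preparePlaces.exec s₂).reg 4 = 2 ^ x.k := (exec_reg 4 rfl).trans h4
  have b₃ := hc₃ s₂.reg (2 * x.size ^ 2) (by positivity) fun b hb => by
    have h : ∀ b ∈ preparePlaces.bounds, b = 1 ∨ b = 5 := by decide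
    obtain rfl | rfl := h b hb
    · rw [hl₂.reg_k]
      nlinarith
    · rw [h5]
      nlinarith
  generalize preparePlaces.exec s₂ = s₃ at *
  obtain ⟨t₄, ht₄, r₄⟩ := solve.runs rfl s₃
  have b₄ := hc₄ s₃.reg x.size hX (by rw [f4]; positivity) (by rw [h7]; exact codeBound_pos _)
    (hl₃.reg_k.trans_le hkX) (hl₃.reg_n.trans_le hnX) (hl₃.reg_len.trans_le hCX)
  rw [h7, f4] at b₄
  refine ⟨_, _, r₁.seq (r₂.seq (r₃.seq r₄)), hcorrect, ?_⟩
  change ((t₁ + (t₂ + (t₃ + t₄)) : ℕ) : ℝ) ≤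
    C * (((x.k ^ (2 * x.k ^ 2) : ℕ) : ℝ) * (x.size : ℝ) ^ C)
  have hM := BSInstance.codeBound_mul_two_pow_le hkX hX
  have hK : 0 < x.k ^ (2 * x.k ^ 2) := by
    rcases Nat.eq_zero_or_pos x.k with h | h
    · simp [h]
    · exact Nat.pow_pos h
  generalize x.size = X at *
  generalize x.k ^ (2 * x.k ^ 2) = K at *
  have pow_le : ∀ {d}, d ≤ C → X ^ d ≤ K * X ^ C := fun hd =>
    (Nat.pow_le_pow_right hX hd).trans (Nat.le_mul_of_pos_left _ hK)
  have g₁ : t₁ ≤ c₁ * (K * X ^ C) := ht₁.trans (b₁.trans (Nat.mul_le_mul_left _ (pow_le (by omega))))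
  have g₂ : t₂ ≤ c₂ * (K * X ^ C) := ht₂.trans (b₂.trans (Nat.mul_le_mul_left _ (pow_le (by omega))))
  have g₃ : t₃ ≤ c₃ * 2 ^ preparePlaces.depth * (K * X ^ C) := by
    rw [mul_pow, ← mul_assoc, ← pow_mul] at b₃
    exact ht₃.trans (b₃.trans (Nat.mul_le_mul_left _ (pow_le (by omega))))
  have g₄ : t₄ ≤ c₄ * 8 * (K * X ^ C) :=
    calc t₄ ≤ c₄ * X ^ solve.depth * (8 * (K * X ^ 6)) :=
          ht₄.trans (b₄.trans (Nat.mul_le_mul_left _ hM))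
      _ = c₄ * 8 * (K * X ^ (solve.depth + 6)) := by ring
      _ ≤ _ := Nat.mul_le_mul_left _ (Nat.mul_le_mul_left _ (Nat.pow_le_pow_right hX (by omega)))
  have : t₁ + (t₂ + (t₃ + t₄)) ≤ C * (K * X ^ C) :=
    calc t₁ + (t₂ + (t₃ + t₄))
        ≤ (c₁ + c₂ + c₃ * 2 ^ preparePlaces.depth + c₄ * 8) * (K * X ^ C) := by
          simp only [add_mul]
          omega
      _ ≤ _ := Nat.mul_le_mul_right _ (by omega)
  exact_mod_cast this

/-- For k > 0 the left side is (2^(log₂ k))^(2k²); for k = 0 both sides are 1, the right one as 0^0.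
-/
theorem Real.four_rpow_sq_mul_logb (k : ℕ) :
    (4 : ℝ) ^ ((k : ℝ) ^ 2 * Real.logb 2 k) = ((k ^ (2 * k ^ 2) : ℕ) : ℝ) := by
  rcases Nat.eq_zero_or_pos k with rfl | hk
  · simp
  have hk' : (0 : ℝ) < k := Nat.cast_pos.2 hk
  calc (4 : ℝ) ^ ((k : ℝ) ^ 2 * Real.logb 2 k)
      = ((2 : ℝ) ^ (2 : ℝ)) ^ ((k : ℝ) ^ 2 * Real.logb 2 k) := by norm_num
    _ = ((2 : ℝ) ^ Real.logb 2 k) ^ ((2 * k ^ 2 : ℕ) : ℝ) := by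
        rw [← Real.rpow_mul (by norm_num), ← Real.rpow_mul (by norm_num)]
        push_cast
        ring_nf
    _ = ((k ^ (2 * k ^ 2) : ℕ) : ℝ) := by
        rw [Real.rpow_logb (by norm_num) (by norm_num) hk', Real.rpow_natCast]
        push_cast
        rfl

theorem computable_self_pow : Computable fun k : ℕ => k ^ (2 * k ^ 2) := by
  have hpow : Primrec₂ fun a b : ℕ => a ^ b := Primrec₂.unpaired'.1 Nat.Primrec.pow
  exact (hpow.comp .id (Primrec.nat_mul.comp (.const 2) (hpow.comp .id (.const 2)))).to_comp

theorem mainTheorem5 :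
    -- fixed-parameter tractability, and the running time
    valuedAPEPBoDESoDU.IsFPT ∧
    valuedAPEPBoDESoDU.SolvableInOStar
      (fun k => (4 : ℝ) ^ ((k : ℝ) ^ 2 * Real.logb 2 (k : ℝ))) ∧
    -- the Valued WSP instance
    (∀ (n k : ℕ) (I : BSInstance (Fin n) (Fin k)), 0 < n →
      ((∀ r l hl, BSConstraint.bodE r r l hl ∉ I.C) →
        Fintype.card I.Step ≤ max k (k * (k - 1))) ∧
      (∀ w ∈ I.toWSP.constraints, ValuedWSP.UserIndependent w) ∧
      (∃ m : ℕ, I.toAPEP.IsOPT m ∧ I.toWSP.IsOPT m) ∧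
      (∀ π : I.Step → Fin n, I.toWSP.IsOptimalPlan π →
        I.toAPEP.IsSolution (I.relOfPlan π))) ∧
    -- the reduction and the way back take polynomial time
    computeSteps.IsPolyTime ∧
    computeWSPAuth.IsPolyTime ∧
    computeWSPConstraint.IsPolyTime ∧
    solutionFromPlan.IsPolyTime := by

  refine ⟨⟨_, computable_self_pow, valuedAPEPBoDESoDU_solvable⟩, ?_, fun n k I hn => ?_,
    computeSteps_isPolyTime, computeWSPAuth_isPolyTime, computeWSPConstraint_isPolyTime,
    solutionFromPlan_isPolyTime⟩
  · simp only [Real.four_rpow_sq_mul_logb]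
    exact valuedAPEPBoDESoDU_solvable
  · have : Nonempty (Fin n) := ⟨⟨0, hn⟩⟩
    refine ⟨fun hI => ?_, I.userIndependent_of_mem, I.exists_isOPT,
      fun π hπ => I.isSolution_relOfPlan hπ⟩
    simpa only [Fintype.card_fin] using I.card_step_le hI
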